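/- **Theorem.** Let $n\ge 3$ and $m>0$. Identify the configurations $q=(q_1,\dots,q_{n+1})$ of $n+1$ points of the plane with $\mathbb R^{2n+2}$, with the standard inner product. Give the first $n$ bodies mass $1$ and the last one mass $m$, let $I=\frac12\sum_i m_i|q_i|^2$, $U=\sum_{i<j}\frac{m_im_j}{|q_i-q_j|}$, $f=\sqrt I\,U$, and let $z_0$ be the central $+$ regular $n$-gon configuration $q_k=(\cos k\theta,\sin k\theta)$, $1\le k\le n$, $q_{n+1}=(0,0)$, $\theta=2\pi/n$. Let $H=D^2f(z_0)$. Call $z_0$ *degenerate* (for the mass $m$) if $\ker H$ is not contained in the plane spanned by the scaling direction $z_0$ and the infinitesimal rotation $(q_k^\perp)_k$ of $z_0$, where $(x,y)^\perp=(-y,x)$. The dihedral group $D_n=\langle r,s\rangle$ acts on $\mathbb R^{2n+2}$ by permuting the bodies and applying the corresponding rotation or reflection of the plane ($r$ is the rotation by $\theta$, $s$ the reflection in the first axis). Let $$v_l=(\cos(lk\theta)\,q_k)_k,\quad v_l'=(-\sin(lk\theta)\,q_k^\perp)_k,\quad w_l'=(\sin(lk\theta)\,q_k)_k,\quad w_l=(\cos(lk\theta)\,q_k^\perp)_k,$$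 with zero entry at the central body, and let $e_{2n+1},e_{2n+2}$ be the unit displacements of the central body. 1. (*Block structure*) The vectors $v_0$; $w_0$; $v_{n/2}$; $w_{n/2}$ (the last two only for $n$ even); $v_1,v_1',e_{2n+1}$; $w_1',w_1,e_{2n+2}$; and $v_l,v_l'$; $w_l',w_l$ for $2\le l<n/2$ form a basis of $\mathbb R^{2n+2}$. It is adapted to $D_n$: the lines of $v_0,w_0,v_{n/2},w_{n/2}$ are the one-dimensional representations with $(r,s)\mapsto(1,1),(1,-1),(-1,1),(-1,-1)$ respectively, and for $1\le l<n/2$ the pairs $(v_l,w_l')$ and $(v_l',w_l)$, as well as $(e_{2n+1},e_{2n+2})$ if $l=1$, transform by the two-dimensional representation $\rho_l$ in which $r$ is the rotation by $l\theta$ and $s=\mathrm{diag}(1,-1)$. In this basis $H$ is block-diagonal, with scalar blocks $\lambda_1,\lambda_2$ (on $v_0,w_0$) and, for $n$ even, $\lambda_3,\lambda_4$ (on $v_{n/2},w_{n/2}$); one and the same $3\times3$ block $A_1$ on $(v_1,v_1',e_{2n+1})$ and on $(w_1',w_1,e_{2n+2})$; and, for each $2\le l<n/2$, one and the same $2\times2$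 block $A_l$ on $(v_l,v_l')$ and on $(w_l',w_l)$. Moreover $\lambda_1=\lambda_2=0$. For $n$ even, $n\ge4$, write $A_{n/2}$ for the matrix of $H$ in the basis $(v_{n/2},w_{n/2})$; it is $\mathrm{diag}(\lambda_3,\lambda_4)$. 2. (*Degeneracy criterion*) $z_0$ is degenerate if and only if $\det A_1=0$ or $\det A_l=0$ for some $2\le l\le\lfloor n/2\rfloor$. 3. (*Modes $l\ge2$*) For each $2\le l\le\lfloor n/2\rfloor$ there is at most one $m>0$ for which $\det A_l=0$. 4. (*Mode $l=1$*) If $3\le n\le6$ there is exactly one $m>0$ with $\det A_1=0$; if $n\ge7$ there is none. 5. (*Number of degeneracy values*) The set of those $m>0$ for which $z_0$ is degenerate is finite. Its cardinality $N(n)$ equals the number of modes $1\le l\le\lfloor n/2\rfloor$ for which $\det A_l$ vanishes for some $m>0$, and $$N(3)=1,\qquad N(n)=\lfloor n/2\rfloor-1\ (4\le n\le 6),\qquad N(n)=\lfloor n/2\rfloor-2\ (7\le n\le9),\qquad N(n)=\lfloor n/2\rfloor-1\ (n\ge10).$$ In particular $N(n)$ increases with $n$ for $n\ge7$, in the sense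 that $N(n)\le N(n+1)$ and $N(n)<N(n+2)$. -/

import Mathlib

open scoped Gradient

/-! ### The `n`-body functions

The plane `ℝ²` is identified with `ℂ`, so that rotation by an angle `t` is multiplication by
`exp (i t)`.  There are `n + 1` bodies: the vertices `some k`, `k : ZMod n`, and the centre `none`. -/

/-- The labels of the bodies: `some k` is the `k`-th vertex, `none` is the central body. -/
abbrev Body (n : ℕ) : Type := Option (ZMod n)

/-- The configuration space `ℝ^(2n+2) = (ℝ²)^(n+1)` with its standard inner product. -/
abbrev Config (n : ℕ) : Type := PiLp 2 (fun _ : Body n => ℂ)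

/-- The masses: `1` at every vertex and `m` at the centre. -/
def mass (n : ℕ) (m : ℝ) : Body n → ℝ
  | some _ => 1
  | none => m

/-- The moment of inertia `I = (1/2) ∑ m_i |q_i|²`. -/
noncomputable def inertia (n : ℕ) [NeZero n] (m : ℝ) (q : Config n) : ℝ :=
  (1 / 2) * ∑ i : Body n, mass n m i * ‖q i‖ ^ 2

/-- The Newtonian potential `U = ∑_{i<j} m_i m_j / |q_i - q_j|`
(each unordered pair is met twice, whence the factor `1/2`). -/
noncomputable def potential (n : ℕ) [NeZero n] (m : ℝ) (q : Config n) : ℝ :=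
  (1 / 2) * ∑ i : Body n, ∑ j ∈ Finset.univ.erase i, mass n m i * mass n m j / ‖q i - q j‖

/-- The function `f = √I · U`. -/
noncomputable def sqrtIU (n : ℕ) [NeZero n] (m : ℝ) (q : Config n) : ℝ :=
  Real.sqrt (inertia n m q) * potential n m q

/-- The angle `2πk/n` of the `k`-th vertex. -/
noncomputable def vertexAngle (n : ℕ) (k : ZMod n) : ℝ := 2 * Real.pi * (k.val : ℝ) / n

/-- The `k`-th vertex `(cos (2πk/n), sin (2πk/n))` of the regular `n`-gon. -/
noncomputable def vertex (n : ℕ) (k : ZMod n) : ℂ := Complex.exp (Complex.I * vertexAngle n k)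

/-- The central + regular `n`-gon configuration `z₀`. -/
noncomputable def z0 (n : ℕ) : Config n :=
  WithLp.toLp 2 fun
    | some k => vertex n k
    | none => 0

/-- The Hessian `D²f(z₀)`, as a linear operator on the Euclidean space `ℝ^(2n+2)`: the derivative
at `z₀` of the gradient of `f = √I · U`. -/
noncomputable def hess (n : ℕ) [NeZero n] (m : ℝ) : Config n →L[ℝ] Config n :=
  fderiv ℝ (gradient (sqrtIU n m)) (z0 n)

/-- The infinitesimal rotation of `z₀` about the origin. -/
noncomputable def rotationDirection (n : ℕ) : Config n :=
  WithLp.toLp 2 fun i => Complex.I * z0 n i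

/-- `z₀` is (nontrivially) degenerate: the kernel of the Hessian has an element outside the plane
spanned by the scaling direction `z₀` and the rotation direction, which is the part of the kernel
forced by the invariance of `f` under scalings and rotations. -/
def Degenerate (n : ℕ) [NeZero n] (m : ℝ) : Prop :=
  ∃ v : Config n, hess n m v = 0 ∧ v ∉ Submodule.span ℝ {z0 n, rotationDirection n}

/-! ### The representation of the dihedral group -/

/-- `vertex n` turns addition modulo `n` into multiplication. -/
theorem vertex_add (n : ℕ) [NeZero n] (a b : ZMod n) :
    vertex n (a + b) = vertex n a * vertex n b := by
  have h : ∀ k : ZMod n, vertex n k = ZMod.stdAddChar k := by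
    intro k
    rw [ZMod.stdAddChar_apply, ZMod.toCircle_apply]
    unfold vertex vertexAngle
    congr 1
    push_cast
    ring
  rw [h, h, h, AddChar.map_add_eq_mul]

theorem vertex_zero (n : ℕ) [NeZero n] : vertex n 0 = 1 := by
  simp [vertex, vertexAngle]

theorem conj_vertex (n : ℕ) [NeZero n] (a : ZMod n) :
    (starRingEnd ℂ) (vertex n a) = vertex n (-a) := by
  have h1 : vertex n (-a) * vertex n a = 1 := by rw [← vertex_add]; simp [vertex_zero]
  have h2 : (starRingEnd ℂ) (vertex n a) * vertex n a = 1 := by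
    rw [mul_comm, Complex.mul_conj, Complex.normSq_eq_norm_sq]
    unfold vertex
    rw [mul_comm, Complex.norm_exp_ofReal_mul_I]
    simp
  have h3 : vertex n a ≠ 0 := Complex.exp_ne_zero _
  exact mul_right_cancel₀ h3 (h2.trans h1.symm)

/-- The rotation `r^a`: every position is rotated by `2πa/n`, and the vertex labels are shifted. -/
noncomputable def rotationAction (n : ℕ) [NeZero n] (a : ZMod n) : Config n →ₗ[ℝ] Config n where
  toFun z := WithLp.toLp 2 fun
    | some k => vertex n a * z (some (k - a))
    | none => vertex n a * z none
  map_add' x y := by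
    ext i
    cases i <;> simp [mul_add]
  map_smul' c x := by
    ext i
    cases i <;> simp [mul_left_comm]

/-- The reflection `s`: every position is reflected in the first coordinate axis, and the vertex
labels are reversed. -/
noncomputable def reflectionAction (n : ℕ) [NeZero n] : Config n →ₗ[ℝ] Config n where
  toFun z := WithLp.toLp 2 fun
    | some k => (starRingEnd ℂ) (z (some (-k)))
    | none => (starRingEnd ℂ) (z none)
  map_add' x y := by
    ext i
    cases i <;> simp
  map_smul' c x := by
    ext i
    cases i <;> simp

theorem rotationAction_zero (n : ℕ) [NeZero n] : rotationAction n 0 = 1 := by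
  ext z i
  cases i <;> simp [rotationAction, vertex_zero]

theorem rotationAction_mul (n : ℕ) [NeZero n] (a b : ZMod n) :
    rotationAction n a * rotationAction n b = rotationAction n (a + b) := by
  ext z i
  cases i <;> simp [rotationAction, vertex_add, mul_assoc, sub_sub]

theorem reflectionAction_mul_self (n : ℕ) [NeZero n] :
    reflectionAction n * reflectionAction n = 1 := by
  ext z i
  cases i <;> simp [reflectionAction]

theorem rotationAction_mul_reflectionAction (n : ℕ) [NeZero n] (a : ZMod n) :
    rotationAction n a * reflectionAction n = reflectionAction n * rotationAction n (-a) := by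
  ext z i
  cases i <;> simp [rotationAction, reflectionAction, conj_vertex, sub_eq_add_neg, add_comm]

/-- The underlying map of the representation of `D_n`; in Mathlib `sr a` is `s * r^a`. -/
noncomputable def dihedralAction (n : ℕ) [NeZero n] :
    DihedralGroup n → (Config n →ₗ[ℝ] Config n)
  | .r a => rotationAction n a
  | .sr a => reflectionAction n * rotationAction n a

/-- The representation of the dihedral group `D_n` on the configuration space `ℝ^(2n+2)` that
permutes the bodies and applies the corresponding rotation or reflection of the plane. -/
noncomputable def dihedralRep (n : ℕ) [NeZero n] : Representation ℝ (DihedralGroup n) (Config n) where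
  toFun := dihedralAction n
  map_one' := rotationAction_zero n
  map_mul' x y := by
    have h1 := rotationAction_mul n
    have h2 := reflectionAction_mul_self n
    have h3 := rotationAction_mul_reflectionAction n
    rcases x with a | a <;> rcases y with b | b
    · simp only [DihedralGroup.r_mul_r, dihedralAction, h1]
    · simp only [DihedralGroup.r_mul_sr, dihedralAction]
      rw [← mul_assoc, h3, mul_assoc, h1, neg_add_eq_sub]
    · simp only [DihedralGroup.sr_mul_r, dihedralAction]
      rw [mul_assoc, h1]
    · simp only [DihedralGroup.sr_mul_sr, dihedralAction]
      rw [mul_assoc, ← mul_assoc (rotationAction n a), h3, mul_assoc, h1, ← mul_assoc, h2, one_mul,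
        neg_add_eq_sub]

/-- The one-dimensional representation of `D_n` with `r ↦ a`, `s ↦ b`, where `a, b ∈ {1, -1}`. -/
def dihedralChar (n : ℕ) (a b : ℝ) : DihedralGroup n → ℝ
  | .r k => a ^ k.val
  | .sr k => b * a ^ k.val

/-- The two-dimensional representation `ρ_l` of `D_n`: `r^k` acts as the rotation by `2πlk/n` and
`s` acts as `diag(1, -1)`. -/
noncomputable def dihedralRho (n l : ℕ) : DihedralGroup n → Matrix (Fin 2) (Fin 2) ℝ
  | .r k => !![Real.cos (l * vertexAngle n k), -Real.sin (l * vertexAngle n k);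
               Real.sin (l * vertexAngle n k), Real.cos (l * vertexAngle n k)]
  | .sr k => !![1, 0; 0, -1] *
             !![Real.cos (l * vertexAngle n k), -Real.sin (l * vertexAngle n k);
                Real.sin (l * vertexAngle n k), Real.cos (l * vertexAngle n k)]

/-- The vector `v` spans a line on which `D_n` acts through `χ`. -/
def ActsByChar (n : ℕ) [NeZero n] (χ : DihedralGroup n → ℝ) (v : Config n) : Prop :=
  ∀ g, dihedralRep n g v = χ g • v

/-- In the ordered pair `(u 0, u 1)`, the group `D_n` acts through the matrices `ρ g`. -/
def ActsByMatrix (n : ℕ) [NeZero n] (ρ : DihedralGroup n → Matrix (Fin 2) (Fin 2) ℝ)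
    (u : Fin 2 → Config n) : Prop :=
  ∀ g j, dihedralRep n g (u j) = ∑ i, ρ g i j • u i

/-! ### The symmetry-adapted basis -/

/-- `v_l`: the vector with `k`-th entry `cos (lkθ) (cos kθ, sin kθ)`, `θ = 2π/n`. -/
noncomputable def modeV (n l : ℕ) : Config n :=
  WithLp.toLp 2 fun
    | some k => (Real.cos (l * vertexAngle n k) : ℂ) * vertex n k
    | none => 0

/-- `v_l'`: the vector with `k`-th entry `-sin (lkθ) (-sin kθ, cos kθ)`. -/
noncomputable def modeV' (n l : ℕ) : Config n :=
  WithLp.toLp 2 fun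
    | some k => -(Real.sin (l * vertexAngle n k) : ℂ) * (Complex.I * vertex n k)
    | none => 0

/-- `w_l`: the vector with `k`-th entry `cos (lkθ) (-sin kθ, cos kθ)`. -/
noncomputable def modeW (n l : ℕ) : Config n :=
  WithLp.toLp 2 fun
    | some k => (Real.cos (l * vertexAngle n k) : ℂ) * (Complex.I * vertex n k)
    | none => 0

/-- `w_l'`: the vector with `k`-th entry `sin (lkθ) (cos kθ, sin kθ)`. -/
noncomputable def modeW' (n l : ℕ) : Config n :=
  WithLp.toLp 2 fun
    | some k => (Real.sin (l * vertexAngle n k) : ℂ) * vertex n k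
    | none => 0

/-- `e_{2n+1}`: unit displacement of the central body along the first axis. -/
noncomputable def centerX (n : ℕ) : Config n :=
  WithLp.toLp 2 fun
    | some _ => 0
    | none => 1

/-- `e_{2n+2}`: unit displacement of the central body along the second axis. -/
noncomputable def centerY (n : ℕ) : Config n :=
  WithLp.toLp 2 fun
    | some _ => 0
    | none => Complex.I

/-- The Fourier modes `l` with `2 ≤ l < n/2`. -/
abbrev HighMode (n : ℕ) : Type := {l : Fin n // 2 ≤ l.val ∧ 2 * l.val < n}

/-- The blocks of the decomposition: the scalar blocks of the one-dimensional representations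
`φ₁, φ₂` and, when `n` is even, `φ₃, φ₄`; the two copies `A₁, B₁` of the `3 × 3` block; the two
copies `A_l, B_l` of the `2 × 2` block for `2 ≤ l < n/2`. -/
inductive BlockIndex (n : ℕ) : Type
  | phi1 : BlockIndex n
  | phi2 : BlockIndex n
  | phi3 : PLift (Even n) → BlockIndex n
  | phi4 : PLift (Even n) → BlockIndex n
  | A1 : BlockIndex n
  | B1 : BlockIndex n
  | A : HighMode n → BlockIndex n
  | B : HighMode n → BlockIndex n
  deriving DecidableEq, Fintype

/-- The size of a block. -/
def blockSize (n : ℕ) : BlockIndex n → ℕ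
  | .phi1 => 1
  | .phi2 => 1
  | .phi3 _ => 1
  | .phi4 _ => 1
  | .A1 => 3
  | .B1 => 3
  | .A _ => 2
  | .B _ => 2

/-- The symmetry-adapted vectors of each block. -/
noncomputable def blockVector (n : ℕ) : (β : BlockIndex n) → Fin (blockSize n β) → Config n
  | .phi1 => fun _ => modeV n 0
  | .phi2 => fun _ => modeW n 0
  | .phi3 _ => fun _ => modeV n (n / 2)
  | .phi4 _ => fun _ => modeW n (n / 2)
  | .A1 => ![modeV n 1, modeV' n 1, centerX n]
  | .B1 => ![modeW' n 1, modeW n 1, centerY n]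
  | .A l => ![modeV n l.1, modeV' n l.1]
  | .B l => ![modeW' n l.1, modeW n l.1]

/-- The index set of the symmetry-adapted basis. -/
abbrev AdaptedIndex (n : ℕ) : Type := Σ β : BlockIndex n, Fin (blockSize n β)

/-- The vectors of the blocks transform under `D_n` through its irreducible representations
`φ₁, …, φ₄` and `ρ_l`. -/
def IsSymmetryAdapted (n : ℕ) [NeZero n] : Prop :=
  ActsByChar n (dihedralChar n 1 1) (modeV n 0) ∧
  ActsByChar n (dihedralChar n 1 (-1)) (modeW n 0) ∧
  (Even n → ActsByChar n (dihedralChar n (-1) 1) (modeV n (n / 2)) ∧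
    ActsByChar n (dihedralChar n (-1) (-1)) (modeW n (n / 2))) ∧
  (∀ l : ℕ, 1 ≤ l → 2 * l < n →
    ActsByMatrix n (dihedralRho n l) ![modeV n l, modeW' n l] ∧
    ActsByMatrix n (dihedralRho n l) ![modeV' n l, modeW n l]) ∧
  ActsByMatrix n (dihedralRho n 1) ![centerX n, centerY n]

/-! ### The blocks of the Hessian -/

/-- The coefficients `⟪u_i, T u_j⟫ / ⟪u_i, u_i⟫`.  When the vectors `u_i` are nonzero and mutually
orthogonal and their span is `T`-invariant, this is the matrix of `T` in the basis `u` of it. -/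
noncomputable def coeffMatrix {n : ℕ} [NeZero n] {κ : Type} (T : Config n →L[ℝ] Config n)
    (u : κ → Config n) : Matrix κ κ ℝ :=
  Matrix.of fun i j => inner ℝ (u i) (T (u j)) / inner ℝ (u i) (u i)

/-- The scalar by which the Hessian acts on the line spanned by `v`. -/
noncomputable def scalarBlock (n : ℕ) [NeZero n] (m : ℝ) (v : Config n) : ℝ :=
  inner ℝ v (hess n m v) / inner ℝ v v

/-- The block `A₁` of the Hessian, in the basis `v₁, v₁', e_{2n+1}`. -/
noncomputable def blockA1 (n : ℕ) [NeZero n] (m : ℝ) : Matrix (Fin 3) (Fin 3) ℝ :=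
  coeffMatrix (hess n m) ![modeV n 1, modeV' n 1, centerX n]

/-- The block `A_l` of the Hessian for `2 ≤ l ≤ n/2`, in the basis `v_l, v_l'`.  If `l = n/2`
then `v_l' = 0`, and the mode is spanned by `v_l` and `w_l`. -/
noncomputable def blockA (n : ℕ) [NeZero n] (m : ℝ) (l : ℕ) : Matrix (Fin 2) (Fin 2) ℝ :=
  if 2 * l = n then coeffMatrix (hess n m) ![modeV n l, modeW n l]
  else coeffMatrix (hess n m) ![modeV n l, modeV' n l]

/-- The diagonal blocks of the Hessian in the symmetry-adapted basis: `B₁ = A₁` and `B_l = A_l`. -/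
noncomputable def hessBlock (n : ℕ) [NeZero n] (m : ℝ) :
    (β : BlockIndex n) → Matrix (Fin (blockSize n β)) (Fin (blockSize n β)) ℝ
  | .phi1 => Matrix.of fun _ _ => scalarBlock n m (modeV n 0)
  | .phi2 => Matrix.of fun _ _ => scalarBlock n m (modeW n 0)
  | .phi3 _ => Matrix.of fun _ _ => scalarBlock n m (modeV n (n / 2))
  | .phi4 _ => Matrix.of fun _ _ => scalarBlock n m (modeW n (n / 2))
  | .A1 => blockA1 n m
  | .B1 => blockA1 n m
  | .A l => blockA n m l.1
  | .B l => blockA n m l.1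

/-- The determinant of the block of the mode `l`. -/
noncomputable def modeDet (n : ℕ) [NeZero n] (m : ℝ) (l : ℕ) : ℝ :=
  if l = 1 then (blockA1 n m).det else (blockA n m l).det

/-- The set of positive degeneracy values of the central mass. -/
def degeneracyValues (n : ℕ) [NeZero n] : Set ℝ := {m : ℝ | 0 < m ∧ Degenerate n m}

/-- The set of modes `1 ≤ l ≤ n/2` whose block is singular for some positive central mass. -/
def degenerateModes (n : ℕ) [NeZero n] : Set ℕ :=
  {l : ℕ | 1 ≤ l ∧ l ≤ n / 2 ∧ ∃ m : ℝ, 0 < m ∧ modeDet n m l = 0}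

section

variable {n : ℕ} [NeZero n] {m : ℝ}

/-! ### The gradient and the Hessian of `√I · U` -/

/-! Identify the plane with ℂ and put ζ = exp(2πi/n). With P_l = ½ ∑_t (1 - cos ltθ) / |1 - ζ^t|³
the configuration satisfies ∇U = -λ M z₀, λ = m + 2P₁, and this gives the Hessian at z₀ in closed
form (`hess_apply`): √(n/2) times λM plus D²U minus a rank-one term along z₀. A displacement with
vertex entries (αζ^{lk} + βζ^{-lk})ζ^k, l ≠ 0, keeps its frequency on the vertices: up to √(n/2),
(α, β) becomes (Aα + Bβ̄, Dβ + Bᾱ) with A = P_{l+1} + 2P₁ + 3m/2, D = P_{l-1} + 2P₁ + 3m/2, B = 3(P₁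
- P_l) + 3m/2. Only l = ±1 interacts with the centre. Real and purely imaginary pairs (α, β) produce
the two equal copies of each block, and Fourier inversion shows that these modes fill the space. The
kernel is therefore read off block by block.

For l ≥ 2 the determinant is (n/2)(AD - B²). Its m² terms cancel, and the coefficient of m is a
positive multiple of 8P_l - 2P₁ + R_l, where R_l = P_{l+1} + P_{l-1} - 2P_l. So each such mode has
exactly one real root (`det_blockA_eq_zero_iff`), and only its sign is in question. For l = 1,
translations split off a positive factor, and what remains is a positive constant plus (3m/2)(S -
k/2 - n), with S = ∑ 1/sin(πj/n) and k = cot(π/2n).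

The roots of the modes l ≥ 2 increase strictly with l (`gonF_strictMono`). Indeed R_l - R_{l+1} = ½
cot((2l+1)π/2n), so R decreases up to n/2; hence the first differences of P are concave and positive
there, and two consecutive ones are comparable. It then suffices to know the sign of the root in
mode 2 (negative for n ≤ 9, positive for n ≥ 10), in mode 3 (positive as soon as the mode exists, n
≥ 6), and the sign of S - k/2 - n (negative for n ≤ 6, positive for n ≥ 7). Small n are settled by
Taylor bounds, large n by a two-term lower bound for the cosecant. Finally the masses of different
singular modes differ: by monotonicity for l ≥ 2, and by a numerical comparison for modes 1 and 3 of
the hexagon, the only n at which mode 1 has a competitor. -/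

theorem hasDerivAt_norm_line {E : Type*} [NormedAddCommGroup E] [InnerProductSpace ℝ E] {a b : E}
    (ha : a ≠ 0) : HasDerivAt (fun t : ℝ => ‖a + t • b‖) (inner ℝ a b / ‖a‖) 0 := by
  have h1 : HasDerivAt (fun t : ℝ => a + t • b) b 0 := by
    simpa using ((hasDerivAt_id (0 : ℝ)).smul_const b).const_add a
  have h2 := h1.norm_sq.sqrt (by simpa using ha)
  have h3 : (fun t : ℝ => ‖a + t • b‖) = fun t : ℝ => √(‖a + t • b‖ ^ 2) := by
    funext t
    rw [Real.sqrt_sq (norm_nonneg _)]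
  rw [h3]
  convert h2 using 1
  simp only [zero_smul, add_zero, Real.sqrt_sq (norm_nonneg a)]
  field_simp

/-- The configuration has no collisions. -/
def CollisionFree (q : Config n) : Prop := ∀ i j : Body n, i ≠ j → q i ≠ q j

/-- The gradient of the potential. -/
noncomputable def potentialGrad (n : ℕ) [NeZero n] (m : ℝ) (q : Config n) (i : Body n) : ℂ :=
  ∑ j ∈ Finset.univ.erase i, (-(mass n m i * mass n m j) / ‖q i - q j‖ ^ 3) • (q i - q j)

/-- The gradient of `√I · U` at collision-free configurations. -/
noncomputable def sqrtIUGrad (n : ℕ) [NeZero n] (m : ℝ) (q : Config n) : Config n :=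
  WithLp.toLp 2 fun i => (potential n m q / (2 * √(inertia n m q)) * mass n m i) • q i
    + √(inertia n m q) • potentialGrad n m q i

theorem config_inner (x y : Config n) : inner ℝ x y = ∑ i, inner ℝ (x i) (y i) :=
  PiLp.inner_apply x y

theorem inertia_hasDerivAt (q v : Config n) :
    HasDerivAt (fun t : ℝ => inertia n m (q + t • v))
      (∑ i, mass n m i * inner ℝ (q i) (v i)) 0 := by
  have h : ∀ i, HasDerivAt (fun t : ℝ => mass n m i * ‖(q + t • v) i‖ ^ 2)
      (mass n m i * (2 * inner ℝ (q i) (v i))) 0 := by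
    intro i
    have h1 : HasDerivAt (fun t : ℝ => q i + t • v i) (v i) 0 := by
      simpa using ((hasDerivAt_id (0 : ℝ)).smul_const (v i)).const_add (q i)
    simpa using h1.norm_sq.const_mul (mass n m i)
  have h2 := (HasDerivAt.fun_sum (u := Finset.univ) fun i _ => h i).const_mul (1 / 2 : ℝ)
  refine h2.congr_deriv ?_
  rw [Finset.mul_sum]
  exact Finset.sum_congr rfl fun i _ => by ring

/-- Exchanging i and j flips the sign of x_i - x_j, so the terms in y_j contribute as much as those
in y_i. The resulting factor 2 absorbs the ½ in the potential; the identity gives both its gradient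
and Euler's relation `potential_eq`. -/
theorem sum_sum_erase_antisymm {α : Type*} [Fintype α] [DecidableEq α] (c : α → α → ℝ)
    (hc : ∀ i j, c i j = c j i) (x y : α → ℂ) :
    ∑ i, ∑ j ∈ Finset.univ.erase i, c i j * inner ℝ (x i - x j) (y i - y j) =
      2 * ∑ i, ∑ j ∈ Finset.univ.erase i, c i j * inner ℝ (x i - x j) (y i) := by
  have e : ∀ F : α → α → ℝ, ∑ i, ∑ j ∈ Finset.univ.erase i, F i j =
      ∑ i, ∑ j, if i = j then 0 else F i j := by
    intro F
    refine Finset.sum_congr rfl fun i _ => ?_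
    rw [← Finset.sum_erase_add _ _ (Finset.mem_univ i)]
    simp only [if_true, add_zero]
    refine Finset.sum_congr rfl fun j hj => ?_
    rw [if_neg (Finset.ne_of_mem_erase hj).symm]
  have h1 : ∑ i, ∑ j ∈ Finset.univ.erase i, c i j * inner ℝ (x i - x j) (y j) =
      - ∑ i, ∑ j ∈ Finset.univ.erase i, c i j * inner ℝ (x i - x j) (y i) := by
    rw [e, e, Finset.sum_comm, ← Finset.sum_neg_distrib]
    refine Finset.sum_congr rfl fun i _ => ?_
    rw [← Finset.sum_neg_distrib]
    refine Finset.sum_congr rfl fun j _ => ?_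
    by_cases h : i = j
    · simp [h]
    · rw [if_neg h, if_neg (Ne.symm h), hc, ← neg_sub (x i) (x j), inner_neg_left]
      ring
  simp only [inner_sub_right, mul_sub, Finset.sum_sub_distrib]
  rw [h1]
  ring

theorem potential_hasDerivAt {q : Config n} (hq : CollisionFree q) (v : Config n) :
    HasDerivAt (fun t : ℝ => potential n m (q + t • v))
      (∑ i, inner ℝ (potentialGrad n m q i) (v i)) 0 := by
  have h : ∀ i, ∀ j ∈ Finset.univ.erase i,
      HasDerivAt (fun t : ℝ => mass n m i * mass n m j / ‖(q + t • v) i - (q + t • v) j‖)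
      ((-(mass n m i * mass n m j) / ‖q i - q j‖ ^ 3) * inner ℝ (q i - q j) (v i - v j)) 0 := by
    intro i j hj
    have hne : q i - q j ≠ 0 := sub_ne_zero.2 (hq i j (Finset.ne_of_mem_erase hj).symm)
    have hn : ‖q i - q j‖ ≠ 0 := norm_ne_zero_iff.2 hne
    have h1 := ((hasDerivAt_norm_line (b := v i - v j) hne).inv (by simpa using hn)).const_mul
      (mass n m i * mass n m j)
    have h2 : (fun t : ℝ => mass n m i * mass n m j / ‖(q + t • v) i - (q + t • v) j‖) =
        fun t : ℝ => mass n m i * mass n m j * ‖q i - q j + t • (v i - v j)‖⁻¹ := by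
      funext t
      rw [div_eq_mul_inv]
      congr 3
      simp only [PiLp.add_apply, PiLp.smul_apply, smul_sub]
      ring
    rw [h2]
    refine h1.congr_deriv ?_
    rw [zero_smul, add_zero]
    field_simp
  have h2 := (HasDerivAt.fun_sum (u := Finset.univ) fun i _ =>
    HasDerivAt.fun_sum fun j hj => h i j hj).const_mul (1 / 2 : ℝ)
  refine h2.congr_deriv ?_
  rw [sum_sum_erase_antisymm (fun i j => -(mass n m i * mass n m j) / ‖q i - q j‖ ^ 3)
    (fun i j => by rw [norm_sub_rev, mul_comm (mass n m i)])]
  rw [← mul_assoc, one_div, inv_mul_cancel₀ two_ne_zero, one_mul]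
  refine Finset.sum_congr rfl fun i _ => ?_
  rw [potentialGrad, sum_inner]
  refine Finset.sum_congr rfl fun j _ => ?_
  rw [real_inner_smul_left]

theorem inertia_differentiable : Differentiable ℝ (inertia n m) := by
  unfold inertia
  have h : ∀ i : Body n, Differentiable ℝ fun q : Config n => ‖q i‖ ^ 2 := by
    intro i
    have : Differentiable ℝ fun q : Config n => q i := by fun_prop
    exact this.norm_sq ℝ
  fun_prop

theorem config_norm_sub_differentiableAt {q : Config n} (hq : CollisionFree q) {i j : Body n}
    (h : i ≠ j) : DifferentiableAt ℝ (fun q : Config n => ‖q i - q j‖) q := by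
  have : DifferentiableAt ℝ (fun q : Config n => q i - q j) q := by fun_prop
  exact this.norm ℝ (sub_ne_zero.2 (hq i j h))

theorem potential_differentiableAt {q : Config n} (hq : CollisionFree q) :
    DifferentiableAt ℝ (potential n m) q := by
  unfold potential
  refine DifferentiableAt.const_mul (DifferentiableAt.fun_sum fun i _ =>
    DifferentiableAt.fun_sum fun j hj => ?_) _
  have hij := (Finset.ne_of_mem_erase hj).symm
  simp only [div_eq_mul_inv]
  exact ((config_norm_sub_differentiableAt hq hij).fun_inv (norm_ne_zero_iff.2 (sub_ne_zero.2 (hq i j hij)))).const_mul _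

theorem potentialGrad_differentiableAt {q : Config n} (hq : CollisionFree q) (i : Body n) :
    DifferentiableAt ℝ (fun q : Config n => potentialGrad n m q i) q := by
  unfold potentialGrad
  refine DifferentiableAt.fun_sum fun j hj => ?_
  have hij := (Finset.ne_of_mem_erase hj).symm
  refine DifferentiableAt.fun_smul ?_ (by fun_prop)
  simp only [div_eq_mul_inv]
  exact (((config_norm_sub_differentiableAt hq hij).fun_pow 3).fun_inv
    (pow_ne_zero 3 (norm_ne_zero_iff.2 (sub_ne_zero.2 (hq i j hij))))).const_mul _

theorem sqrtIU_differentiableAt {q : Config n} (hq : CollisionFree q) (hI : inertia n m q ≠ 0) :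
    DifferentiableAt ℝ (sqrtIU n m) q :=
  ((inertia_differentiable q).sqrt hI).mul (potential_differentiableAt hq)

/-- Differentiability is established qualitatively; derivatives are then identified along lines, by
uniqueness of one-variable derivatives, so that no Fréchet derivative has to be computed. -/
theorem line_hasDerivAt {q : Config n} {F : Type*} [NormedAddCommGroup F] [NormedSpace ℝ F]
    {f : Config n → F} (hf : DifferentiableAt ℝ f q) (v : Config n) :
    HasDerivAt (fun t : ℝ => f (q + t • v)) (fderiv ℝ f q v) 0 := by
  have h1 : HasDerivAt (fun t : ℝ => q + t • v) v 0 := by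
    simpa using ((hasDerivAt_id (0 : ℝ)).smul_const v).const_add q
  have h2 : HasFDerivAt f (fderiv ℝ f q) (q + (0 : ℝ) • v) := by simpa using hf.hasFDerivAt
  exact h2.comp_hasDerivAt (0 : ℝ) h1

theorem sqrtIU_hasGradientAt {q : Config n} (hq : CollisionFree q) (hI : 0 < inertia n m q) :
    HasGradientAt (sqrtIU n m) (sqrtIUGrad n m q) q := by
  have hd := sqrtIU_differentiableAt hq hI.ne'
  rw [hasGradientAt_iff_hasFDerivAt]
  refine hd.hasFDerivAt.congr_fderiv (ContinuousLinearMap.ext fun v => ?_)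
  have h1 := line_hasDerivAt hd v
  have h2 := ((inertia_hasDerivAt (m := m) q v).sqrt (by simpa using hI.ne')).mul
    (potential_hasDerivAt (m := m) hq v)
  rw [h1.unique h2, InnerProductSpace.toDual_apply_apply, config_inner]
  simp only [sqrtIUGrad, inner_add_left, real_inner_smul_left, zero_smul, add_zero,
    Finset.sum_add_distrib, ← Finset.mul_sum]
  simp only [mul_assoc, ← Finset.mul_sum]
  ring

theorem z0_collisionFree : CollisionFree (z0 n) := by
  have h0 : ∀ k, vertex n k ≠ 0 := fun k => Complex.exp_ne_zero _
  have hv : ∀ k l, vertex n k = vertex n l → k = l := by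
    intro k l h
    have e : ∀ k : ZMod n, vertex n k = ZMod.stdAddChar k := by
      intro k
      rw [ZMod.stdAddChar_apply, ZMod.toCircle_apply]
      unfold vertex vertexAngle
      congr 1
      push_cast
      ring
    rw [e, e] at h
    exact ZMod.injective_stdAddChar h
  rintro (_ | i) (_ | j) hij
  · exact absurd rfl hij
  · simpa [z0] using (h0 j).symm
  · simpa [z0] using h0 i
  · intro h
    exact hij (congrArg some (hv _ _ (by simpa [z0] using h)))

theorem norm_vertex (k : ZMod n) : ‖vertex n k‖ = 1 := by
  rw [vertex, mul_comm, Complex.norm_exp_ofReal_mul_I]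

theorem inertia_z0 : inertia n m (z0 n) = n / 2 := by
  simp [inertia, z0, Fintype.sum_option, mass, norm_vertex, ZMod.card]
  ring

theorem eventually_collisionFree {q : Config n} (hq : CollisionFree q) :
    ∀ᶠ x in nhds q, CollisionFree x := by
  simp only [CollisionFree, Filter.eventually_all]
  intro i j hij
  have hi : Continuous fun x : Config n => x i := by fun_prop
  have hj : Continuous fun x : Config n => x j := by fun_prop
  exact (isOpen_ne_fun hi hj).mem_nhds (hq i j hij)

/-- Absence of collisions and positivity of the inertia are open conditions, so the explicit
gradient is valid near z₀ and may be differentiated there. -/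
theorem gradient_eventuallyEq :
    gradient (sqrtIU n m) =ᶠ[nhds (z0 n)] sqrtIUGrad n m := by
  have hI : 0 < inertia n m (z0 n) := by
    rw [inertia_z0]
    have : (0 : ℝ) < n := by exact_mod_cast NeZero.pos n
    positivity
  filter_upwards [eventually_collisionFree (z0_collisionFree),
    (inertia_differentiable (m := m) (z0 n)).continuousAt.eventually_const_lt hI] with x h1 h2
  exact (sqrtIU_hasGradientAt h1 h2).gradient

/-- The derivative of the gradient of `-1/|d|` in the direction `e`, up to sign. -/
noncomputable def pairHess (d e : ℂ) : ℂ :=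
  (3 * inner ℝ d e / ‖d‖ ^ 5) • d - (‖d‖ ^ 3)⁻¹ • e

/-- Division by zero makes the self-interaction vanish, so sums over the other bodies may be taken
over all bodies. -/
theorem pairHess_zero (e : ℂ) : pairHess 0 e = 0 := by simp [pairHess]

theorem pairHess_self (d : ℂ) : pairHess d d = (2 / ‖d‖ ^ 3) • d := by
  by_cases hd : d = 0
  · simp [hd, pairHess_zero]
  have hn : ‖d‖ ≠ 0 := norm_ne_zero_iff.2 hd
  rw [pairHess, ← sub_smul, real_inner_self_eq_norm_sq]
  congr 1
  field_simp
  norm_num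

/-- Writing the inner product as (d̄e + dē)/2 splits the real-linear map into a complex-linear and
an antilinear part; the antilinear part is what later couples α with β̄. -/
theorem pairHess_eq (d e : ℂ) : pairHess d e =
    ((2 * ‖d‖ ^ 3)⁻¹ : ℝ) * (e + 3 * (d ^ 2 / (‖d‖ ^ 2 : ℝ)) * (starRingEnd ℂ) e) := by
  by_cases hd : d = 0
  · simp [hd, pairHess_zero]
  have hn : (‖d‖ : ℂ) ≠ 0 := by exact_mod_cast norm_ne_zero_iff.2 hd
  have h1 : ((inner ℝ d e : ℝ) : ℂ) = ((starRingEnd ℂ) d * e + d * (starRingEnd ℂ) e) / 2 := by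
    rw [Complex.inner, Complex.re_eq_add_conj]
    simp
    ring
  have h2 : (starRingEnd ℂ) d * d = (‖d‖ : ℂ) ^ 2 := by
    rw [mul_comm, Complex.mul_conj, Complex.normSq_eq_norm_sq]
    push_cast
    rfl
  rw [pairHess, Complex.real_smul, Complex.real_smul]
  push_cast
  rw [h1]
  field_simp
  linear_combination (3 * e) * h2

theorem potentialGrad_hasDerivAt {q : Config n} (hq : CollisionFree q) (v : Config n)
    (i : Body n) :
    HasDerivAt (fun t : ℝ => potentialGrad n m (q + t • v) i)
      (∑ j, (mass n m i * mass n m j) • pairHess (q i - q j) (v i - v j)) 0 := by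
  have h : ∀ j ∈ Finset.univ.erase i,
      HasDerivAt (fun t : ℝ => (-(mass n m i * mass n m j) /
        ‖(q + t • v) i - (q + t • v) j‖ ^ 3) • ((q + t • v) i - (q + t • v) j))
      ((mass n m i * mass n m j) • pairHess (q i - q j) (v i - v j)) 0 := by
    intro j hj
    have hne : q i - q j ≠ 0 := sub_ne_zero.2 (hq i j (Finset.ne_of_mem_erase hj).symm)
    have hn : ‖q i - q j‖ ≠ 0 := norm_ne_zero_iff.2 hne
    have e : (fun t : ℝ => (-(mass n m i * mass n m j) /
        ‖(q + t • v) i - (q + t • v) j‖ ^ 3) • ((q + t • v) i - (q + t • v) j)) =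
        fun t : ℝ => (-(mass n m i * mass n m j) * (‖q i - q j + t • (v i - v j)‖ ^ 3)⁻¹) •
          (q i - q j + t • (v i - v j)) := by
      funext t
      have : (q + t • v) i - (q + t • v) j = q i - q j + t • (v i - v j) := by
        simp only [PiLp.add_apply, PiLp.smul_apply, smul_sub]
        ring
      rw [this, div_eq_mul_inv]
    rw [e]
    have h1 : HasDerivAt (fun t : ℝ => q i - q j + t • (v i - v j)) (v i - v j) 0 := by
      simpa using ((hasDerivAt_id (0 : ℝ)).smul_const (v i - v j)).const_add (q i - q j)
    have h2 := ((((hasDerivAt_norm_line (b := v i - v j) hne).fun_pow 3).fun_inv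
      (by simpa using hn)).const_mul (-(mass n m i * mass n m j))).fun_smul h1
    refine h2.congr_deriv ?_
    generalize q i - q j = d at hn ⊢
    generalize v i - v j = f
    simp only [zero_smul, add_zero, pairHess, smul_sub, smul_smul]
    rw [add_comm, sub_eq_add_neg, ← neg_smul]
    congr 1
    · congr 1
      field_simp
      norm_num
      ring
    · congr 1
      ring
  have h2 := HasDerivAt.fun_sum h
  unfold potentialGrad
  refine h2.congr_deriv ?_
  rw [← Finset.sum_erase_add _ _ (Finset.mem_univ i)]
  simp [pairHess_zero]

/-! ### Character sums and the central configuration equation -/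

theorem vertex_eq_stdAddChar (k : ZMod n) : vertex n k = ZMod.stdAddChar k := by
  rw [ZMod.stdAddChar_apply, ZMod.toCircle_apply]
  unfold vertex vertexAngle
  congr 1
  push_cast
  ring

theorem vertex_ne_zero (k : ZMod n) : vertex n k ≠ 0 := Complex.exp_ne_zero _

theorem vertex_mul_vertex_neg (k : ZMod n) : vertex n k * vertex n (-k) = 1 := by
  rw [← vertex_add, add_neg_cancel, vertex_zero]

theorem norm_vertex_sub (k t : ZMod n) : ‖vertex n k - vertex n (k + t)‖ = ‖1 - vertex n t‖ := by
  rw [vertex_add, ← mul_one_sub, norm_mul, norm_vertex, one_mul]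

theorem norm_one_sub_vertex_neg (t : ZMod n) : ‖1 - vertex n (-t)‖ = ‖1 - vertex n t‖ := by
  rw [← conj_vertex, ← Complex.norm_conj]
  simp

theorem sum_vertex_mul {l : ZMod n} (hl : l ≠ 0) : ∑ t, vertex n (l * t) = 0 := by
  simp only [vertex_eq_stdAddChar]
  have := AddChar.sum_mulShift l (ZMod.isPrimitive_stdAddChar n)
  rw [if_neg hl] at this
  simpa [mul_comm] using this

/-- `P_l = ½ ∑_t (1 - cos (l t θ)) / |1 - ζ^t|³`. -/
noncomputable def gonP (n : ℕ) [NeZero n] (l : ZMod n) : ℝ :=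
  1 / 2 * ∑ t : ZMod n, (‖1 - vertex n t‖ ^ 3)⁻¹ * (1 - (vertex n (l * t)).re)

/-- The weights are even in t, so the imaginary parts cancel under t ↦ -t. -/
theorem sum_one_sub_vertex (l : ZMod n) :
    ∑ t : ZMod n, ((‖1 - vertex n t‖ ^ 3)⁻¹ : ℝ) * (1 - vertex n (l * t)) =
      ((2 * gonP n l : ℝ) : ℂ) := by
  apply Complex.ext
  · rw [Complex.re_sum, Complex.ofReal_re, gonP, ← mul_assoc]
    rw [mul_one_div_cancel two_ne_zero, one_mul]
    refine Finset.sum_congr rfl fun t _ => ?_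
    rw [Complex.re_ofReal_mul, Complex.sub_re, Complex.one_re]
  · rw [Complex.im_sum, Complex.ofReal_im]
    have h := Equiv.sum_comp (Equiv.neg (ZMod n))
      fun t => (((‖1 - vertex n t‖ ^ 3)⁻¹ : ℝ) * (1 - vertex n (l * t))).im
    have h2 : ∀ t : ZMod n, (((‖1 - vertex n (Equiv.neg (ZMod n) t)‖ ^ 3)⁻¹ : ℝ) *
        (1 - vertex n (l * Equiv.neg (ZMod n) t))).im =
        - (((‖1 - vertex n t‖ ^ 3)⁻¹ : ℝ) * (1 - vertex n (l * t))).im := by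
      intro t
      rw [Equiv.neg_apply, norm_one_sub_vertex_neg, mul_neg, ← conj_vertex, Complex.im_ofReal_mul,
        Complex.im_ofReal_mul]
      simp
    rw [Finset.sum_congr rfl fun t _ => h2 t, Finset.sum_neg_distrib] at h
    linarith

theorem gonP_zero : gonP n 0 = 0 := by simp [gonP, vertex_zero]

theorem gonP_neg (l : ZMod n) : gonP n (-l) = gonP n l := by
  simp only [gonP, neg_mul, ← conj_vertex, Complex.conj_re]

/-- The multiplier of the central configuration. -/
noncomputable def gonLam (n : ℕ) [NeZero n] (m : ℝ) : ℝ := m + 2 * gonP n 1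

theorem sum_vertex (hn : 2 ≤ n) : ∑ t : ZMod n, vertex n t = 0 := by
  have : Fact (1 < n) := ⟨hn⟩
  simpa using sum_vertex_mul (n := n) one_ne_zero

/-- At the centre the forces cancel because the roots of unity sum to zero. At a vertex, factoring
out ζ^k leaves the sum of K_t(1 - ζ^t) with K_t = |1 - ζ^t|⁻³, which is 2P₁, and the central body
adds m. -/
theorem potentialGrad_z0 (hn : 2 ≤ n) (i : Body n) :
    potentialGrad n m (z0 n) i = -((gonLam n m * mass n m i) • z0 n i) := by
  have e : potentialGrad n m (z0 n) i = ∑ j,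
      (-(mass n m i * mass n m j) / ‖z0 n i - z0 n j‖ ^ 3) • (z0 n i - z0 n j) := by
    rw [potentialGrad, ← Finset.sum_erase_add _ _ (Finset.mem_univ i)]
    simp
  rw [e, Fintype.sum_option]
  rcases i with _ | k
  · simp [z0, mass, norm_vertex, ← Finset.mul_sum, sum_vertex hn]
  · rw [← Equiv.sum_comp (Equiv.addLeft k)]
    simp only [z0, mass, Equiv.coe_addLeft, norm_vertex_sub, sub_zero, norm_vertex, mul_one]
    have h := sum_one_sub_vertex (n := n) 1
    simp only [one_mul] at h
    have h2 : ∀ t : ZMod n, (-(1 : ℝ) / ‖1 - vertex n t‖ ^ 3) • (vertex n k - vertex n (k + t)) =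
        -vertex n k * (((‖1 - vertex n t‖ ^ 3)⁻¹ : ℝ) * (1 - vertex n t)) := by
      intro t
      rw [vertex_add, Complex.real_smul]
      push_cast
      ring
    rw [Finset.sum_congr rfl fun t _ => h2 t, ← Finset.mul_sum, h, gonLam]
    simp
    ring

/-- Euler's relation for a function homogeneous of degree -1. Collisions need no exclusion, since
the colliding terms are zero on both sides. -/
theorem potential_eq (q : Config n) :
    potential n m q = -∑ i, inner ℝ (potentialGrad n m q i) (q i) := by
  simp only [potentialGrad, sum_inner, real_inner_smul_left]
  have h := sum_sum_erase_antisymm (fun i j => -(mass n m i * mass n m j) / ‖q i - q j‖ ^ 3)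
    (fun i j => by rw [norm_sub_rev, mul_comm (mass n m i)]) q q
  rw [potential]
  have h2 : ∑ i, ∑ j ∈ Finset.univ.erase i, -(mass n m i * mass n m j) / ‖q i - q j‖ ^ 3 *
      inner ℝ (q i - q j) (q i - q j) =
      - ∑ i, ∑ j ∈ Finset.univ.erase i, mass n m i * mass n m j / ‖q i - q j‖ := by
    simp only [← Finset.sum_neg_distrib]
    refine Finset.sum_congr rfl fun i _ => Finset.sum_congr rfl fun j _ => ?_
    rw [real_inner_self_eq_norm_sq]
    by_cases hz : ‖q i - q j‖ = 0
    · simp [hz]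
    · field_simp
  rw [h2] at h
  linarith

theorem potential_z0 (hn : 2 ≤ n) : potential n m (z0 n) = gonLam n m * n := by
  rw [potential_eq]
  simp only [potentialGrad_z0 hn, inner_neg_left, real_inner_smul_left, real_inner_self_eq_norm_sq,
    Fintype.sum_option]
  simp [z0, mass, norm_vertex, ZMod.card]
  ring

/-- Differentiate U/(2√I)·Mq + √I·∇U at z₀, where I = n/2, U = λn and ∇U = -λMz₀. The variations of
U, of 1/√I and of √I each contribute the same multiple of ⟨z₀, v⟩Mz₀, whence the factor 3 in the
rank-one term. -/
theorem hess_apply (hn : 2 ≤ n) (v : Config n) (i : Body n) :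
    hess n m v i = √(n / 2 : ℝ) • ((gonLam n m * mass n m i) • v i
      + ∑ j, (mass n m i * mass n m j) • pairHess (z0 n i - z0 n j) (v i - v j)
      - (3 * gonLam n m * inner ℝ (z0 n) v / n * mass n m i) • z0 n i) := by
  have hn0 : (0 : ℝ) < n := by exact_mod_cast NeZero.pos n
  have hI : inertia n m (z0 n) ≠ 0 := by rw [inertia_z0]; positivity
  have hc : CollisionFree (z0 n) := z0_collisionFree
  have hs : 0 < √(n / 2 : ℝ) := Real.sqrt_pos.2 (by positivity)
  have hsq : √(n / 2 : ℝ) ^ 2 = n / 2 := Real.sq_sqrt (by positivity)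
  have hd : DifferentiableAt ℝ (sqrtIUGrad n m) (z0 n) := by
    rw [differentiableAt_piLp]
    intro i
    unfold sqrtIUGrad
    have h1 : DifferentiableAt ℝ (fun q : Config n => √(inertia n m q)) (z0 n) :=
      (inertia_differentiable _).sqrt hI
    have h2 : DifferentiableAt ℝ (fun q : Config n => q i) (z0 n) := by fun_prop
    have h3 : (2 * √(inertia n m (z0 n))) ≠ 0 := by
      rw [inertia_z0]; positivity
    simp only [div_eq_mul_inv]
    exact ((((potential_differentiableAt hc).fun_mul ((h1.const_mul 2).fun_inv h3)).mul_const
      (mass n m i)).fun_smul h2).fun_add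
      (h1.fun_smul (potentialGrad_differentiableAt hc i))
  have h1 : HasDerivAt (fun t : ℝ => sqrtIUGrad n m (z0 n + t • v) i) (hess n m v i) 0 := by
    have h := line_hasDerivAt (differentiableAt_piLp 2 |>.1 hd i) v
    have e : fderiv ℝ (fun q => sqrtIUGrad n m q i) (z0 n) v = hess n m v i := by
      rw [hess, gradient_eventuallyEq.fderiv_eq]
      have := (hasFDerivWithinAt_univ.1 <| (hasFDerivWithinAt_piLp 2).1
        hd.hasFDerivAt.hasFDerivWithinAt i).fderiv
      rw [this]
      rfl
    rwa [e] at h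
  have hin : HasDerivAt (fun t : ℝ => inertia n m (z0 n + t • v)) (inner ℝ (z0 n) v) 0 := by
    refine (inertia_hasDerivAt (z0 n) v).congr_deriv ?_
    rw [config_inner, Fintype.sum_option, Fintype.sum_option]
    simp [z0, mass]
  have hp : HasDerivAt (fun t : ℝ => potential n m (z0 n + t • v))
      (-(gonLam n m * inner ℝ (z0 n) v)) 0 := by
    refine (potential_hasDerivAt hc v).congr_deriv ?_
    simp only [potentialGrad_z0 hn, inner_neg_left, real_inner_smul_left]
    rw [config_inner, Fintype.sum_option, Fintype.sum_option]
    simp [z0, mass, Finset.mul_sum]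
  have hv : HasDerivAt (fun t : ℝ => (z0 n + t • v) i) (v i) 0 := by
    simpa using ((hasDerivAt_id (0 : ℝ)).smul_const (v i)).const_add (z0 n i)
  have hsd := hin.sqrt (by simpa using hI)
  have h2 := (((hp.fun_div (hsd.const_mul 2) (by simpa [inertia_z0] using hs.ne')).mul_const
    (mass n m i)).fun_smul hv).fun_add (hsd.fun_smul (potentialGrad_hasDerivAt (m := m) hc v i))
  rw [h1.unique h2]
  simp only [zero_smul, add_zero, inertia_z0, potential_z0 hn, potentialGrad_z0 hn]
  simp only [Complex.real_smul]
  generalize (∑ j, ((mass n m i * mass n m j : ℝ) : ℂ) *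
    pairHess (z0 n i - z0 n j) (v i - v j)) = X
  generalize √(n / 2 : ℝ) = s at *
  have hn' : (n : ℝ) = 2 * s ^ 2 := by linarith
  rw [hn']
  have hsc : (s : ℂ) ≠ 0 := by exact_mod_cast hs.ne'
  push_cast
  field_simp
  ring

/-! ### The Hessian in complex Fourier coordinates -/

/-- The configuration with `k`-th entry `(α ζ^(lk) + β ζ^(-lk)) ζ^k` and zero entry at the centre. -/
noncomputable def fourierMode (n : ℕ) (l : ZMod n) (α β : ℂ) : Config n :=
  WithLp.toLp 2 fun
    | some k => (α * vertex n (l * k) + β * vertex n (-(l * k))) * vertex n k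
    | none => 0

/-- The displacement of the central body by `c`. -/
noncomputable def centerMode (n : ℕ) (c : ℂ) : Config n :=
  WithLp.toLp 2 fun
    | some _ => 0
    | none => c

@[simp] theorem fourierMode_some (l : ZMod n) (α β : ℂ) (k : ZMod n) :
    fourierMode n l α β (some k) =
      (α * vertex n (l * k) + β * vertex n (-(l * k))) * vertex n k := rfl

@[simp] theorem fourierMode_none (l : ZMod n) (α β : ℂ) : fourierMode n l α β none = 0 := rfl

@[simp] theorem centerMode_some (c : ℂ) (k : ZMod n) : centerMode n c (some k) = 0 := rfl

@[simp] theorem centerMode_none (c : ℂ) : centerMode n c none = c := rfl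

@[simp] theorem z0_some (k : ZMod n) : z0 n (some k) = vertex n k := rfl

@[simp] theorem z0_none : z0 n none = 0 := rfl

/-- The radial components of the mode form nontrivial characters, which sum to zero; so the rank-one
term of the Hessian disappears on every frequency l ≠ 0. -/
theorem inner_z0_fourierMode {l : ZMod n} (hl : l ≠ 0) (α β : ℂ) :
    inner ℝ (z0 n) (fourierMode n l α β) = 0 := by
  rw [config_inner, Fintype.sum_option]
  have h : ∀ k : ZMod n, inner ℝ (z0 n (some k)) (fourierMode n l α β (some k)) =
      (α * vertex n (l * k) + β * vertex n (-l * k)).re := by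
    intro k
    rw [Complex.inner, z0_some, fourierMode_some, conj_vertex]
    congr 1
    linear_combination (α * vertex n (l * k) + β * vertex n (-(l * k))) * vertex_mul_vertex_neg k +
      β * (congrArg (vertex n) (neg_mul l k)).symm
  rw [Finset.sum_congr rfl fun k _ => h k, ← Complex.re_sum, Finset.sum_add_distrib,
    ← Finset.mul_sum, ← Finset.mul_sum, sum_vertex_mul hl, sum_vertex_mul (neg_ne_zero.2 hl)]
  simp

theorem inner_z0_centerMode (c : ℂ) : inner ℝ (z0 n) (centerMode n c) = 0 := by
  rw [config_inner, Fintype.sum_option]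
  simp

/-- `(q_k - q_j)² / |q_k - q_j|² = -q_k q_j`. -/
theorem pairHess_vertex (k t : ZMod n) (e : ℂ) :
    pairHess (vertex n k - vertex n (k + t)) e =
      (((‖1 - vertex n t‖ ^ 3)⁻¹ : ℝ) : ℂ) / 2 *
        (e - 3 * (vertex n k ^ 2 * vertex n t) * (starRingEnd ℂ) e) := by
  rw [pairHess_eq, norm_vertex_sub]
  by_cases h : ‖1 - vertex n t‖ = 0
  · simp [h]
  have h1 : ((‖1 - vertex n t‖ ^ 2 : ℝ) : ℂ) = (1 - vertex n t) * (1 - vertex n (-t)) := by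
    rw [← Complex.normSq_eq_norm_sq, ← Complex.mul_conj, map_sub, conj_vertex, map_one]
  have h2 : ((‖1 - vertex n t‖ ^ 2 : ℝ) : ℂ) ≠ 0 := by exact_mod_cast pow_ne_zero 2 h
  have h3 : (vertex n k - vertex n (k + t)) ^ 2 / (‖1 - vertex n t‖ ^ 2 : ℝ) =
      -(vertex n k ^ 2 * vertex n t) := by
    rw [div_eq_iff h2, h1, vertex_add]
    linear_combination (-(vertex n k ^ 2 * (1 - vertex n t))) * vertex_mul_vertex_neg t
  rw [h3, mul_inv]
  push_cast
  ring

/-- With j = k + t each term has weight K_t = |1 - ζ^t|⁻³ and expands into multiples of K_t(1 -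
ζ^{ct}) with c = l + 1, -(l - 1), 1, l, -l. Summing over t replaces these by 2P_{l+1}, 2P_{l-1},
2P₁, 2P_l, 2P_l. Conjugation exchanges ζ^{lk} and ζ^{-lk}, so the antilinear part swaps the roles of
α and β. -/
theorem sum_pairHess_fourierMode (l k : ZMod n) (α β : ℂ) :
    ∑ j : ZMod n, pairHess (vertex n k - vertex n j)
        (fourierMode n l α β (some k) - fourierMode n l α β (some j)) =
      fourierMode n l
        (gonP n (l + 1) * α + 3 * (gonP n 1 - gonP n l) * (starRingEnd ℂ) β)
        (gonP n (l - 1) * β + 3 * (gonP n 1 - gonP n l) * (starRingEnd ℂ) α) (some k) := by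
  rw [← Equiv.sum_comp (Equiv.addLeft k)]
  simp only [Equiv.coe_addLeft, pairHess_vertex, fourierMode_some]
  have s1 := sum_one_sub_vertex (n := n) (l + 1)
  have s2 := sum_one_sub_vertex (n := n) (-(l - 1))
  have s3 := sum_one_sub_vertex (n := n) 1
  have s4 := sum_one_sub_vertex (n := n) l
  have s5 := sum_one_sub_vertex (n := n) (-l)
  rw [gonP_neg] at s2 s5
  set K : ZMod n → ℂ := fun t => (((‖1 - vertex n t‖ ^ 3)⁻¹ : ℝ) : ℂ) with hK
  change ∑ t, K t * _ = _ at s1 s2 s3 s4 s5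
  set a := vertex n (l * k) with ha
  set b := vertex n (-(l * k)) with hb
  set q := vertex n k with hq
  have e : ∀ t : ZMod n, K t / 2 *
      ((α * a + β * b) * q - (α * vertex n (l * (k + t)) + β * vertex n (-(l * (k + t)))) *
        vertex n (k + t) - 3 * (q ^ 2 * vertex n t) *
      (starRingEnd ℂ) ((α * a + β * b) * q -
        (α * vertex n (l * (k + t)) + β * vertex n (-(l * (k + t)))) * vertex n (k + t))) =
      (α * a * q / 2) * (K t * (1 - vertex n ((l + 1) * t))) +
      (β * b * q / 2) * (K t * (1 - vertex n (-(l - 1) * t))) +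
      (3 / 2 * q * ((starRingEnd ℂ) α * b + (starRingEnd ℂ) β * a)) *
        (K t * (1 - vertex n (1 * t))) -
      (3 / 2 * q * (starRingEnd ℂ) β * a) * (K t * (1 - vertex n (l * t))) -
      (3 / 2 * q * (starRingEnd ℂ) α * b) * (K t * (1 - vertex n (-l * t))) := by
    intro t
    simp only [map_sub, map_mul, map_add, conj_vertex, ha, hb, hq, neg_neg]
    have e1 : l * (k + t) = l * k + l * t := by ring
    have e2 : -(l * (k + t)) = -(l * k) + -(l * t) := by ring
    have e3 : (l + 1) * t = l * t + t := by ring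
    have e4 : -(l - 1) * t = -(l * t) + t := by ring
    have e5 : -l * t = -(l * t) := by ring
    have e6 : -(k + t) = -k + -t := by ring
    rw [e2, e1, e3, e4, e5, e6, one_mul]
    simp only [vertex_add]
    have u1 := vertex_mul_vertex_neg k
    have u2 := vertex_mul_vertex_neg t
    generalize vertex n (l * k) = x1 at *
    generalize vertex n (-(l * k)) = x2 at *
    generalize vertex n (l * t) = x3 at *
    generalize vertex n (-(l * t)) = x4 at *
    generalize vertex n k = x5 at *
    generalize vertex n (-k) = x6 at *
    generalize vertex n t = x7 at *
    generalize vertex n (-t) = x8 at *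
    linear_combination (-(3 / 2) * K t * x5 * x7 * (x2 * (starRingEnd ℂ) α +
      x1 * (starRingEnd ℂ) β) + (3 / 2) * K t * x5 * x7 * x8 * (x2 * x4 * (starRingEnd ℂ) α +
      x1 * x3 * (starRingEnd ℂ) β)) * u1 + (3 / 2) * K t * x5 * (x2 * x4 * (starRingEnd ℂ) α +
      x1 * x3 * (starRingEnd ℂ) β) * u2
  rw [Finset.sum_congr rfl fun t _ => e t]
  simp only [Finset.sum_add_distrib, Finset.sum_sub_distrib, ← Finset.mul_sum]
  rw [s1, s2, s3, s4, s5]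
  push_cast
  ring

theorem pairHess_unit {d : ℂ} (hd : ‖d‖ = 1) (e : ℂ) :
    pairHess d e = 1 / 2 * (e + 3 * d ^ 2 * (starRingEnd ℂ) e) := by
  rw [pairHess_eq, hd]
  norm_num

/-- The central body is at unit distance, so its pull is ½m(e + 3ζ^{2k}ē) in the relative
displacement e. Its linear part m/2 joins the m in λ to give 3m/2 on the diagonal, and its
antilinear part gives 3m/2 off it. -/
theorem hess_some (hn : 2 ≤ n) (l : ZMod n) (α β c : ℂ)
    (h0 : inner ℝ (z0 n) (fourierMode n l α β) = 0) (k : ZMod n) :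
    hess n m (fourierMode n l α β + centerMode n c) (some k) = √(n / 2 : ℝ) *
      (fourierMode n l
        ((gonP n (l + 1) + 2 * gonP n 1 + 3 * m / 2) * α +
          (3 * (gonP n 1 - gonP n l) + 3 * m / 2) * (starRingEnd ℂ) β)
        ((gonP n (l - 1) + 2 * gonP n 1 + 3 * m / 2) * β +
          (3 * (gonP n 1 - gonP n l) + 3 * m / 2) * (starRingEnd ℂ) α) (some k) -
        m / 2 * (c + 3 * vertex n k ^ 2 * (starRingEnd ℂ) c)) := by
  rw [hess_apply hn, inner_add_right, h0, inner_z0_centerMode, Fintype.sum_option]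
  have h := sum_pairHess_fourierMode l k α β
  simp only [PiLp.add_apply, centerMode_some, centerMode_none, fourierMode_none, z0_some, z0_none,
    add_zero, zero_add, mass, mul_one, one_mul, one_smul, sub_zero, Complex.real_smul] at h ⊢
  rw [h, pairHess_unit (norm_vertex k), gonLam]
  simp only [fourierMode_some, map_sub, map_mul, map_add, conj_vertex, neg_neg]
  push_cast
  linear_combination ((√(n / 2 : ℝ) : ℝ) : ℂ) * (m : ℂ) * (3 / 2) * vertex n k *
    ((starRingEnd ℂ) α * vertex n (-(l * k)) + (starRingEnd ℂ) β * vertex n (l * k)) *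
    vertex_mul_vertex_neg k

/-- For n ≥ 3 the sum of ζ^{2k} vanishes, which removes the antilinear term in c. What the vertices
exert on the centre consists of the character sums of frequencies l + 1 and 1 - l, nonzero only for
l = ±1. -/
theorem hess_none (hn : 3 ≤ n) (l : ZMod n) (α β c : ℂ)
    (h0 : inner ℝ (z0 n) (fourierMode n l α β) = 0) :
    hess n m (fourierMode n l α β + centerMode n c) none = √(n / 2 : ℝ) *
      (gonLam n m * m * c + m / 2 * (n * c - ∑ k : ZMod n,
        (α * vertex n ((l + 1) * k) + β * vertex n ((1 - l) * k) +
          3 * ((starRingEnd ℂ) α * vertex n ((1 - l) * k) +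
          (starRingEnd ℂ) β * vertex n ((l + 1) * k))))) := by
  rw [hess_apply (by omega), inner_add_right, h0, inner_z0_centerMode, Fintype.sum_option]
  simp only [PiLp.add_apply, centerMode_some, centerMode_none, fourierMode_none, z0_some, z0_none,
    add_zero, zero_add, mass, mul_one, Complex.real_smul, zero_sub, sub_self, pairHess_zero,
    mul_zero, zero_mul, zero_div, sub_zero]
  have hneg : ∀ k : ZMod n, ‖-vertex n k‖ = 1 := fun k => by rw [norm_neg, norm_vertex]
  have h2 : (2 : ZMod n) ≠ 0 := by
    intro h
    have : n ∣ 2 := (ZMod.natCast_eq_zero_iff 2 n).1 (by exact_mod_cast h)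
    exact absurd (Nat.le_of_dvd two_pos this) (by omega)
  have s2 := sum_vertex_mul h2
  have e : ∀ k : ZMod n, (m : ℂ) * pairHess (-vertex n k) (c - fourierMode n l α β (some k)) =
      m / 2 * c + (m * 3 / 2 * (starRingEnd ℂ) c) * vertex n (2 * k) -
      m / 2 * (α * vertex n ((l + 1) * k) + β * vertex n ((1 - l) * k) +
          3 * ((starRingEnd ℂ) α * vertex n ((1 - l) * k) +
          (starRingEnd ℂ) β * vertex n ((l + 1) * k))) := by
    intro k
    rw [pairHess_unit (hneg k)]
    have e1 : (2 : ZMod n) * k = k + k := by ring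
    have e2 : (l + 1) * k = l * k + k := by ring
    have e3 : (1 - l) * k = -(l * k) + k := by ring
    simp only [fourierMode_some, map_sub, map_mul, map_add, conj_vertex, neg_neg]
    rw [e1, e2, e3]
    simp only [vertex_add]
    linear_combination (-(3 / 2) * (m : ℂ) * vertex n k *
      ((starRingEnd ℂ) α * vertex n (-(l * k)) + (starRingEnd ℂ) β * vertex n (l * k))) *
      vertex_mul_vertex_neg k
  rw [Finset.sum_congr rfl fun k _ => e k]
  simp only [Finset.sum_add_distrib, Finset.sum_sub_distrib, ← Finset.mul_sum, s2]
  simp only [Finset.sum_const, Finset.card_univ, ZMod.card, nsmul_eq_mul]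
  push_cast
  ring

/-- The Hessian on the modes `l ≠ ±1`. -/
theorem hess_fourierMode (hn : 3 ≤ n) {l : ZMod n} (h1 : l ≠ 1) (h2 : l ≠ -1) (α β : ℂ)
    (h0 : inner ℝ (z0 n) (fourierMode n l α β) = 0) :
    hess n m (fourierMode n l α β) = √(n / 2 : ℝ) • fourierMode n l
        ((gonP n (l + 1) + 2 * gonP n 1 + 3 * m / 2) * α +
          (3 * (gonP n 1 - gonP n l) + 3 * m / 2) * (starRingEnd ℂ) β)
        ((gonP n (l - 1) + 2 * gonP n 1 + 3 * m / 2) * β +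
          (3 * (gonP n 1 - gonP n l) + 3 * m / 2) * (starRingEnd ℂ) α) := by
  have hc : centerMode n 0 = 0 := by
    ext i
    cases i <;> rfl
  have s1 := sum_vertex_mul (l := l + 1) (fun h => h2 (eq_neg_of_add_eq_zero_left h))
  have s2 := sum_vertex_mul (l := 1 - l) (fun h => h1 (sub_eq_zero.1 h).symm)
  ext i
  rcases i with _ | k
  · have h := hess_none (m := m) hn l α β 0 h0
    rw [hc, add_zero] at h
    rw [h]
    simp only [Finset.sum_add_distrib, ← Finset.mul_sum, s1, s2]
    simp
  · have h := hess_some (m := m) (by omega) l α β 0 h0 k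
    rw [hc, add_zero] at h
    rw [h]
    simp

/-- The Hessian on the mode `1` and the centre. -/
theorem hess_fourierMode_one (hn : 3 ≤ n) (α β c : ℂ) :
    hess n m (fourierMode n 1 α β + centerMode n c) = √(n / 2 : ℝ) • (fourierMode n 1
        ((gonP n 2 + 2 * gonP n 1 + 3 * m / 2) * α + 3 * m / 2 * (starRingEnd ℂ) β -
          3 * m / 2 * (starRingEnd ℂ) c)
        ((2 * gonP n 1 + 3 * m / 2) * β + 3 * m / 2 * (starRingEnd ℂ) α - m / 2 * c) +
      centerMode n (gonLam n m * m * c + m * n / 2 * (c - β - 3 * (starRingEnd ℂ) α))) := by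
  have : Fact (1 < n) := ⟨by omega⟩
  have h0 := inner_z0_fourierMode (n := n) one_ne_zero α β
  have h2 : (1 + 1 : ZMod n) ≠ 0 := by
    intro h
    have : n ∣ 2 := (ZMod.natCast_eq_zero_iff 2 n).1 (by rw [← h]; norm_num)
    exact absurd (Nat.le_of_dvd two_pos this) (by omega)
  have s1 := sum_vertex_mul h2
  ext i
  rcases i with _ | k
  · rw [hess_none hn 1 α β c h0]
    simp only [Finset.sum_add_distrib, ← Finset.mul_sum, s1, sub_self, zero_mul, vertex_zero]
    simp [ZMod.card]
    ring_nf
  · rw [hess_some (by omega) 1 α β c h0, sub_self, sub_self (1 : ZMod n), gonP_zero]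
    have e : (1 + 1 : ZMod n) = 2 := by norm_num
    simp only [e, PiLp.smul_apply, PiLp.add_apply, fourierMode_some, centerMode_some,
      Complex.real_smul, one_mul]
    push_cast
    linear_combination ((√(n / 2 : ℝ) : ℝ) : ℂ) * (m / 2 * c) * vertex_mul_vertex_neg k

/-- Infinitesimal scale invariance: moving along z₀ changes ∇U by -2∇U = 2λMz₀, so the terms λ, 2λ
and -3λ cancel. The rank-one term is present here, so the formula for the other modes does not
apply. -/
theorem hess_z0 (hn : 2 ≤ n) : hess n m (z0 n) = 0 := by
  ext i
  have h := potentialGrad_z0 (m := m) hn i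
  have hn0 : (n : ℝ) ≠ 0 := by exact_mod_cast NeZero.ne n
  have hin : inner ℝ (z0 n) (z0 n) = (n : ℝ) := by
    rw [config_inner, Fintype.sum_option]
    simp only [z0_some, z0_none, real_inner_self_eq_norm_sq, norm_vertex]
    simp [ZMod.card]
  have e : ∑ j, (mass n m i * mass n m j) • pairHess (z0 n i - z0 n j) (z0 n i - z0 n j) =
      (-2 : ℝ) • potentialGrad n m (z0 n) i := by
    rw [potentialGrad, ← Finset.sum_erase_add _ _ (Finset.mem_univ i), sub_self, pairHess_zero,
      smul_zero, add_zero, Finset.smul_sum]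
    refine Finset.sum_congr rfl fun j _ => ?_
    rw [pairHess_self, smul_smul, smul_smul]
    congr 1
    ring
  rw [hess_apply hn, e, h, hin]
  simp only [Complex.real_smul, PiLp.zero_apply]
  push_cast
  have hn1 : (n : ℂ) ≠ 0 := by exact_mod_cast hn0
  field_simp
  ring

/-! ### The real Fourier modes -/

theorem vertex_natCast_mul (l : ℕ) (k : ZMod n) : vertex n ((l : ZMod n) * k) =
    Real.cos (l * vertexAngle n k) + Real.sin (l * vertexAngle n k) * Complex.I := by
  have h : vertex n ((l : ZMod n) * k) = vertex n k ^ l := by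
    induction l with
    | zero => simp [vertex_zero]
    | succ l ih => rw [Nat.cast_succ, add_mul, one_mul, vertex_add, ih, pow_succ]
  rw [h, vertex, ← Complex.exp_nat_mul, Complex.ofReal_cos, Complex.ofReal_sin,
    ← Complex.exp_mul_I]
  congr 1
  push_cast
  ring

theorem vertex_neg_natCast_mul (l : ℕ) (k : ZMod n) : vertex n (-((l : ZMod n) * k)) =
    Real.cos (l * vertexAngle n k) - Real.sin (l * vertexAngle n k) * Complex.I := by
  rw [← conj_vertex, vertex_natCast_mul]
  simp only [map_add, map_mul, Complex.conj_ofReal, Complex.conj_I]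
  ring

theorem modeV_eq (l : ℕ) : modeV n l = fourierMode n l (1 / 2) (1 / 2) := by
  ext i
  rcases i with _ | k
  · rfl
  · rw [fourierMode_some, vertex_natCast_mul, vertex_neg_natCast_mul]
    change _ * vertex n k = _
    ring

theorem modeV'_eq (l : ℕ) : modeV' n l = fourierMode n l (-1 / 2) (1 / 2) := by
  ext i
  rcases i with _ | k
  · rfl
  · rw [fourierMode_some, vertex_natCast_mul, vertex_neg_natCast_mul]
    change _ * (_ * vertex n k) = _
    ring

theorem modeW_eq (l : ℕ) : modeW n l = fourierMode n l (Complex.I / 2) (Complex.I / 2) := by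
  ext i
  rcases i with _ | k
  · rfl
  · rw [fourierMode_some, vertex_natCast_mul, vertex_neg_natCast_mul]
    change _ * (_ * vertex n k) = _
    ring

theorem modeW'_eq (l : ℕ) : modeW' n l = fourierMode n l (-Complex.I / 2) (Complex.I / 2) := by
  ext i
  rcases i with _ | k
  · rfl
  · rw [fourierMode_some, vertex_natCast_mul, vertex_neg_natCast_mul]
    change _ * vertex n k = _
    linear_combination ((Real.sin (l * vertexAngle n k)) * vertex n k : ℂ) * Complex.I_mul_I

theorem centerX_eq : centerX n = centerMode n 1 := rfl

theorem centerY_eq : centerY n = centerMode n Complex.I := rfl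

theorem fourierMode_add (l : ZMod n) (α β α' β' : ℂ) :
    fourierMode n l α β + fourierMode n l α' β' = fourierMode n l (α + α') (β + β') := by
  ext i
  rcases i with _ | k
  · simp
  · simp only [PiLp.add_apply, fourierMode_some]
    ring

theorem smul_fourierMode (l : ZMod n) (r : ℝ) (α β : ℂ) :
    r • fourierMode n l α β = fourierMode n l (r * α) (r * β) := by
  ext i
  rcases i with _ | k
  · simp
  · simp only [PiLp.smul_apply, fourierMode_some, Complex.real_smul]
    ring

theorem centerMode_add (c c' : ℂ) : centerMode n c + centerMode n c' = centerMode n (c + c') := by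
  ext i
  cases i <;> simp

theorem smul_centerMode (r : ℝ) (c : ℂ) : r • centerMode n c = centerMode n (r * c) := by
  ext i
  cases i <;> simp

theorem centerMode_zero : centerMode n 0 = 0 := by
  ext i
  cases i <;> rfl

theorem fourierMode_zero (l : ZMod n) : fourierMode n l 0 0 = 0 := by
  ext i
  cases i <;> simp

/-! ### The blocks of the Hessian -/

/-- The matrix of the Hessian on `v_l, v_l'` and on `w_l', w_l`. -/
noncomputable def modeBlock (n : ℕ) [NeZero n] (m : ℝ) (l : ZMod n) : Matrix (Fin 2) (Fin 2) ℝ :=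
  let A := gonP n (l + 1) + 2 * gonP n 1 + 3 * m / 2
  let D := gonP n (l - 1) + 2 * gonP n 1 + 3 * m / 2
  let B := 3 * (gonP n 1 - gonP n l) + 3 * m / 2
  √(n / 2 : ℝ) • !![(A + D) / 2 + B, (D - A) / 2; (D - A) / 2, (A + D) / 2 - B]

/-- The matrix of the Hessian on `v_1, v_1', e_{2n+1}` and on `w_1', w_1, e_{2n+2}`. -/
noncomputable def firstBlock (n : ℕ) [NeZero n] (m : ℝ) : Matrix (Fin 3) (Fin 3) ℝ :=
  let A := gonP n 2 + 2 * gonP n 1 + 3 * m / 2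
  let D := 2 * gonP n 1 + 3 * m / 2
  let B := 3 * m / 2
  √(n / 2 : ℝ) • !![(A + D) / 2 + B, (D - A) / 2, -2 * m;
    (D - A) / 2, (A + D) / 2 - B, m;
    -m * n, m * n / 2, gonLam n m * m + m * n / 2]

theorem conj_half : (starRingEnd ℂ) (1 / 2) = 1 / 2 := by
  simp [Complex.ext_iff]

theorem conj_neg_half : (starRingEnd ℂ) (-1 / 2) = -1 / 2 := by
  rw [map_div₀, map_neg, map_one, map_ofNat]

theorem conj_half_I : (starRingEnd ℂ) (Complex.I / 2) = -Complex.I / 2 := by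
  rw [map_div₀, Complex.conj_I, map_ofNat]

theorem conj_neg_half_I : (starRingEnd ℂ) (-Complex.I / 2) = Complex.I / 2 := by
  rw [map_div₀, map_neg, Complex.conj_I, neg_neg, map_ofNat]

section
variable (hn : 3 ≤ n) {l : ℕ} (hl : 2 ≤ l) (hl' : l ≤ n / 2)
include hn hl hl'

theorem natCast_mode_ne : (l : ZMod n) ≠ 0 ∧ (l : ZMod n) ≠ 1 ∧ (l : ZMod n) ≠ -1 := by
  have key : ∀ a : ℕ, 0 < a → a < n → (a : ZMod n) ≠ 0 := by
    intro a h0 h1 h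
    exact absurd (Nat.le_of_dvd h0 ((ZMod.natCast_eq_zero_iff a n).1 h)) (by omega)
  refine ⟨key l (by omega) (by omega), fun h => ?_, fun h => ?_⟩
  · refine key (l - 1) (by omega) (by omega) ?_
    rw [Nat.cast_sub (by omega), h]
    simp
  · refine key (l + 1) (by omega) (by omega) ?_
    rw [Nat.cast_add, h]
    simp

theorem hess_modeV_modeV' (j : Fin 2) :
    hess n m ((![modeV n l, modeV' n l] : Fin 2 → Config n) j) =
      ∑ i, modeBlock n m l i j • (![modeV n l, modeV' n l] : Fin 2 → Config n) i := by
  obtain ⟨h0, h1, h2⟩ := natCast_mode_ne hn hl hl'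
  rw [Fin.sum_univ_two]
  fin_cases j <;>
    simp only [modeBlock, modeV_eq, modeV'_eq, Fin.zero_eta, Fin.mk_one, Matrix.cons_val_zero,
      Matrix.cons_val_one, Matrix.smul_apply, Matrix.of_apply, smul_eq_mul, mul_smul, Fin.isValue,
      Matrix.cons_val', Matrix.cons_val_fin_one] <;>
    rw [hess_fourierMode hn h1 h2 _ _ (inner_z0_fourierMode h0 _ _), ← smul_add] <;>
    simp only [smul_fourierMode, fourierMode_add] <;>
    refine congrArg₂ _ ?_ ?_ <;>
    simp only [conj_half, conj_neg_half] <;> push_cast <;> ring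

/-- The map (a, b) ↦ (-ia, ib) commutes with (α, β) ↦ (Aα + Bβ̄, Dβ + Bᾱ) and takes v_l, v_l' to
w_l', w_l; hence the same matrix. Together with c ↦ ic at the centre it also explains the second
copy of the 3 × 3 block. -/
theorem hess_modeW'_modeW (j : Fin 2) :
    hess n m ((![modeW' n l, modeW n l] : Fin 2 → Config n) j) =
      ∑ i, modeBlock n m l i j • (![modeW' n l, modeW n l] : Fin 2 → Config n) i := by
  obtain ⟨h0, h1, h2⟩ := natCast_mode_ne hn hl hl'
  rw [Fin.sum_univ_two]
  fin_cases j <;>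
    simp only [modeBlock, modeW_eq, modeW'_eq, Fin.zero_eta, Fin.mk_one, Matrix.cons_val_zero,
      Matrix.cons_val_one, Matrix.smul_apply, Matrix.of_apply, smul_eq_mul, mul_smul, Fin.isValue,
      Matrix.cons_val', Matrix.cons_val_fin_one] <;>
    rw [hess_fourierMode hn h1 h2 _ _ (inner_z0_fourierMode h0 _ _), ← smul_add] <;>
    simp only [smul_fourierMode, fourierMode_add] <;>
    refine congrArg₂ _ ?_ ?_ <;>
    simp only [conj_half_I, conj_neg_half_I] <;> push_cast <;> ring

end

/-- Infinitesimal rotation invariance: at l = 0 one has A = B = D, because P₀ = 0 and P is even, so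
Aα + Bᾱ = 0 for imaginary α. -/
theorem hess_modeW_zero (hn : 3 ≤ n) : hess n m (modeW n 0) = 0 := by
  have : Fact (1 < n) := ⟨by omega⟩
  have h1 : (0 : ZMod n) ≠ 1 := zero_ne_one
  have h2 : (0 : ZMod n) ≠ -1 := fun h => h1 (by rw [← neg_neg (1 : ZMod n), ← h, neg_zero])
  rw [modeW_eq, Nat.cast_zero, hess_fourierMode hn h1 h2]
  · ext i
    rcases i with _ | k
    · simp
    · rw [PiLp.smul_apply, fourierMode_some, conj_half_I, zero_add, zero_sub, gonP_neg, gonP_zero]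
      simp only [zero_mul, neg_zero, vertex_zero, PiLp.zero_apply, smul_eq_zero]
      right
      push_cast
      ring
  · rw [config_inner, Fintype.sum_option]
    simp only [z0_none, inner_zero_left, zero_add, z0_some, fourierMode_some]
    refine Finset.sum_eq_zero fun k _ => ?_
    rw [zero_mul, neg_zero, vertex_zero, Complex.inner]
    have : (Complex.I / 2 * 1 + Complex.I / 2 * 1) * vertex n k * (starRingEnd ℂ) (vertex n k) =
        Complex.I := by
      rw [conj_vertex]
      linear_combination Complex.I * vertex_mul_vertex_neg k
    rw [this, Complex.I_re]

theorem hess_firstA (hn : 3 ≤ n) (j : Fin 3) :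
    hess n m ((![modeV n 1, modeV' n 1, centerX n] : Fin 3 → Config n) j) =
      ∑ i, firstBlock n m i j • (![modeV n 1, modeV' n 1, centerX n] : Fin 3 → Config n) i := by
  have key : ∀ α β c : ℂ, hess n m (fourierMode n 1 α β + centerMode n c) = _ :=
    hess_fourierMode_one hn
  have k1 := key (1 / 2) (1 / 2) 0
  have k2 := key (-1 / 2) (1 / 2) 0
  have k3 := key 0 0 1
  simp only [centerMode_zero, add_zero, fourierMode_zero, zero_add] at k1 k2 k3
  rw [Fin.sum_univ_three]
  fin_cases j <;>
    simp only [firstBlock, modeV_eq, modeV'_eq, Nat.cast_one, centerX_eq, Fin.zero_eta,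
      Fin.mk_one, Fin.reduceFinMk, Matrix.cons_val_zero,
      Matrix.cons_val_one, Matrix.cons_val, Matrix.smul_apply, Matrix.of_apply, smul_eq_mul,
      mul_smul, Fin.isValue, Matrix.cons_val', Matrix.cons_val_fin_one, k1, k2, k3] <;>
    rw [← smul_add, ← smul_add] <;>
    simp only [smul_fourierMode, fourierMode_add, smul_centerMode] <;>
    refine congrArg _ (congrArg₂ _ (congrArg₂ _ ?_ ?_) (congrArg _ ?_)) <;>
    simp only [conj_half, conj_neg_half, map_zero,
      map_one] <;>
    push_cast <;> ring

theorem hess_firstB (hn : 3 ≤ n) (j : Fin 3) :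
    hess n m ((![modeW' n 1, modeW n 1, centerY n] : Fin 3 → Config n) j) =
      ∑ i, firstBlock n m i j • (![modeW' n 1, modeW n 1, centerY n] : Fin 3 → Config n) i := by
  have key : ∀ α β c : ℂ, hess n m (fourierMode n 1 α β + centerMode n c) = _ :=
    hess_fourierMode_one hn
  have k1 := key (-Complex.I / 2) (Complex.I / 2) 0
  have k2 := key (Complex.I / 2) (Complex.I / 2) 0
  have k3 := key 0 0 Complex.I
  simp only [centerMode_zero, add_zero, fourierMode_zero, zero_add] at k1 k2 k3
  rw [Fin.sum_univ_three]
  fin_cases j <;>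
    simp only [firstBlock, modeW_eq, modeW'_eq, Nat.cast_one, centerY_eq, Fin.zero_eta,
      Fin.mk_one, Fin.reduceFinMk, Matrix.cons_val_zero,
      Matrix.cons_val_one, Matrix.cons_val, Matrix.smul_apply, Matrix.of_apply, smul_eq_mul,
      mul_smul, Fin.isValue, Matrix.cons_val', Matrix.cons_val_fin_one, k1, k2, k3] <;>
    rw [← smul_add, ← smul_add] <;>
    simp only [smul_fourierMode, fourierMode_add, smul_centerMode] <;>
    refine congrArg _ (congrArg₂ _ (congrArg₂ _ ?_ ?_) (congrArg _ ?_)) <;>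
    simp only [conj_half_I, conj_neg_half_I, Complex.conj_I, map_zero,
      map_one] <;>
    push_cast <;> ring

theorem coeffMatrix_eq {κ : Type} [Fintype κ] {T : Config n →L[ℝ] Config n} {u : κ → Config n}
    {M : Matrix κ κ ℝ} (hu : ∀ i, u i ≠ 0) (ho : ∀ i j, i ≠ j → inner ℝ (u i) (u j) = 0)
    (hT : ∀ j, T (u j) = ∑ i, M i j • u i) : coeffMatrix T u = M := by
  ext i j
  rw [coeffMatrix, Matrix.of_apply, hT, inner_sum]
  rw [Finset.sum_eq_single i]
  · rw [inner_smul_right, mul_div_cancel_right₀]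
    exact inner_self_ne_zero.2 (hu i)
  · intro k _ hk
    rw [inner_smul_right, ho i k hk.symm, mul_zero]
  · simp

/-! ### The action of the dihedral group on the modes -/

theorem rotationAction_fourierMode (a l : ZMod n) (α β : ℂ) :
    rotationAction n a (fourierMode n l α β) =
      fourierMode n l (α * vertex n (-(l * a))) (β * vertex n (l * a)) := by
  ext i
  rcases i with _ | k
  · simp [rotationAction]
  · change vertex n a * fourierMode n l α β (some (k - a)) = _
    have e1 : l * (k - a) = l * k + -(l * a) := by ring
    have e2 : -(l * k + -(l * a)) = -(l * k) + l * a := by ring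
    simp only [fourierMode_some]
    rw [e1, e2, sub_eq_add_neg]
    simp only [vertex_add]
    linear_combination (α * (vertex n (l * k) * vertex n (-(l * a))) +
      β * (vertex n (-(l * k)) * vertex n (l * a))) * vertex n k * vertex_mul_vertex_neg a

theorem reflectionAction_fourierMode (l : ZMod n) (α β : ℂ) :
    reflectionAction n (fourierMode n l α β) =
      fourierMode n l ((starRingEnd ℂ) α) ((starRingEnd ℂ) β) := by
  ext i
  rcases i with _ | k
  · simp [reflectionAction]
  · change (starRingEnd ℂ) (fourierMode n l α β (some (-k))) = _
    simp only [fourierMode_some, map_mul, map_add, conj_vertex, mul_neg, neg_neg]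

theorem rotationAction_centerMode (a : ZMod n) (c : ℂ) :
    rotationAction n a (centerMode n c) = centerMode n (vertex n a * c) := by
  ext i
  cases i <;> simp [rotationAction]

theorem reflectionAction_centerMode (c : ℂ) :
    reflectionAction n (centerMode n c) = centerMode n ((starRingEnd ℂ) c) := by
  ext i
  cases i <;> simp [reflectionAction]

theorem dihedralRep_r (a : ZMod n) (x : Config n) :
    dihedralRep n (.r a) x = rotationAction n a x := rfl

theorem dihedralRep_sr (a : ZMod n) (x : Config n) :
    dihedralRep n (.sr a) x = reflectionAction n (rotationAction n a x) := rfl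

theorem actsByMatrix_V_W' (l : ℕ) :
    ActsByMatrix n (dihedralRho n l) ![modeV n l, modeW' n l] := by
  rintro (a | a) j <;> rw [Fin.sum_univ_two] <;> fin_cases j <;>
  simp only [modeV_eq, modeW'_eq, dihedralRep_r, dihedralRep_sr, rotationAction_fourierMode,
    reflectionAction_fourierMode, vertex_natCast_mul, vertex_neg_natCast_mul, dihedralRho,
    Fin.zero_eta, Fin.mk_one, Matrix.cons_val_zero, Matrix.cons_val_one, Matrix.of_apply,
    Matrix.cons_val', Matrix.cons_val_fin_one, Matrix.mul_apply, Fin.sum_univ_two, Fin.isValue,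
    smul_fourierMode, fourierMode_add, map_mul, map_add, map_sub, conj_half,
    conj_half_I, conj_neg_half_I, Complex.conj_ofReal, Complex.conj_I] <;>
  refine congrArg₂ _ ?_ ?_ <;> push_cast <;> ring_nf <;> (try rw [Complex.I_sq]) <;> ring

theorem actsByMatrix_V'_W (l : ℕ) :
    ActsByMatrix n (dihedralRho n l) ![modeV' n l, modeW n l] := by
  rintro (a | a) j <;> rw [Fin.sum_univ_two] <;> fin_cases j <;>
  simp only [modeV'_eq, modeW_eq, dihedralRep_r, dihedralRep_sr, rotationAction_fourierMode,
    reflectionAction_fourierMode, vertex_natCast_mul, vertex_neg_natCast_mul, dihedralRho,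
    Fin.zero_eta, Fin.mk_one, Matrix.cons_val_zero, Matrix.cons_val_one, Matrix.of_apply,
    Matrix.cons_val', Matrix.cons_val_fin_one, Matrix.mul_apply, Fin.sum_univ_two, Fin.isValue,
    smul_fourierMode, fourierMode_add, map_mul, map_add, map_sub, conj_half, conj_neg_half,
    conj_half_I, Complex.conj_ofReal, Complex.conj_I] <;>
  refine congrArg₂ _ ?_ ?_ <;> push_cast <;> ring_nf <;> (try rw [Complex.I_sq]) <;> ring

theorem actsByMatrix_center : ActsByMatrix n (dihedralRho n 1) ![centerX n, centerY n] := by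
  have h : ∀ a : ZMod n, vertex n a = Real.cos ((1 : ℕ) * vertexAngle n a) +
      Real.sin ((1 : ℕ) * vertexAngle n a) * Complex.I := by
    intro a
    rw [← vertex_natCast_mul, Nat.cast_one, one_mul]
  rintro (a | a) j <;> rw [Fin.sum_univ_two] <;> fin_cases j <;>
  simp only [centerX_eq, centerY_eq, dihedralRep_r, dihedralRep_sr, rotationAction_centerMode,
    reflectionAction_centerMode, h, dihedralRho,
    Fin.zero_eta, Fin.mk_one, Matrix.cons_val_zero, Matrix.cons_val_one, Matrix.of_apply,
    Matrix.cons_val', Matrix.cons_val_fin_one, Matrix.mul_apply, Fin.sum_univ_two, Fin.isValue,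
    smul_centerMode, centerMode_add, map_mul, map_add, map_one, Complex.conj_ofReal,
    Complex.conj_I] <;>
  refine congrArg _ ?_ <;> push_cast <;> ring_nf <;> (try rw [Complex.I_sq]) <;> ring

theorem actsByChar_fourierMode {l : ZMod n} {e b : ℝ} {α : ℂ}
    (h1 : ∀ a : ZMod n, vertex n (l * a) = ((e ^ a.val : ℝ) : ℂ))
    (hb : (starRingEnd ℂ) α = b * α) :
    ActsByChar n (dihedralChar n e b) (fourierMode n l α α) := by
  have h2 : ∀ a : ZMod n, vertex n (-(l * a)) = ((e ^ a.val : ℝ) : ℂ) := by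
    intro a
    rw [← conj_vertex, h1, Complex.conj_ofReal]
  rintro (a | a)
  · rw [dihedralRep_r, rotationAction_fourierMode, h1, h2, dihedralChar, smul_fourierMode, mul_comm]
  · rw [dihedralRep_sr, rotationAction_fourierMode, reflectionAction_fourierMode, h1, h2,
      dihedralChar, smul_fourierMode, map_mul, Complex.conj_ofReal, hb]
    push_cast
    refine congrArg₂ _ ?_ ?_ <;> ring

theorem isSymmetryAdapted : IsSymmetryAdapted n := by
  have h0 : ∀ a : ZMod n, vertex n (((0 : ℕ) : ZMod n) * a) = (((1 : ℝ) ^ a.val : ℝ) : ℂ) := by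
    intro a
    simp [vertex_zero]
  have hI : (starRingEnd ℂ) (Complex.I / 2) = ((-1 : ℝ) : ℂ) * (Complex.I / 2) := by
    rw [conj_half_I]
    push_cast
    ring
  have h1 : (starRingEnd ℂ) (1 / 2) = ((1 : ℝ) : ℂ) * (1 / 2) := by
    rw [conj_half]
    simp
  refine ⟨?_, ?_, fun he => ?_, fun l _ _ => ⟨actsByMatrix_V_W' l, actsByMatrix_V'_W l⟩,
    actsByMatrix_center⟩
  · rw [modeV_eq]
    exact actsByChar_fourierMode h0 h1
  · rw [modeW_eq]
    exact actsByChar_fourierMode h0 hI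
  · have h2 : ∀ a : ZMod n,
        vertex n (((n / 2 : ℕ) : ZMod n) * a) = (((-1 : ℝ) ^ a.val : ℝ) : ℂ) := by
      intro a
      obtain ⟨r, hr⟩ := he
      have hn0 : (n : ℝ) ≠ 0 := by exact_mod_cast NeZero.ne n
      have e : ((n / 2 : ℕ) : ℝ) * vertexAngle n a = a.val * Real.pi := by
        have : ((n / 2 : ℕ) : ℝ) = n / 2 := by
          rw [show n / 2 = r by omega, hr]
          push_cast
          ring
        rw [this, vertexAngle]
        field_simp
      rw [vertex_natCast_mul, e, Real.sin_nat_mul_pi, Real.cos_nat_mul_pi]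
      simp
    rw [modeV_eq, modeW_eq]
    exact ⟨actsByChar_fourierMode h2 h1, actsByChar_fourierMode h2 hI⟩

/-! ### The symmetry-adapted basis -/

/-- These are the frequencies with l = -l modulo n: the two characters coincide, and the mode has
real dimension two instead of four. -/
theorem modeV'_zero_or_half {l : ℕ} (h : l = 0 ∨ 2 * l = n) : modeV' n l = 0 ∧ modeW' n l = 0 := by
  have hs : ∀ k : ZMod n, Real.sin (l * vertexAngle n k) = 0 := by
    intro k
    rcases h with h | h
    · simp [h]
    · have hn0 : (l : ℝ) ≠ 0 := by
        have := NeZero.ne n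
        exact_mod_cast (by omega : l ≠ 0)
      have : (l : ℝ) * vertexAngle n k = k.val * Real.pi := by
        have h' : (n : ℝ) = 2 * l := by exact_mod_cast h.symm
        rw [vertexAngle, h']
        field_simp
      rw [this, Real.sin_nat_mul_pi]
  constructor <;> ext i <;> rcases i with _ | k
  · rfl
  · change -(Real.sin (l * vertexAngle n k) : ℂ) * _ = 0
    rw [hs]
    simp
  · rfl
  · change (Real.sin (l * vertexAngle n k) : ℂ) * _ = 0
    rw [hs]
    simp

theorem fourierMode_neg (l : ZMod n) (α β : ℂ) :
    fourierMode n (-l) α β = fourierMode n l β α := by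
  ext i
  rcases i with _ | k
  · rfl
  · simp only [fourierMode_some, neg_mul, neg_neg]
    ring

theorem fourierMode_eq_sum (l : ℕ) (α β : ℂ) : fourierMode n l α β =
    (α.re + β.re) • modeV n l + (β.re - α.re) • modeV' n l + (β.im - α.im) • modeW' n l +
      (α.im + β.im) • modeW n l := by
  simp only [modeV_eq, modeV'_eq, modeW_eq, modeW'_eq, smul_fourierMode, fourierMode_add]
  refine congrArg₂ _ ?_ ?_ <;> apply Complex.ext <;> simp <;> ring

/-- Fourier inversion on `ZMod n` for the co-rotating entries x_k ζ^{-k}. All residues l occur, so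
the β-component is not needed. -/
theorem config_eq_sum (x : Config n) : x = centerMode n (x none) + ∑ l : ZMod n,
    fourierMode n l ((n : ℂ)⁻¹ * ∑ j, x (some j) * vertex n (-j) * vertex n (-(l * j))) 0 := by
  have hn0 : (n : ℂ) ≠ 0 := by exact_mod_cast NeZero.ne n
  ext i
  rcases i with _ | k
  · simp
  · have e : ∀ l : ZMod n, fourierMode n l
        ((n : ℂ)⁻¹ * ∑ j, x (some j) * vertex n (-j) * vertex n (-(l * j))) 0 (some k) =
        (n : ℂ)⁻¹ * vertex n k *
          ∑ j, x (some j) * vertex n (-j) * vertex n ((k - j) * l) := by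
      intro l
      rw [fourierMode_some, zero_mul, add_zero, Finset.mul_sum, Finset.mul_sum, Finset.sum_mul,
        Finset.sum_mul]
      refine Finset.sum_congr rfl fun j _ => ?_
      have : (k - j) * l = l * k + -(l * j) := by ring
      rw [this, vertex_add]
      ring
    simp only [PiLp.add_apply, centerMode_some, zero_add, WithLp.ofLp_sum, Finset.sum_apply]
    rw [Finset.sum_congr rfl fun l _ => e l, ← Finset.mul_sum, Finset.sum_comm,
      Finset.sum_eq_single k]
    · simp only [sub_self, zero_mul, vertex_zero, mul_one, Finset.sum_const, Finset.card_univ,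
        ZMod.card, nsmul_eq_mul]
      field_simp
      linear_combination -(x (some k)) * vertex_mul_vertex_neg k
    · intro j _ hj
      rw [← Finset.mul_sum, sum_vertex_mul (sub_ne_zero.2 hj.symm), mul_zero]
    · simp

/-- Linear independence is never checked directly: spanning, together with the count 2n + 2 of
`card_adaptedIndex`, makes the family a basis. -/
theorem span_blockVector (hn : 3 ≤ n) :
    Submodule.span ℝ (Set.range fun x : AdaptedIndex n => blockVector n x.1 x.2) = ⊤ := by
  set S := Submodule.span ℝ (Set.range fun x : AdaptedIndex n => blockVector n x.1 x.2) with hS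
  have hmem : ∀ (β : BlockIndex n) (i : Fin (blockSize n β)), blockVector n β i ∈ S :=
    fun β i => Submodule.subset_span ⟨⟨β, i⟩, rfl⟩
  have hmode : ∀ l : ℕ, l ≤ n / 2 →
      modeV n l ∈ S ∧ modeV' n l ∈ S ∧ modeW' n l ∈ S ∧ modeW n l ∈ S := by
    intro l hl
    by_cases h0 : l = 0
    · have h := modeV'_zero_or_half (n := n) (Or.inl h0)
      rw [h.1, h.2, h0]
      exact ⟨hmem .phi1 (0 : Fin 1), S.zero_mem, S.zero_mem, hmem .phi2 (0 : Fin 1)⟩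
    by_cases h1 : l = 1
    · rw [h1]
      exact ⟨hmem .A1 (0 : Fin 3), hmem .A1 (1 : Fin 3), hmem .B1 (0 : Fin 3),
        hmem .B1 (1 : Fin 3)⟩
    by_cases h2 : 2 * l = n
    · have h := modeV'_zero_or_half (n := n) (Or.inr h2)
      have he : Even n := ⟨l, by omega⟩
      have hl2 : l = n / 2 := by omega
      rw [h.1, h.2, hl2]
      exact ⟨hmem (.phi3 ⟨he⟩) (0 : Fin 1), S.zero_mem, S.zero_mem,
        hmem (.phi4 ⟨he⟩) (0 : Fin 1)⟩
    · let L : HighMode n := ⟨⟨l, by omega⟩, by constructor <;> simp only <;> omega⟩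
      exact ⟨hmem (.A L) (0 : Fin 2), hmem (.A L) (1 : Fin 2), hmem (.B L) (0 : Fin 2),
        hmem (.B L) (1 : Fin 2)⟩
  have hf : ∀ (l : ℕ) (α β : ℂ), l ≤ n / 2 → fourierMode n l α β ∈ S := by
    intro l α β hl
    obtain ⟨h1, h2, h3, h4⟩ := hmode l hl
    rw [fourierMode_eq_sum]
    exact S.add_mem (S.add_mem (S.add_mem (S.smul_mem _ h1) (S.smul_mem _ h2)) (S.smul_mem _ h3))
      (S.smul_mem _ h4)
  have hf' : ∀ (l : ZMod n) (α β : ℂ), fourierMode n l α β ∈ S := by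
    intro l α β
    -- Every residue is ± a natural number at most n/2, and changing the sign of l only exchanges α
    -- and β.
    have h1 := ZMod.natAbs_valMinAbs_le l
    have h2 := ZMod.coe_valMinAbs l
    rcases Int.natAbs_eq l.valMinAbs with h | h
    · rw [h] at h2
      rw [← h2, Int.cast_natCast]
      exact hf _ _ _ h1
    · rw [h] at h2
      rw [← h2, Int.cast_neg, Int.cast_natCast, fourierMode_neg]
      exact hf _ _ _ h1
  rw [eq_top_iff]
  intro x _
  rw [config_eq_sum x]
  refine S.add_mem ?_ (S.sum_mem fun l _ => hf' _ _ _)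
  have : centerMode n (x none) = (x none).re • centerX n + (x none).im • centerY n := by
    rw [centerX_eq, centerY_eq, smul_centerMode, smul_centerMode, centerMode_add]
    congr 1
    rw [mul_one, Complex.re_add_im]
  rw [this]
  exact S.add_mem (S.smul_mem _ (hmem .A1 (2 : Fin 3))) (S.smul_mem _ (hmem .B1 (2 : Fin 3)))

theorem card_highMode (hn : 3 ≤ n) : Fintype.card (HighMode n) = (n - 1) / 2 - 1 := by
  rw [Fintype.card_subtype, ← Finset.card_map Fin.valEmbedding]
  have : (Finset.univ.filter fun l : Fin n => 2 ≤ l.val ∧ 2 * l.val < n).map Fin.valEmbedding =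
      Finset.Ico 2 ((n - 1) / 2 + 1) := by
    ext l
    simp only [Finset.mem_map, Finset.mem_filter, Finset.mem_univ, true_and, Fin.valEmbedding_apply,
      Finset.mem_Ico]
    constructor
    · rintro ⟨a, ⟨h1, h2⟩, rfl⟩
      omega
    · rintro ⟨h1, h2⟩
      exact ⟨⟨l, by omega⟩, ⟨h1, by simp only; omega⟩, rfl⟩
  rw [this, Nat.card_Ico]
  omega

/-- The blocks grouped by their type. -/
def blockIndexEquiv (n : ℕ) : BlockIndex n ≃
    (Bool ⊕ Bool) ⊕ ((PLift (Even n) ⊕ PLift (Even n)) ⊕ (HighMode n ⊕ HighMode n)) where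
  toFun
    | .phi1 => .inl (.inl true)
    | .phi2 => .inl (.inl false)
    | .A1 => .inl (.inr true)
    | .B1 => .inl (.inr false)
    | .phi3 h => .inr (.inl (.inl h))
    | .phi4 h => .inr (.inl (.inr h))
    | .A l => .inr (.inr (.inl l))
    | .B l => .inr (.inr (.inr l))
  invFun
    | .inl (.inl true) => .phi1
    | .inl (.inl false) => .phi2
    | .inl (.inr true) => .A1
    | .inl (.inr false) => .B1
    | .inr (.inl (.inl h)) => .phi3 h
    | .inr (.inl (.inr h)) => .phi4 h
    | .inr (.inr (.inl l)) => .A l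
    | .inr (.inr (.inr l)) => .B l
  left_inv x := by cases x <;> rfl
  right_inv x := by rcases x with (_ | _) | ((_ | _) | (_ | _)) <;> (try rfl) <;> rename_i b <;> cases b <;> rfl

theorem card_adaptedIndex (hn : 3 ≤ n) : Fintype.card (AdaptedIndex n) = 2 * n + 2 := by
  rw [Fintype.card_sigma, ← Equiv.sum_comp (blockIndexEquiv n).symm]
  simp only [Fintype.sum_sum_type, Fintype.card_fin, Fintype.sum_bool]
  simp only [blockIndexEquiv, Equiv.coe_fn_symm_mk, blockSize, Finset.sum_const, Finset.card_univ,
    smul_eq_mul, card_highMode hn]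
  by_cases he : Even n
  · have : Fintype.card (PLift (Even n)) = 1 := Fintype.card_eq_one_iff.2 ⟨⟨he⟩, fun _ => rfl⟩
    rw [this]
    obtain ⟨r, hr⟩ := he
    omega
  · have : Fintype.card (PLift (Even n)) = 0 := Fintype.card_eq_zero_iff.2 ⟨fun h => he h.down⟩
    rw [this]
    have := Nat.not_even_iff.1 he
    omega

theorem finrank_config : Module.finrank ℝ (Config n) = 2 * n + 2 := by
  rw [LinearEquiv.finrank_eq (WithLp.linearEquiv 2 ℝ (Body n → ℂ)), Module.finrank_pi_fintype]
  simp [Complex.finrank_real_complex, ZMod.card]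
  ring

/-- The symmetry-adapted basis. -/
noncomputable def adaptedBasis (hn : 3 ≤ n) : Module.Basis (AdaptedIndex n) ℝ (Config n) :=
  basisOfTopLeSpanOfCardEqFinrank (fun x : AdaptedIndex n => blockVector n x.1 x.2)
    (span_blockVector hn).ge (by rw [card_adaptedIndex hn, finrank_config])

theorem adaptedBasis_apply (hn : 3 ≤ n) (x : AdaptedIndex n) :
    adaptedBasis hn x = blockVector n x.1 x.2 := by
  rw [adaptedBasis, coe_basisOfTopLeSpanOfCardEqFinrank]

theorem vertexAngle_zero : vertexAngle n 0 = 0 := by simp [vertexAngle]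

theorem modeV_ne_zero (l : ℕ) : modeV n l ≠ 0 := by
  intro h
  have h1 : modeV n l (some 0) = 0 := by rw [h]; rfl
  change (Real.cos (l * vertexAngle n 0) : ℂ) * vertex n 0 = 0 at h1
  simp [vertexAngle_zero, vertex_zero] at h1

theorem modeW_ne_zero (l : ℕ) : modeW n l ≠ 0 := by
  intro h
  have h1 : modeW n l (some 0) = 0 := by rw [h]; rfl
  change (Real.cos (l * vertexAngle n 0) : ℂ) * (Complex.I * vertex n 0) = 0 at h1
  simp [vertexAngle_zero, vertex_zero] at h1

theorem modeV'_ne_zero {l : ℕ} (hl : 0 < l) (hl' : 2 * l < n) : modeV' n l ≠ 0 := by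
  intro h
  have h1 : modeV' n l (some 1) = 0 := by rw [h]; rfl
  change -(Real.sin (l * vertexAngle n 1) : ℂ) * (Complex.I * vertex n 1) = 0 at h1
  have : Fact (1 < n) := ⟨by omega⟩
  have hn0 : (0 : ℝ) < n := by exact_mod_cast NeZero.pos n
  have hl0 : (0 : ℝ) < l := by exact_mod_cast hl
  have hl1 : (2 * l : ℝ) < n := by exact_mod_cast hl'
  have hs : 0 < Real.sin (l * vertexAngle n 1) := by
    rw [vertexAngle, ZMod.val_one]
    apply Real.sin_pos_of_pos_of_lt_pi
    · have := Real.pi_pos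
      positivity
    · rw [mul_div_assoc', div_lt_iff₀ hn0]
      push_cast
      nlinarith [Real.pi_pos]
  have hs' : (Real.sin (l * vertexAngle n 1) : ℂ) ≠ 0 := by exact_mod_cast hs.ne'
  exact (mul_ne_zero (neg_ne_zero.2 hs') (mul_ne_zero Complex.I_ne_zero (vertex_ne_zero 1))) h1

theorem centerX_ne_zero : centerX n ≠ 0 := by
  intro h
  have h1 : centerX n none = 0 := by rw [h]; rfl
  exact one_ne_zero h1

theorem inner_real_mul_I (a b : ℝ) (q : ℂ) : inner ℝ (a * q) (b * (Complex.I * q)) = 0 := by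
  rw [Complex.inner]
  simp
  ring

theorem inner_modeV_modeV' (l l' : ℕ) : inner ℝ (modeV n l) (modeV' n l') = 0 := by
  rw [config_inner]
  refine Finset.sum_eq_zero fun i _ => ?_
  rcases i with _ | k
  · exact inner_zero_left _
  · have := inner_real_mul_I (Real.cos (l * vertexAngle n k)) (-Real.sin (l' * vertexAngle n k))
      (vertex n k)
    rwa [Complex.ofReal_neg] at this

theorem inner_modeV_modeW (l l' : ℕ) : inner ℝ (modeV n l) (modeW n l') = 0 := by
  rw [config_inner]
  refine Finset.sum_eq_zero fun i _ => ?_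
  rcases i with _ | k
  · exact inner_zero_left _
  · exact inner_real_mul_I (Real.cos (l * vertexAngle n k)) (Real.cos (l' * vertexAngle n k)) _

theorem inner_fourierMode_centerMode (l : ZMod n) (α β c : ℂ) :
    inner ℝ (fourierMode n l α β) (centerMode n c) = 0 := by
  rw [config_inner, Fintype.sum_option]
  simp

theorem coeffMatrix_pair {T : Config n →L[ℝ] Config n} {u v : Config n} (hu : u ≠ 0) (hv : v ≠ 0)
    (h : inner ℝ u v = 0) {M : Matrix (Fin 2) (Fin 2) ℝ}
    (hT : ∀ j, T ((![u, v] : Fin 2 → Config n) j) =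
      ∑ i, M i j • (![u, v] : Fin 2 → Config n) i) :
    coeffMatrix T ![u, v] = M := by
  have h' : inner ℝ v u = 0 := by rw [real_inner_comm, h]
  refine coeffMatrix_eq (fun i => ?_) (fun i j hij => ?_) hT
  · fin_cases i <;> assumption
  · fin_cases i <;> fin_cases j <;> first | exact absurd rfl hij | assumption

theorem blockA1_eq (hn : 3 ≤ n) : blockA1 n m = firstBlock n m := by
  have h1 := modeV_ne_zero (n := n) 1
  have h2 := modeV'_ne_zero (n := n) one_pos (by omega)
  have h3 := centerX_ne_zero (n := n)
  have i1 := inner_modeV_modeV' (n := n) 1 1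
  have i2 : inner ℝ (modeV n 1) (centerX n) = 0 := by
    rw [modeV_eq]; exact inner_fourierMode_centerMode _ _ _ _
  have i3 : inner ℝ (modeV' n 1) (centerX n) = 0 := by
    rw [modeV'_eq]; exact inner_fourierMode_centerMode _ _ _ _
  have i1' : inner ℝ (modeV' n 1) (modeV n 1) = 0 := by rw [real_inner_comm, i1]
  have i2' : inner ℝ (centerX n) (modeV n 1) = 0 := by rw [real_inner_comm, i2]
  have i3' : inner ℝ (centerX n) (modeV' n 1) = 0 := by rw [real_inner_comm, i3]
  refine coeffMatrix_eq (fun i => ?_) (fun i j hij => ?_) (hess_firstA hn)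
  · fin_cases i <;> assumption
  · fin_cases i <;> fin_cases j <;> first | exact absurd rfl hij | assumption

theorem blockA_eq (hn : 3 ≤ n) {l : ℕ} (hl : 2 ≤ l) (hl' : 2 * l < n) :
    blockA n m l = modeBlock n m l := by
  rw [blockA, if_neg hl'.ne]
  exact coeffMatrix_pair (modeV_ne_zero l) (modeV'_ne_zero (by omega) hl')
    (inner_modeV_modeV' l l) (hess_modeV_modeV' hn hl (by omega))

theorem hess_modeV_half (hn : 3 ≤ n) {l : ℕ} (hl : 2 * l = n) :
    hess n m (modeV n l) = modeBlock n m l 0 0 • modeV n l := by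
  have h := hess_modeV_modeV' (m := m) hn (l := l) (by omega) (by omega) 0
  rw [Fin.sum_univ_two] at h
  simpa [(modeV'_zero_or_half (Or.inr hl)).1] using h

theorem hess_modeW_half (hn : 3 ≤ n) {l : ℕ} (hl : 2 * l = n) :
    hess n m (modeW n l) = modeBlock n m l 1 1 • modeW n l := by
  have h := hess_modeW'_modeW (m := m) hn (l := l) (by omega) (by omega) 1
  rw [Fin.sum_univ_two] at h
  simpa [(modeV'_zero_or_half (Or.inr hl)).2] using h

theorem scalarBlock_eq {v : Config n} {c : ℝ} (hv : v ≠ 0) (h : hess n m v = c • v) :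
    scalarBlock n m v = c := by
  rw [scalarBlock, h, inner_smul_right, mul_div_cancel_right₀]
  exact inner_self_ne_zero.2 hv

theorem blockA_half (hn : 3 ≤ n) {l : ℕ} (hl : 2 * l = n) : blockA n m l =
    Matrix.diagonal ![modeBlock n m l 0 0, modeBlock n m l 1 1] := by
  rw [blockA, if_pos hl]
  refine coeffMatrix_pair (modeV_ne_zero l) (modeW_ne_zero l) (inner_modeV_modeW l l) fun j => ?_
  rw [Fin.sum_univ_two]
  fin_cases j
  · simp [hess_modeV_half hn hl]
  · simp [hess_modeW_half hn hl]

/-- Passing from (α, β) to v_l, v_l' leaves the determinant AD - B². For l = n/2 the block is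
diagonal with entries (A + D)/2 ± B, and evenness of P gives A = D, so the same formula holds. -/
theorem det_blockA (hn : 3 ≤ n) {l : ℕ} (hl : 2 ≤ l) (hl' : l ≤ n / 2) :
    (blockA n m l).det = n / 2 *
      ((gonP n (l + 1) + 2 * gonP n 1 + 3 * m / 2) * (gonP n (l - 1) + 2 * gonP n 1 + 3 * m / 2) -
        (3 * (gonP n 1 - gonP n l) + 3 * m / 2) ^ 2) := by
  have hsq : √(n / 2 : ℝ) ^ 2 = n / 2 := Real.sq_sqrt (by positivity)
  rcases (by omega : 2 * l < n ∨ 2 * l = n) with h | h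
  · rw [blockA_eq hn hl h, modeBlock, Matrix.det_fin_two]
    simp only [Matrix.smul_apply, Matrix.of_apply, Matrix.cons_val_zero, Matrix.cons_val_one,
      Matrix.cons_val', Matrix.cons_val_fin_one, smul_eq_mul]
    generalize √(n / 2 : ℝ) = s at hsq ⊢
    rw [← hsq]
    ring
  · have hz : (l : ZMod n) + l = 0 := by
      have : ((2 * l : ℕ) : ZMod n) = 0 := by rw [h]; exact ZMod.natCast_self n
      push_cast at this
      rw [← this]
      ring
    have e : gonP n (l + 1) = gonP n (l - 1) := by
      rw [← gonP_neg]
      congr 1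
      linear_combination -hz
    rw [blockA_half hn h, modeBlock, Matrix.det_diagonal, Fin.prod_univ_two]
    simp only [Matrix.smul_apply, Matrix.of_apply, Matrix.cons_val_zero, Matrix.cons_val_one,
      Matrix.cons_val', Matrix.cons_val_fin_one, smul_eq_mul]
    generalize √(n / 2 : ℝ) = s at hsq ⊢
    rw [← hsq, e]
    ring

/-- Translations lie in this mode, and the Hessian sends them to √(n/2)·λM times themselves. This
accounts for the factor λ, and the mass of the centre for the factor m; the remaining factor is
affine in m. -/
theorem det_blockA1 (hn : 3 ≤ n) : (blockA1 n m).det = √(n / 2 : ℝ) ^ 3 *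
    (m * gonLam n m * ((gonP n 2 + 2 * gonP n 1) * (n / 2 + 2 * gonP n 1) +
      3 * m / 2 * (gonP n 2 + 4 * gonP n 1 - n))) := by
  rw [blockA1_eq hn, firstBlock, Matrix.det_fin_three, gonLam]
  simp only [Matrix.smul_apply, Matrix.of_apply, Matrix.cons_val_zero, Matrix.cons_val_one,
    Matrix.cons_val, Matrix.cons_val', Matrix.cons_val_fin_one, smul_eq_mul]
  ring

/-! ### The Hessian is block diagonal -/

theorem z0_eq_modeV : z0 n = modeV n 0 := by
  ext i
  rcases i with _ | k
  · rfl
  · change vertex n k = (Real.cos _ : ℂ) * vertex n k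
    simp

theorem rotationDirection_eq_modeW : rotationDirection n = modeW n 0 := by
  ext i
  rcases i with _ | k
  · change Complex.I * 0 = 0
    simp
  · change Complex.I * vertex n k = (Real.cos _ : ℂ) * (Complex.I * vertex n k)
    simp

theorem hess_blockVector (hn : 3 ≤ n) (β : BlockIndex n) (j : Fin (blockSize n β)) :
    hess n m (blockVector n β j) = ∑ i, hessBlock n m β i j • blockVector n β i := by
  cases β with
  | phi1 =>
    have h : hess n m (modeV n 0) = (0 : ℝ) • modeV n 0 := by rw [← z0_eq_modeV, hess_z0 (by omega), zero_smul]
    have hs := scalarBlock_eq (modeV_ne_zero 0) h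
    change hess n m (modeV n 0) = ∑ i : Fin 1, scalarBlock n m (modeV n 0) • modeV n 0
    rw [Fin.sum_univ_one, hs, h]
  | phi2 =>
    have h : hess n m (modeW n 0) = (0 : ℝ) • modeW n 0 := by rw [hess_modeW_zero hn, zero_smul]
    have hs := scalarBlock_eq (modeW_ne_zero 0) h
    change hess n m (modeW n 0) = ∑ i : Fin 1, scalarBlock n m (modeW n 0) • modeW n 0
    rw [Fin.sum_univ_one, hs, h]
  | phi3 he =>
    have h := hess_modeV_half (m := m) hn (l := n / 2) (Nat.two_mul_div_two_of_even he.down)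
    have hs := scalarBlock_eq (modeV_ne_zero (n / 2)) h
    change hess n m (modeV n (n / 2)) =
      ∑ i : Fin 1, scalarBlock n m (modeV n (n / 2)) • modeV n (n / 2)
    rw [Fin.sum_univ_one, hs, h]
  | phi4 he =>
    have h := hess_modeW_half (m := m) hn (l := n / 2) (Nat.two_mul_div_two_of_even he.down)
    have hs := scalarBlock_eq (modeW_ne_zero (n / 2)) h
    change hess n m (modeW n (n / 2)) =
      ∑ i : Fin 1, scalarBlock n m (modeW n (n / 2)) • modeW n (n / 2)
    rw [Fin.sum_univ_one, hs, h]
  | A1 =>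
    have h := hess_firstA (m := m) hn j
    rwa [← blockA1_eq hn] at h
  | B1 =>
    have h := hess_firstB (m := m) hn j
    rwa [← blockA1_eq hn] at h
  | A l =>
    have h2 := l.2.2
    have h := hess_modeV_modeV' (m := m) hn l.2.1 (by omega) j
    rwa [← blockA_eq hn l.2.1 l.2.2] at h
  | B l =>
    have h2 := l.2.2
    have h := hess_modeW'_modeW (m := m) hn l.2.1 (by omega) j
    rwa [← blockA_eq hn l.2.1 l.2.2] at h

theorem toMatrix_hess (hn : 3 ≤ n) :
    LinearMap.toMatrix (adaptedBasis hn) (adaptedBasis hn) (hess n m : Config n →ₗ[ℝ] Config n) =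
      Matrix.blockDiagonal' (hessBlock n m) := by
  ext ⟨β, i⟩ ⟨γ, j⟩
  rw [LinearMap.toMatrix_apply, adaptedBasis_apply]
  have h : (hess n m : Config n →ₗ[ℝ] Config n) (blockVector n γ j) =
      ∑ k, hessBlock n m γ k j • adaptedBasis hn ⟨γ, k⟩ := by
    simp only [adaptedBasis_apply]
    exact hess_blockVector hn γ j
  rw [h, map_sum, Finset.sum_apply']
  simp only [map_smul, Finsupp.smul_apply, Module.Basis.repr_self, smul_eq_mul]
  by_cases hb : β = γ
  · subst hb
    rw [Matrix.blockDiagonal'_apply_eq, Finset.sum_eq_single i]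
    · simp
    · intro k _ hk
      rw [Finsupp.single_apply, if_neg, mul_zero]
      intro h
      exact hk (by simpa using h)
    · simp
  · rw [Matrix.blockDiagonal'_apply_ne _ _ _ hb]
    refine Finset.sum_eq_zero fun k _ => ?_
    rw [Finsupp.single_apply, if_neg, mul_zero]
    intro h
    exact hb (congrArg Sigma.fst h).symm

/-! ### The kernel of the Hessian -/

theorem hess_sum (hn : 3 ≤ n) (β : BlockIndex n) (c : Fin (blockSize n β) → ℝ) :
    hess n m (∑ j, c j • blockVector n β j) =
      ∑ i, (hessBlock n m β).mulVec c i • blockVector n β i := by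
  simp only [map_sum, map_smul, hess_blockVector hn, Finset.smul_sum, Matrix.mulVec, dotProduct,
    Finset.sum_smul]
  rw [Finset.sum_comm]
  refine Finset.sum_congr rfl fun i _ => Finset.sum_congr rfl fun j _ => ?_
  rw [smul_smul, mul_comm]

/-- The kernel of a block-diagonal operator is the sum of the kernels of its blocks, and the blocks
φ₁ and φ₂ are exactly the scaling and rotation lines that degeneracy disregards. -/
theorem degenerate_iff_hessBlock (hn : 3 ≤ n) : Degenerate n m ↔
    ∃ β : BlockIndex n, β ≠ .phi1 ∧ β ≠ .phi2 ∧ (hessBlock n m β).det = 0 := by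
  set b := adaptedBasis hn with hb
  have hv : ∀ β j, blockVector n β j = b ⟨β, j⟩ := fun β j => (adaptedBasis_apply hn ⟨β, j⟩).symm
  obtain ⟨i₁, hz⟩ : ∃ i, z0 n = b ⟨.phi1, i⟩ :=
    ⟨(0 : Fin 1), z0_eq_modeV.trans (hv .phi1 (0 : Fin 1))⟩
  obtain ⟨i₂, hr⟩ : ∃ i, rotationDirection n = b ⟨.phi2, i⟩ :=
    ⟨(0 : Fin 1), rotationDirection_eq_modeW.trans (hv .phi2 (0 : Fin 1))⟩
  have hdec : ∀ x : Config n, x = ∑ β, ∑ j, b.repr x ⟨β, j⟩ • blockVector n β j := by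
    intro x
    conv_lhs => rw [← b.sum_repr x]
    rw [Fintype.sum_sigma]
    simp only [hv]
  constructor
  · rintro ⟨v, hv0, hvs⟩
    by_contra hcon
    push Not at hcon
    apply hvs
    have hc : ∀ β : BlockIndex n, β ≠ .phi1 → β ≠ .phi2 → ∀ j, b.repr v ⟨β, j⟩ = 0 := by
      intro β h1 h2
      have hm : (hessBlock n m β).mulVec (fun j => b.repr v ⟨β, j⟩) = 0 := by
        have hh : hess n m v = ∑ x : AdaptedIndex n,
            (hessBlock n m x.1).mulVec (fun j => b.repr v ⟨x.1, j⟩) x.2 • b x := by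
          conv_lhs => rw [hdec v]
          rw [map_sum, Fintype.sum_sigma]
          refine Finset.sum_congr rfl fun γ _ => ?_
          rw [hess_sum hn]
          simp only [hv]
        rw [hv0] at hh
        have := Fintype.linearIndependent_iff.1 b.linearIndependent _ hh.symm
        funext i
        exact this ⟨β, i⟩
      have := Matrix.eq_zero_of_mulVec_eq_zero (hcon β h1 h2) hm
      exact fun j => congrFun this j
    rw [hdec v]
    refine Submodule.sum_mem _ fun β _ => Submodule.sum_mem _ fun j _ => ?_
    by_cases h1 : β = .phi1
    · subst h1
      refine Submodule.smul_mem _ _ (Submodule.subset_span (Or.inl ?_))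
      rw [z0_eq_modeV]
      rfl
    by_cases h2 : β = .phi2
    · subst h2
      refine Submodule.smul_mem _ _ (Submodule.subset_span (Or.inr ?_))
      rw [rotationDirection_eq_modeW]
      rfl
    rw [hc β h1 h2, zero_smul]
    exact Submodule.zero_mem _
  · rintro ⟨β, h1, h2, hd⟩
    obtain ⟨c, hc0, hc⟩ := Matrix.exists_mulVec_eq_zero_iff.2 hd
    refine ⟨∑ j, c j • blockVector n β j, ?_, ?_⟩
    · rw [hess_sum hn, hc]
      simp
    · intro hmem
      rw [hz, hr, Submodule.mem_span_pair] at hmem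
      obtain ⟨x, y, hxy⟩ := hmem
      apply hc0
      funext i
      have h := congrArg (fun v => b.repr v ⟨β, i⟩) hxy
      have e1 : (⟨.phi1, i₁⟩ : AdaptedIndex n) ≠ ⟨β, i⟩ :=
        fun h => h1 (congrArg Sigma.fst h).symm
      have e2 : (⟨.phi2, i₂⟩ : AdaptedIndex n) ≠ ⟨β, i⟩ :=
        fun h => h2 (congrArg Sigma.fst h).symm
      simp only [map_add, map_smul, Finsupp.add_apply, Finsupp.smul_apply, Module.Basis.repr_self,
        Finsupp.single_apply, if_neg e1, if_neg e2, map_sum, hv,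
        Finset.sum_apply', smul_eq_mul] at h
      rw [Finset.sum_eq_single i] at h
      · simpa using h.symm
      · intro j _ hj
        rw [if_neg, mul_zero]
        intro h'
        exact hj (by simpa using h')
      · simp

theorem degenerate_iff (hn : 3 ≤ n) : Degenerate n m ↔
    (blockA1 n m).det = 0 ∨ ∃ l : ℕ, 2 ≤ l ∧ l ≤ n / 2 ∧ (blockA n m l).det = 0 := by
  rw [degenerate_iff_hessBlock hn]
  have hhalf : Even n → (blockA n m (n / 2)).det =
      scalarBlock n m (modeV n (n / 2)) * scalarBlock n m (modeW n (n / 2)) := by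
    intro he
    have h2 := Nat.two_mul_div_two_of_even he
    rw [blockA_half hn h2, Matrix.det_diagonal, Fin.prod_univ_two,
      scalarBlock_eq (modeV_ne_zero _) (hess_modeV_half hn h2),
      scalarBlock_eq (modeW_ne_zero _) (hess_modeW_half hn h2)]
    rfl
  have hhl : Even n → 2 ≤ n / 2 := by
    rintro ⟨r, hr⟩
    omega
  constructor
  · rintro ⟨β, h1, h2, hd⟩
    cases β with
    | phi1 => exact absurd rfl h1
    | phi2 => exact absurd rfl h2
    | phi3 he =>
      refine Or.inr ⟨n / 2, hhl he.down, le_rfl, ?_⟩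
      rw [hhalf he.down]
      have : scalarBlock n m (modeV n (n / 2)) = 0 := by
        rw [← hd]
        exact (Matrix.det_fin_one (Matrix.of fun _ _ => scalarBlock n m (modeV n (n / 2)))).symm
      rw [this, zero_mul]
    | phi4 he =>
      refine Or.inr ⟨n / 2, hhl he.down, le_rfl, ?_⟩
      rw [hhalf he.down]
      have : scalarBlock n m (modeW n (n / 2)) = 0 := by
        rw [← hd]
        exact (Matrix.det_fin_one (Matrix.of fun _ _ => scalarBlock n m (modeW n (n / 2)))).symm
      rw [this, mul_zero]
    | A1 => exact Or.inl hd
    | B1 => exact Or.inl hd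
    | A l =>
      have := l.2.2
      exact Or.inr ⟨l.1, l.2.1, by omega, hd⟩
    | B l =>
      have := l.2.2
      exact Or.inr ⟨l.1, l.2.1, by omega, hd⟩
  · rintro (h | ⟨l, hl, hl', h⟩)
    · exact ⟨.A1, by simp, by simp, h⟩
    · rcases (by omega : 2 * l < n ∨ 2 * l = n) with h2 | h2
      · exact ⟨.A ⟨⟨l, by omega⟩, hl, h2⟩, by simp, by simp, h⟩
      · have he : Even n := ⟨l, by omega⟩
        have hl2 : l = n / 2 := by omega
        rw [hl2, hhalf he] at h
        rcases mul_eq_zero.1 h with h | h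
        · refine ⟨.phi3 ⟨he⟩, by simp, by simp, ?_⟩
          exact (Matrix.det_fin_one
            (Matrix.of fun _ _ => scalarBlock n m (modeV n (n / 2)))).trans h
        · refine ⟨.phi4 ⟨he⟩, by simp, by simp, ?_⟩
          exact (Matrix.det_fin_one
            (Matrix.of fun _ _ => scalarBlock n m (modeW n (n / 2)))).trans h

/-! ### The sequence `P_l` -/

/-- `R_l = ½ ∑_t cos (l t θ) / |1 - ζ^t|`, the second difference of `P_l`. -/
noncomputable def gonR (n : ℕ) [NeZero n] (l : ZMod n) : ℝ :=
  1 / 2 * ∑ t : ZMod n, ‖1 - vertex n t‖⁻¹ * (vertex n (l * t)).re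

theorem norm_one_sub_vertex_sq (t : ZMod n) : ‖1 - vertex n t‖ ^ 2 = 2 - 2 * (vertex n t).re := by
  have h1 := Complex.sq_norm (vertex n t)
  rw [norm_vertex, Complex.normSq_apply] at h1
  rw [Complex.sq_norm, Complex.normSq_apply]
  simp only [Complex.sub_re, Complex.sub_im, Complex.one_re, Complex.one_im]
  linear_combination -h1

/-- The second difference of cos(lx) in l is -(2 - 2 cos x) cos(lx), and 2 - 2 cos(tθ) = |1 - ζ^t|²,
so two powers of the distance cancel. -/
theorem gonP_second_diff (l : ZMod n) : gonP n (l + 1) + gonP n (l - 1) - 2 * gonP n l = gonR n l := by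
  simp only [gonP, gonR]
  rw [← sub_eq_zero]
  have : ∀ a b c d : ℝ, 1 / 2 * a + 1 / 2 * b - 2 * (1 / 2 * c) - 1 / 2 * d =
      1 / 2 * (a + b - 2 * c - d) := by intros; ring
  rw [this, Finset.mul_sum, ← Finset.sum_add_distrib, ← Finset.sum_sub_distrib,
    ← Finset.sum_sub_distrib]
  rw [Finset.sum_eq_zero, mul_zero]
  intro t _
  by_cases hz : ‖1 - vertex n t‖ = 0
  · simp [hz]
  have h := norm_one_sub_vertex_sq t
  have e1 : vertex n ((l + 1) * t) = vertex n (l * t) * vertex n t := by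
    rw [← vertex_add]; congr 1; ring
  have e2 : vertex n ((l - 1) * t) = vertex n (l * t) * (starRingEnd ℂ) (vertex n t) := by
    rw [conj_vertex, ← vertex_add]; congr 1; ring
  rw [e1, e2]
  simp only [Complex.mul_re, Complex.conj_re, Complex.conj_im]
  field_simp
  linear_combination -(vertex n (l * t)).re * h

theorem gonR_zero : gonR n 0 = 2 * gonP n 1 := by
  rw [← gonP_second_diff, zero_add, zero_sub, gonP_neg, gonP_zero]
  ring

theorem gonR_neg (l : ZMod n) : gonR n (-l) = gonR n l := by
  simp only [gonR, neg_mul, ← conj_vertex, Complex.conj_re]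

/-! ### Monotonicity of R_l and of the singular masses -/

theorem sum_zmod_val {M : Type*} [AddCommMonoid M] (f : ℕ → M) :
    ∑ t : ZMod n, f t.val = ∑ j ∈ Finset.range n, f j := by
  obtain ⟨k, rfl⟩ := Nat.exists_eq_succ_of_ne_zero (NeZero.ne n)
  exact Fin.sum_univ_eq_sum_range f (k + 1)

theorem sin_pi_mul_div_nonneg {j : ℕ} (hj : j ≤ n) : 0 ≤ Real.sin (Real.pi * j / n) := by
  have hn0 : (0 : ℝ) < n := by exact_mod_cast NeZero.pos n
  have hj' : (j : ℝ) ≤ n := by exact_mod_cast hj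
  apply Real.sin_nonneg_of_nonneg_of_le_pi
  · have := Real.pi_pos
    positivity
  · rw [div_le_iff₀ hn0]
    exact mul_le_mul_of_nonneg_left hj' Real.pi_pos.le

theorem vertexAngle_eq (t : ZMod n) : vertexAngle n t = 2 * (Real.pi * t.val / n) := by
  rw [vertexAngle]
  ring

theorem vertex_re (l : ℕ) (t : ZMod n) :
    (vertex n ((l : ZMod n) * t)).re = Real.cos (l * vertexAngle n t) := by
  rw [vertex_natCast_mul]
  simp [-Complex.ofReal_cos, -Complex.ofReal_sin]

theorem norm_one_sub_vertex (t : ZMod n) :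
    ‖1 - vertex n t‖ = 2 * Real.sin (Real.pi * t.val / n) := by
  have h0 := sin_pi_mul_div_nonneg (n := n) (ZMod.val_lt t).le
  have h := norm_one_sub_vertex_sq t
  have h1 := vertex_re (n := n) 1 t
  rw [Nat.cast_one, one_mul, Nat.cast_one, one_mul, vertexAngle_eq, Real.cos_two_mul] at h1
  rw [h1] at h
  rw [← sq_eq_sq₀ (norm_nonneg _) (by positivity), h]
  linear_combination -4 * Real.sin_sq_add_cos_sq (Real.pi * t.val / n)

theorem two_mul_sin_mul_sum_sin (x : ℝ) (N : ℕ) :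
    2 * Real.sin (x / 2) * ∑ j ∈ Finset.range N, Real.sin (j * x) =
      Real.cos (x / 2) - Real.cos (N * x - x / 2) := by
  induction N with
  | zero =>
    rw [Nat.cast_zero, zero_mul, zero_sub, Real.cos_neg, sub_self, Finset.sum_range_zero, mul_zero]
  | succ N ih =>
    rw [Finset.sum_range_succ, mul_add, ih]
    have e1 : ((N + 1 : ℕ) : ℝ) * x - x / 2 = N * x + x / 2 := by push_cast; ring
    rw [e1, Real.cos_add, Real.cos_sub]
    ring

/-- The difference of the cosines contains sin(πt/n), which cancels the distance 2 sin(πt/n). What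
is left is the sum of sin(jx) with x = (2l + 1)π/n, which telescopes to cot(x/2). -/
theorem gonR_succ {l : ℕ} (hl : l < n) : gonR n ((l + 1 : ℕ) : ZMod n) =
    gonR n l - 1 / 2 * Real.cot ((2 * l + 1) * Real.pi / (2 * n)) := by
  have hn0 : (0 : ℝ) < n := by exact_mod_cast NeZero.pos n
  have hl1 : (l : ℝ) + 1 ≤ n := by exact_mod_cast hl
  set x : ℝ := (2 * l + 1) * Real.pi / n with hx
  have hx2 : (2 * l + 1) * Real.pi / (2 * n) = x / 2 := by rw [hx]; field_simp
  have hs : 0 < Real.sin (x / 2) := by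
    apply Real.sin_pos_of_pos_of_lt_pi
    · have := Real.pi_pos
      positivity
    · rw [← hx2, div_lt_iff₀ (by positivity)]
      nlinarith [Real.pi_pos]
  have key : gonR n ((l + 1 : ℕ) : ZMod n) - gonR n l =
      1 / 2 * ∑ j ∈ Finset.range n, -Real.sin (j * x) := by
    rw [gonR, gonR, ← mul_sub, ← Finset.sum_sub_distrib, ← sum_zmod_val]
    congr 1
    refine Finset.sum_congr rfl fun t _ => ?_
    rw [vertex_re, vertex_re, norm_one_sub_vertex, ← mul_sub, Real.cos_sub_cos, vertexAngle_eq]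
    set y := Real.pi * t.val / n with hy
    have e1 : (((l + 1 : ℕ) : ℝ) * (2 * y) + l * (2 * y)) / 2 = t.val * x := by
      rw [hx, hy]; push_cast; field_simp; ring
    have e2 : (((l + 1 : ℕ) : ℝ) * (2 * y) - l * (2 * y)) / 2 = y := by push_cast; ring
    rw [e1, e2]
    -- The sine vanishes only at t = 0, where the left side is zero by the convention 0⁻¹ = 0 and
    -- the right side because sin 0 = 0.
    by_cases h0 : Real.sin y = 0
    · have ht : t.val = 0 := by
        by_contra hne
        have hpos : 0 < Real.sin y := by
          apply Real.sin_pos_of_pos_of_lt_pi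
          · have := Real.pi_pos
            have : (0 : ℝ) < t.val := by exact_mod_cast Nat.pos_of_ne_zero hne
            positivity
          · rw [hy, div_lt_iff₀ hn0]
            have : (t.val : ℝ) < n := by exact_mod_cast ZMod.val_lt t
            exact mul_lt_mul_of_pos_left this Real.pi_pos
        exact hpos.ne' h0
      simp [ht, h0]
    · field_simp
  have hsum := two_mul_sin_mul_sum_sin x n
  -- Since nx is an odd multiple of π, the two boundary terms of the telescoping sum add up.
  have hc : Real.cos (n * x - x / 2) = -Real.cos (x / 2) := by
    have : n * x - x / 2 = Real.pi - x / 2 + l * (2 * Real.pi) := by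
      rw [hx]
      field_simp
      ring
    rw [this, Real.cos_add_nat_mul_two_pi, Real.cos_pi_sub]
  rw [hc] at hsum
  rw [hx2, Real.cot_eq_cos_div_sin]
  rw [Finset.sum_neg_distrib] at key
  have h2 : ∑ j ∈ Finset.range n, Real.sin (j * x) = Real.cos (x / 2) / Real.sin (x / 2) := by
    rw [eq_div_iff hs.ne']
    linarith
  rw [h2] at key
  linarith

theorem cot_pos_of_lt {l : ℕ} (hl : 2 * l + 1 < n) :
    0 < Real.cot ((2 * l + 1) * Real.pi / (2 * n)) := by
  have hn0 : (0 : ℝ) < n := by exact_mod_cast NeZero.pos n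
  have hl1 : (2 * l : ℝ) + 1 < n := by exact_mod_cast hl
  have hpi := Real.pi_pos
  have h1 : (2 * l + 1) * Real.pi / (2 * n) < Real.pi / 2 := by
    rw [div_lt_iff₀ (by positivity)]
    nlinarith
  have h2 : 0 < (2 * l + 1) * Real.pi / (2 * n) := by positivity
  rw [Real.cot_eq_cos_div_sin]
  exact div_pos (Real.cos_pos_of_mem_Ioo ⟨by linarith, h1⟩)
    (Real.sin_pos_of_pos_of_lt_pi h2 (by linarith))

theorem gonR_succ_lt {l : ℕ} (hl : 2 * l + 1 < n) :
    gonR n ((l + 1 : ℕ) : ZMod n) < gonR n l := by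
  rw [gonR_succ (by omega)]
  linarith [cot_pos_of_lt (n := n) hl]

theorem gonR_lt_of_lt {l i : ℕ} (hli : l < i) (hi : 2 * i ≤ n) : gonR n i < gonR n l := by
  induction i with
  | zero => omega
  | succ i ih =>
    have h := gonR_succ_lt (n := n) (l := i) (by omega)
    rcases Nat.lt_succ_iff_lt_or_eq.1 hli with h1 | h1
    · exact h.trans (ih h1 (by omega))
    · rwa [h1]

theorem natCast_sub_self {i : ℕ} (hi : i ≤ n) : ((n - i : ℕ) : ZMod n) = -(i : ZMod n) := by
  rw [Nat.cast_sub hi, ZMod.natCast_self, zero_sub]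

/-- As R is even, i may be replaced by n - i; the hypotheses say that l lies below both. -/
theorem gonR_lt_of_lt_of_add_lt {l i : ℕ} (hli : l < i) (hi : i + l < n) :
    gonR n i < gonR n l := by
  by_cases h : 2 * i ≤ n
  · exact gonR_lt_of_lt hli h
  · rw [← gonR_neg, ← natCast_sub_self (by omega)]
    exact gonR_lt_of_lt (by omega) (by omega)

theorem gonP_nonneg (l : ZMod n) : 0 ≤ gonP n l := by
  refine mul_nonneg (by norm_num) (Finset.sum_nonneg fun t _ => mul_nonneg (by positivity) ?_)
  have := Complex.re_le_norm (vertex n (l * t))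
  rw [norm_vertex] at this
  linarith

theorem gonP_one_pos (hn : 2 ≤ n) : 0 < gonP n 1 := by
  have : Fact (1 < n) := ⟨hn⟩
  refine mul_pos (by norm_num) (Finset.sum_pos' (fun t _ => mul_nonneg (by positivity) ?_)
    ⟨1, Finset.mem_univ _, ?_⟩)
  · have := Complex.re_le_norm (vertex n (1 * t))
    rw [norm_vertex] at this
    linarith
  · have hs : 0 < ‖1 - vertex n 1‖ := by
      rw [norm_one_sub_vertex, ZMod.val_one]
      have hn0 : (2 : ℝ) ≤ n := by exact_mod_cast hn
      refine mul_pos two_pos (Real.sin_pos_of_pos_of_lt_pi ?_ ?_)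
      · have := Real.pi_pos
        positivity
      · rw [div_lt_iff₀ (by linarith)]
        push_cast
        nlinarith [Real.pi_pos]
    have h := norm_one_sub_vertex_sq (n := n) 1
    rw [one_mul]
    have h2 : 0 < 1 - (vertex n 1).re := by nlinarith
    positivity

/-- The first difference of `P_l`. -/
noncomputable def gonG (n : ℕ) [NeZero n] (l : ℕ) : ℝ := gonP n ((l + 1 : ℕ) : ZMod n) - gonP n l

theorem gonG_succ_sub (l : ℕ) :
    gonG n (l + 1) - gonG n l = gonR n ((l + 1 : ℕ) : ZMod n) := by
  rw [gonG, gonG, ← gonP_second_diff]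
  have e1 : ((l + 1 + 1 : ℕ) : ZMod n) = ((l + 1 : ℕ) : ZMod n) + 1 := by push_cast; ring
  have e2 : ((l + 1 : ℕ) : ZMod n) - 1 = l := by push_cast; ring
  rw [e1, e2]
  ring

theorem gonG_symm {l : ℕ} (hl : l + 1 ≤ n) : gonG n (n - 1 - l) = -gonG n l := by
  rw [gonG, gonG, show n - 1 - l + 1 = n - l by omega, show n - 1 - l = n - (l + 1) by omega,
    natCast_sub_self (by omega), natCast_sub_self hl, gonP_neg, gonP_neg]
  ring

theorem gonG_add_sub (l k : ℕ) : gonG n (l + k) - gonG n l =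
    ∑ i ∈ Finset.range k, gonR n ((l + i + 1 : ℕ) : ZMod n) := by
  induction k with
  | zero => simp
  | succ k ih =>
    rw [Finset.sum_range_succ, ← ih, ← gonG_succ_sub, add_assoc]
    ring

/-- Concavity of the first difference. -/
theorem gonG_ratio_aux {l : ℕ} (hl : 2 * (l + 1) + 1 < n) :
    ((n : ℝ) - 1 - 2 * (l + 1)) * gonG n l ≤ ((n : ℝ) + 1 - 2 * (l + 1)) * gonG n (l + 1) := by
  -- The first difference g is odd about (n - 1)/2, so its increments from l + 1 to the mirror index
  -- add up to -2g_{l+1}. Each is at most R_{l+1} = g_{l+1} - g_l.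
  have h1 := gonG_add_sub (n := n) (l + 1) (n - 1 - 2 * (l + 1))
  rw [show l + 1 + (n - 1 - 2 * (l + 1)) = n - 1 - (l + 1) by omega, gonG_symm (by omega)] at h1
  have h2 : ∑ i ∈ Finset.range (n - 1 - 2 * (l + 1)), gonR n ((l + 1 + i + 1 : ℕ) : ZMod n) ≤
      (n - 1 - 2 * (l + 1) : ℕ) * gonR n ((l + 1 : ℕ) : ZMod n) := by
    rw [← nsmul_eq_mul]
    conv_rhs => rw [← Finset.card_range (n - 1 - 2 * (l + 1))]
    refine Finset.sum_le_card_nsmul _ _ _ fun i hi => ?_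
    have := Finset.mem_range.1 hi
    exact (gonR_lt_of_lt_of_add_lt (by omega) (by omega)).le
  have h3 : ((n - 1 - 2 * (l + 1) : ℕ) : ℝ) = (n : ℝ) - 1 - 2 * (l + 1) := by
    rw [Nat.cast_sub (by omega), Nat.cast_sub (by omega)]
    push_cast
    ring
  rw [h3, ← gonG_succ_sub] at h2
  linarith

/-- The ratio inequality propagates positivity from g₀ = P₁ up to the middle of the period. -/
theorem gonG_pos {l : ℕ} (hl : 2 * l + 1 < n) : 0 < gonG n l := by
  induction l with
  | zero =>
    rw [gonG, zero_add, Nat.cast_one, Nat.cast_zero, gonP_zero, sub_zero]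
    exact gonP_one_pos (by omega)
  | succ l ih =>
    have h1 := gonG_ratio_aux hl
    have h2 := ih (by omega)
    have h3 : (2 * (l + 1) + 1 : ℝ) < n := by exact_mod_cast hl
    have h4 : 0 < ((n : ℝ) - 1 - 2 * (l + 1)) * gonG n l := mul_pos (by linarith) h2
    exact pos_of_mul_pos_right (h4.trans_le h1) (by linarith)

/-- The ratio inequality has constant (p + 2)/p with p = n - 1 - 2(l + 1) ≥ 1; the worst case is p =
1. -/
theorem gonG_le_three_mul {l : ℕ} (hl : 2 * (l + 1) + 1 < n) : gonG n l ≤ 3 * gonG n (l + 1) := by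
  have h1 := gonG_ratio_aux hl
  have h2 := gonG_pos (n := n) (l := l) (by omega)
  have h3 := gonG_pos hl
  have h4 : (2 * (l + 1) + 1 : ℝ) + 1 ≤ n := by exact_mod_cast hl
  nlinarith

theorem gonP_one_le {l : ℕ} (hl : 1 ≤ l) (hl' : 2 * l ≤ n) : gonP n 1 ≤ gonP n l := by
  induction l, hl using Nat.le_induction with
  | base => simp
  | succ l hl ih =>
    have h1 := ih (by omega)
    have h2 := gonG_pos (n := n) (l := l) (by omega)
    rw [gonG] at h2
    linarith

/-- `6` times the mass for which the block of the mode `l + 1` is singular. -/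
noncomputable def gonF (n : ℕ) [NeZero n] (l : ℕ) : ℝ :=
  4 * gonP n ((l + 1 : ℕ) : ZMod n) - 10 * gonP n 1 - gonR n ((l + 1 : ℕ) : ZMod n) +
    (gonG n l + gonG n (l + 1)) ^ 2 /
      (8 * gonP n ((l + 1 : ℕ) : ZMod n) - 2 * gonP n 1 + gonR n ((l + 1 : ℕ) : ZMod n))

/-- Up to a positive factor this is the coefficient of m in the determinant of mode l + 1. Expanding
R_{l+1} turns it into 6P_{l+1} - 2P₁ + P_{l+2} + P_l, and P_{l+1} ≥ P₁. -/
theorem gonF_den_pos {l : ℕ} (hl : 2 * (l + 1) ≤ n) :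
    0 < 8 * gonP n ((l + 1 : ℕ) : ZMod n) - 2 * gonP n 1 + gonR n ((l + 1 : ℕ) : ZMod n) := by
  rw [← gonP_second_diff]
  have h1 := gonP_nonneg (n := n) (((l + 1 : ℕ) : ZMod n) + 1)
  have h2 := gonP_nonneg (n := n) (((l + 1 : ℕ) : ZMod n) - 1)
  have h3 := gonP_one_le (n := n) (l := l + 1) (by omega) hl
  have h4 := gonP_one_pos (n := n) (by omega)
  linarith

/-- The part without the fraction increases by 4g_{l+1} + R_{l+1} - R_{l+2} > 4g_{l+1}. The next
fraction is nonnegative, so it suffices that the current one is below 4g_{l+1}. -/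
theorem gonF_lt_succ {l : ℕ} (hl : 2 * (l + 2) ≤ n) : gonF n l < gonF n (l + 1) := by
  have hd1 := gonF_den_pos (n := n) (l := l) (by omega)
  have hd2 := gonF_den_pos (n := n) (l := l + 1) (by omega)
  have hR := gonR_succ_lt (n := n) (l := l + 1) (by omega)
  have hx := gonG_pos (n := n) (l := l) (by omega)
  have hy := gonG_pos (n := n) (l := l + 1) (by omega)
  have hxy := gonG_le_three_mul (n := n) (l := l) (by omega)
  have hp := gonP_one_le (n := n) (l := l + 1) (by omega) (by omega)
  have hp0 := gonP_nonneg (n := n) l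
  have hG : gonG n l = gonP n ((l + 1 : ℕ) : ZMod n) - gonP n l := rfl
  have hG1 : gonG n (l + 1) = gonP n ((l + 1 + 1 : ℕ) : ZMod n) -
    gonP n ((l + 1 : ℕ) : ZMod n) := rfl
  have hRd := gonG_succ_sub (n := n) l
  have hE : (gonG n l + gonG n (l + 1)) ^ 2 /
      (8 * gonP n ((l + 1 : ℕ) : ZMod n) - 2 * gonP n 1 + gonR n ((l + 1 : ℕ) : ZMod n)) <
      4 * gonG n (l + 1) := by
    rw [div_lt_iff₀ hd1, ← hRd]
    -- With x = g_l and y = g_{l+1} the denominator is at least 5x + y, and (x + y)² < 4y(5x + y)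
    -- follows from x ≤ 3y.
    nlinarith
  have hE2 : 0 ≤ (gonG n (l + 1) + gonG n (l + 1 + 1)) ^ 2 /
      (8 * gonP n ((l + 1 + 1 : ℕ) : ZMod n) - 2 * gonP n 1 +
        gonR n ((l + 1 + 1 : ℕ) : ZMod n)) := div_nonneg (sq_nonneg _) hd2.le
  rw [gonF, gonF]
  linarith

theorem gonF_strictMono {l i : ℕ} (hli : l < i) (hi : 2 * (i + 1) ≤ n) : gonF n l < gonF n i := by
  induction i with
  | zero => omega
  | succ i ih =>
    have h := gonF_lt_succ (n := n) (l := i) (by omega)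
    rcases Nat.lt_succ_iff_lt_or_eq.1 hli with h1 | h1
    · exact (ih h1 (by omega)).trans h
    · rwa [h1]

/-- Both products have leading term 9m²/4, so the determinant has degree one in m and its slope is
positive. -/
theorem det_blockA_eq_zero_iff (hn : 3 ≤ n) {l : ℕ} (hl : 1 ≤ l) (hl' : l + 1 ≤ n / 2) :
    (blockA n m (l + 1)).det = 0 ↔ m = gonF n l / 6 := by
  have hd := gonF_den_pos (n := n) (l := l) (by omega)
  have hn0 : (0 : ℝ) < n := by exact_mod_cast NeZero.pos n
  have hR := gonP_second_diff (n := n) ((l + 1 : ℕ) : ZMod n)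
  have e1 : ((l + 1 : ℕ) : ZMod n) + 1 = ((l + 1 + 1 : ℕ) : ZMod n) := by push_cast; ring
  have e2 : ((l + 1 : ℕ) : ZMod n) - 1 = l := by push_cast; ring
  rw [det_blockA hn (by omega) hl', mul_eq_zero, or_iff_right (by positivity), gonF, gonG, gonG, e1,
    e2]
  rw [e1, e2] at hR
  rw [← hR] at hd ⊢
  generalize gonP n ((l + 1 + 1 : ℕ) : ZMod n) = a at *
  generalize gonP n ((l + 1 : ℕ) : ZMod n) = b at *
  generalize gonP n (l : ZMod n) = c at *
  generalize gonP n 1 = d at *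
  have hd' := hd.ne'
  have key : (a + 2 * d + 3 * m / 2) * (c + 2 * d + 3 * m / 2) - (3 * (d - b) + 3 * m / 2) ^ 2 =
      3 / 2 * (8 * b - 2 * d + (a + c - 2 * b)) * (m - (4 * b - 10 * d - (a + c - 2 * b) +
        (b - c + (a - b)) ^ 2 / (8 * b - 2 * d + (a + c - 2 * b))) / 6) := by
    generalize he : 8 * b - 2 * d + (a + c - 2 * b) = e at hd'
    -- Eliminating P_{l+2} makes the denominator a single variable, after which the identity is
    -- polynomial.
    obtain rfl : a = e - 6 * b + 2 * d - c := by linarith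
    field_simp
    ring
  rw [key, mul_eq_zero, or_iff_right (by positivity), sub_eq_zero]

/-! ### Closed forms in terms of cosecants and cotangents -/

/-- `∑_{0<j<n} 1 / sin (π j / n)`. -/
noncomputable def cscSum (n : ℕ) : ℝ := ∑ j ∈ Finset.range n, (Real.sin (Real.pi * j / n))⁻¹

/-- `cot ((2 l + 1) π / (2 n))`. -/
noncomputable def oddCot (n l : ℕ) : ℝ := Real.cot ((2 * l + 1) * Real.pi / (2 * n))

theorem gonP_one_eq : gonP n 1 = cscSum n / 8 := by
  have h := gonR_zero (n := n)
  rw [gonR] at h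
  have h2 : ∑ t : ZMod n, ‖1 - vertex n t‖⁻¹ * (vertex n (0 * t)).re = cscSum n / 2 := by
    rw [cscSum, ← sum_zmod_val, Finset.sum_div]
    refine Finset.sum_congr rfl fun t _ => ?_
    rw [zero_mul, vertex_zero, norm_one_sub_vertex, Complex.one_re, mul_one, mul_inv]
    ring
  rw [h2] at h
  linarith

theorem gonR_one_eq : gonR n 1 = cscSum n / 4 - oddCot n 0 / 2 := by
  have h := gonR_succ (n := n) (l := 0) (NeZero.pos n)
  rw [zero_add, Nat.cast_one, Nat.cast_zero, gonR_zero, gonP_one_eq] at h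
  rw [h, oddCot, Nat.cast_zero]
  ring

theorem gonR_two_eq (hn : 2 ≤ n) :
    gonR n 2 = cscSum n / 4 - oddCot n 0 / 2 - oddCot n 1 / 2 := by
  have h := gonR_succ (n := n) (l := 1) (by omega)
  rw [Nat.cast_one, gonR_one_eq] at h
  have e : ((1 + 1 : ℕ) : ZMod n) = 2 := by norm_num
  rw [e] at h
  rw [h]
  simp only [oddCot, Nat.cast_one]
  ring

theorem gonR_three_eq (hn : 3 ≤ n) :
    gonR n 3 = cscSum n / 4 - oddCot n 0 / 2 - oddCot n 1 / 2 - oddCot n 2 / 2 := by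
  have h := gonR_succ (n := n) (l := 2) (by omega)
  rw [Nat.cast_two, gonR_two_eq (by omega)] at h
  have e : ((2 + 1 : ℕ) : ZMod n) = 3 := by norm_num
  rw [e] at h
  rw [h]
  simp only [oddCot]
  push_cast
  ring

theorem gonP_two_eq : gonP n 2 = cscSum n / 2 - oddCot n 0 / 2 := by
  have h := gonP_second_diff (n := n) 1
  rw [sub_self, gonP_zero, gonP_one_eq, gonR_one_eq, one_add_one_eq_two] at h
  linarith

theorem gonP_three_eq (hn : 2 ≤ n) :
    gonP n 3 = 9 / 8 * cscSum n - 3 / 2 * oddCot n 0 - oddCot n 1 / 2 := by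
  have h := gonP_second_diff (n := n) 2
  have e1 : (2 : ZMod n) + 1 = 3 := by norm_num
  have e2 : (2 : ZMod n) - 1 = 1 := by norm_num
  rw [e1, e2, gonP_one_eq, gonP_two_eq, gonR_two_eq hn] at h
  linarith

/-- The quantity whose sign decides whether the block of the mode `2` can be singular. -/
noncomputable def secondModeSign (n : ℕ) : ℝ :=
  3 / 4 * cscSum n ^ 2 - 45 / 16 * cscSum n * oddCot n 0 + 9 / 4 * oddCot n 0 ^ 2 +
    3 / 16 * cscSum n * oddCot n 1

/-- The multiplier is a quarter of the positive denominator. In the cleared numerator the square of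
cot(3π/2n) cancels, so `secondModeSign` is linear in it. -/
theorem gonF_one_mul (hn : 4 ≤ n) : ∃ c : ℝ, 0 < c ∧ gonF n 1 * c = secondModeSign n := by
  have hd := gonF_den_pos (n := n) (l := 1) (by omega)
  refine ⟨_, div_pos hd four_pos, ?_⟩
  have e2 : ((1 + 1 : ℕ) : ZMod n) = 2 := by norm_num
  have e3 : ((1 + 1 + 1 : ℕ) : ZMod n) = 3 := by norm_num
  rw [gonF, gonG, gonG, e3, e2]
  rw [e2] at hd
  have hd' := hd.ne'
  rw [gonR_two_eq (by omega), gonP_two_eq, gonP_one_eq] at hd'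
  rw [gonR_two_eq (by omega), gonP_three_eq (by omega), gonP_two_eq, Nat.cast_one, gonP_one_eq,
    secondModeSign]
  generalize cscSum n = S at *
  generalize oddCot n 0 = k at *
  generalize oddCot n 1 = k3 at *
  generalize he : 8 * (S / 2 - k / 2) - 2 * (S / 8) + (S / 4 - k / 2 - k3 / 2) = e at *
  obtain rfl : k3 = 2 * (8 * (S / 2 - k / 2) - 2 * (S / 8) + (S / 4 - k / 2) - e) := by linarith
  field_simp
  ring

/-- Dropping the nonnegative fraction is affordable: mode 3 only needs a positive lower bound. -/
theorem gonF_two_lower (hn : 6 ≤ n) :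
    3 * cscSum n - 11 / 2 * oddCot n 0 - 3 / 2 * oddCot n 1 + oddCot n 2 / 2 ≤ gonF n 2 := by
  have hd := gonF_den_pos (n := n) (l := 2) (by omega)
  have e3 : ((2 + 1 : ℕ) : ZMod n) = 3 := by norm_num
  have h := div_nonneg (sq_nonneg (gonG n 2 + gonG n (2 + 1))) hd.le
  rw [gonF, e3]
  rw [e3] at h
  rw [gonR_three_eq (by omega), gonP_three_eq (by omega), gonP_one_eq] at h ⊢
  linarith

/-- After removal of the positive factors an affine equation in m is left, with positive constant
term by `firstMode_const_pos`; solvability in m > 0 depends only on the sign of the slope. -/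
theorem det_blockA1_eq_zero_iff (hn : 3 ≤ n) (hm : 0 < m) : (blockA1 n m).det = 0 ↔
    (cscSum n * 3 / 4 - oddCot n 0 / 2) * (n / 2 + cscSum n / 4) +
      3 * m / 2 * (cscSum n - oddCot n 0 / 2 - n) = 0 := by
  have hn0 : (0 : ℝ) < n := by exact_mod_cast NeZero.pos n
  have h1 := gonP_one_pos (n := n) (by omega)
  have hlam : 0 < gonLam n m := by rw [gonLam]; linarith
  have hs : 0 < √(n / 2 : ℝ) := Real.sqrt_pos.2 (by positivity)
  rw [det_blockA1 hn, mul_eq_zero, or_iff_right (by positivity), mul_eq_zero,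
    or_iff_right (by positivity), gonP_two_eq, gonP_one_eq]
  ring_nf

theorem firstMode_const_pos (hn : 3 ≤ n) :
    0 < (cscSum n * 3 / 4 - oddCot n 0 / 2) * (n / 2 + cscSum n / 4) := by
  have hn0 : (0 : ℝ) < n := by exact_mod_cast NeZero.pos n
  have h1 := gonP_one_pos (n := n) (by omega)
  have h2 := gonP_nonneg (n := n) 2
  rw [gonP_one_eq] at h1
  rw [gonP_two_eq] at h2
  exact mul_pos (by linarith) (by linarith)

/-! ### Taylor bounds -/

/-- Integrating an inequality from 0. Alternating between sine and cosine, it raises the order of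
the Taylor bounds by one each time. -/
theorem le_of_hasDerivAt_le {f g f' g' : ℝ → ℝ} (hf : ∀ x, HasDerivAt f (f' x) x)
    (hg : ∀ x, HasDerivAt g (g' x) x) (h0 : f 0 = g 0) (h : ∀ x, 0 ≤ x → f' x ≤ g' x) {x : ℝ}
    (hx : 0 ≤ x) : f x ≤ g x := by
  have hd : ∀ x, HasDerivAt (fun x => g x - f x) (g' x - f' x) x := fun x => (hg x).sub (hf x)
  have hm : MonotoneOn (fun x => g x - f x) (Set.Ici 0) := by
    refine monotoneOn_of_deriv_nonneg (convex_Ici 0)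
      (fun x _ => (hd x).continuousAt.continuousWithinAt)
      (fun x _ => (hd x).differentiableAt.differentiableWithinAt) fun x hx => ?_
    rw [interior_Ici] at hx
    rw [(hd x).deriv]
    exact sub_nonneg.2 (h x (le_of_lt hx))
  have := hm (Set.mem_Ici.2 le_rfl) (Set.mem_Ici.2 hx) hx
  simp only [h0, sub_self] at this
  linarith

theorem cos_le_taylor_four {x : ℝ} (hx : 0 ≤ x) : Real.cos x ≤ 1 - x ^ 2 / 2 + x ^ 4 / 24 := by
  refine le_of_hasDerivAt_le (f := Real.cos) (f' := fun x => -Real.sin x)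
    (g := fun x => 1 - x ^ 2 / 2 + x ^ 4 / 24) (g' := fun x => -x + x ^ 3 / 6)
    Real.hasDerivAt_cos (fun x => ?_) (by simp) (fun x hx => ?_) hx
  · refine ((((hasDerivAt_pow 2 x).div_const 2).const_sub 1).add
      ((hasDerivAt_pow 4 x).div_const 24)).congr_deriv ?_
    norm_num
    ring
  · linarith [Real.sin_ge_sub_cube hx]

theorem sin_le_taylor_five {x : ℝ} (hx : 0 ≤ x) : Real.sin x ≤ x - x ^ 3 / 6 + x ^ 5 / 120 := by
  refine le_of_hasDerivAt_le (f := Real.sin) (f' := Real.cos)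
    (g := fun x => x - x ^ 3 / 6 + x ^ 5 / 120) (g' := fun x => 1 - x ^ 2 / 2 + x ^ 4 / 24)
    Real.hasDerivAt_sin (fun x => ?_) (by simp) (fun x hx => cos_le_taylor_four hx) hx
  refine (((hasDerivAt_id x).sub ((hasDerivAt_pow 3 x).div_const 6)).add
    ((hasDerivAt_pow 5 x).div_const 120)).congr_deriv ?_
  norm_num
  ring

theorem taylor_six_le_cos {x : ℝ} (hx : 0 ≤ x) :
    1 - x ^ 2 / 2 + x ^ 4 / 24 - x ^ 6 / 720 ≤ Real.cos x := by
  refine le_of_hasDerivAt_le (g := Real.cos) (g' := fun x => -Real.sin x)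
    (f := fun x => 1 - x ^ 2 / 2 + x ^ 4 / 24 - x ^ 6 / 720)
    (f' := fun x => -x + x ^ 3 / 6 - x ^ 5 / 120) (fun x => ?_)
    Real.hasDerivAt_cos (by simp) (fun x hx => ?_) hx
  · refine (((((hasDerivAt_pow 2 x).div_const 2).const_sub 1).add
      ((hasDerivAt_pow 4 x).div_const 24)).sub ((hasDerivAt_pow 6 x).div_const 720)).congr_deriv ?_
    norm_num
    ring
  · linarith [sin_le_taylor_five hx]

theorem taylor_seven_le_sin {x : ℝ} (hx : 0 ≤ x) :
    x - x ^ 3 / 6 + x ^ 5 / 120 - x ^ 7 / 5040 ≤ Real.sin x := by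
  refine le_of_hasDerivAt_le (g := Real.sin) (g' := Real.cos)
    (f := fun x => x - x ^ 3 / 6 + x ^ 5 / 120 - x ^ 7 / 5040)
    (f' := fun x => 1 - x ^ 2 / 2 + x ^ 4 / 24 - x ^ 6 / 720) (fun x => ?_)
    Real.hasDerivAt_sin (by simp) (fun x hx => taylor_six_le_cos hx) hx
  refine ((((hasDerivAt_id x).sub ((hasDerivAt_pow 3 x).div_const 6)).add
    ((hasDerivAt_pow 5 x).div_const 120)).sub ((hasDerivAt_pow 7 x).div_const 5040)).congr_deriv ?_
  norm_num
  ring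

theorem cos_le_taylor_eight {x : ℝ} (hx : 0 ≤ x) :
    Real.cos x ≤ 1 - x ^ 2 / 2 + x ^ 4 / 24 - x ^ 6 / 720 + x ^ 8 / 40320 := by
  refine le_of_hasDerivAt_le (f := Real.cos) (f' := fun x => -Real.sin x)
    (g := fun x => 1 - x ^ 2 / 2 + x ^ 4 / 24 - x ^ 6 / 720 + x ^ 8 / 40320)
    (g' := fun x => -x + x ^ 3 / 6 - x ^ 5 / 120 + x ^ 7 / 5040)
    Real.hasDerivAt_cos (fun x => ?_) (by simp) (fun x hx => ?_) hx
  · refine ((((((hasDerivAt_pow 2 x).div_const 2).const_sub 1).add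
      ((hasDerivAt_pow 4 x).div_const 24)).sub ((hasDerivAt_pow 6 x).div_const 720)).add
      ((hasDerivAt_pow 8 x).div_const 40320)).congr_deriv ?_
    norm_num
    ring
  · linarith [taylor_seven_le_sin hx]

theorem sin_le_taylor_nine {x : ℝ} (hx : 0 ≤ x) :
    Real.sin x ≤ x - x ^ 3 / 6 + x ^ 5 / 120 - x ^ 7 / 5040 + x ^ 9 / 362880 := by
  refine le_of_hasDerivAt_le (f := Real.sin) (f' := Real.cos)
    (g := fun x => x - x ^ 3 / 6 + x ^ 5 / 120 - x ^ 7 / 5040 + x ^ 9 / 362880)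
    (g' := fun x => 1 - x ^ 2 / 2 + x ^ 4 / 24 - x ^ 6 / 720 + x ^ 8 / 40320)
    Real.hasDerivAt_sin (fun x => ?_) (by simp) (fun x hx => cos_le_taylor_eight hx) hx
  refine (((((hasDerivAt_id x).sub ((hasDerivAt_pow 3 x).div_const 6)).add
    ((hasDerivAt_pow 5 x).div_const 120)).sub ((hasDerivAt_pow 7 x).div_const 5040)).add
    ((hasDerivAt_pow 9 x).div_const 362880)).congr_deriv ?_
  norm_num
  ring

/-! ### Numerical bounds -/

/-- `1 / sin (π r)`. -/
noncomputable def cscPi (r : ℝ) : ℝ := (Real.sin (Real.pi * r))⁻¹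

theorem cscPi_one_sub (r : ℝ) : cscPi (1 - r) = cscPi r := by
  rw [cscPi, cscPi, mul_sub, mul_one, Real.sin_pi_sub]

theorem cscPi_half : cscPi (1 / 2) = 1 := by
  rw [cscPi, mul_one_div, Real.sin_pi_div_two, inv_one]

theorem cscPi_zero : cscPi 0 = 0 := by simp [cscPi]

theorem cscSum_eq (n : ℕ) : cscSum n = ∑ j ∈ Finset.range n, cscPi (j / n) := by
  simp only [cscSum, cscPi, mul_div_assoc]

/-- For r ≤ 12/25 even the upper approximation of πr stays below π/2, where sine is increasing, so π
can be replaced by its decimal bounds. -/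
theorem sin_pi_mul_bounds {r : ℝ} (h0 : 0 ≤ r) (h1 : r ≤ 12 / 25) {a b : ℝ}
    (ha : a = 3.141592 * r) (hb : b = 3.141593 * r) :
    a - a ^ 3 / 6 + a ^ 5 / 120 - a ^ 7 / 5040 ≤ Real.sin (Real.pi * r) ∧
      Real.sin (Real.pi * r) ≤ b - b ^ 3 / 6 + b ^ 5 / 120 - b ^ 7 / 5040 + b ^ 9 / 362880 := by
  have l1 := Real.pi_gt_d6
  have l2 := Real.pi_lt_d6
  have hx : a ≤ Real.pi * r := by rw [ha]; exact mul_le_mul_of_nonneg_right l1.le h0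
  have hx' : Real.pi * r ≤ b := by rw [hb]; exact mul_le_mul_of_nonneg_right l2.le h0
  have ha0 : 0 ≤ a := by rw [ha]; positivity
  have hh : Real.pi * r ≤ Real.pi / 2 := by nlinarith
  constructor
  · exact (taylor_seven_le_sin ha0).trans
      (Real.sin_le_sin_of_le_of_le_pi_div_two (by linarith) hh hx)
  · exact (Real.sin_le_sin_of_le_of_le_pi_div_two (by linarith) (by rw [hb]; linarith) hx').trans
      (sin_le_taylor_nine (by linarith))

theorem cos_pi_mul_bounds {r : ℝ} (h0 : 0 ≤ r) (h1 : r ≤ 12 / 25) {a b : ℝ}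
    (ha : a = 3.141592 * r) (hb : b = 3.141593 * r) :
    1 - b ^ 2 / 2 + b ^ 4 / 24 - b ^ 6 / 720 ≤ Real.cos (Real.pi * r) ∧
      Real.cos (Real.pi * r) ≤ 1 - a ^ 2 / 2 + a ^ 4 / 24 - a ^ 6 / 720 + a ^ 8 / 40320 := by
  have l1 := Real.pi_gt_d6
  have l2 := Real.pi_lt_d6
  have hx : a ≤ Real.pi * r := by rw [ha]; exact mul_le_mul_of_nonneg_right l1.le h0
  have hx' : Real.pi * r ≤ b := by rw [hb]; exact mul_le_mul_of_nonneg_right l2.le h0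
  have ha0 : 0 ≤ a := by rw [ha]; positivity
  have hb0 : b ≤ Real.pi := by rw [hb]; linarith
  constructor
  · exact (taylor_six_le_cos (by linarith)).trans
      (Real.cos_le_cos_of_nonneg_of_le_pi (by linarith) hb0 hx')
  · exact (Real.cos_le_cos_of_nonneg_of_le_pi ha0 (by linarith) hx).trans (cos_le_taylor_eight ha0)

theorem cscPi_bounds {r a b c d : ℝ} (h0 : 0 < r) (h1 : r ≤ 12 / 25)
    (ha : a = 3.141592 * r) (hb : b = 3.141593 * r) (hc0 : 0 < c) (hd0 : 0 < d)
    (hc : c * (b - b ^ 3 / 6 + b ^ 5 / 120 - b ^ 7 / 5040 + b ^ 9 / 362880) ≤ 1)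
    (hd : 1 ≤ d * (a - a ^ 3 / 6 + a ^ 5 / 120 - a ^ 7 / 5040)) :
    c ≤ cscPi r ∧ cscPi r ≤ d := by
  obtain ⟨h2, h3⟩ := sin_pi_mul_bounds h0.le h1 ha hb
  have hs : 0 < Real.sin (Real.pi * r) := Real.sin_pos_of_pos_of_lt_pi
    (mul_pos Real.pi_pos h0) (by nlinarith [Real.pi_pos])
  constructor
  · rw [cscPi, ← one_div, le_div_iff₀ hs]
    exact (mul_le_mul_of_nonneg_left h3 hc0.le).trans hc
  · rw [cscPi, ← one_div, div_le_iff₀ hs]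
    exact hd.trans (mul_le_mul_of_nonneg_left h2 hd0.le)

theorem cot_pi_mul_bounds {r a b c d : ℝ} (h0 : 0 < r) (h1 : r ≤ 12 / 25)
    (ha : a = 3.141592 * r) (hb : b = 3.141593 * r) (hc0 : 0 ≤ c) (hd0 : 0 ≤ d)
    (hc : c * (b - b ^ 3 / 6 + b ^ 5 / 120 - b ^ 7 / 5040 + b ^ 9 / 362880) ≤
      1 - b ^ 2 / 2 + b ^ 4 / 24 - b ^ 6 / 720)
    (hd : 1 - a ^ 2 / 2 + a ^ 4 / 24 - a ^ 6 / 720 + a ^ 8 / 40320 ≤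
      d * (a - a ^ 3 / 6 + a ^ 5 / 120 - a ^ 7 / 5040)) :
    c ≤ Real.cot (Real.pi * r) ∧ Real.cot (Real.pi * r) ≤ d := by
  obtain ⟨h2, h3⟩ := sin_pi_mul_bounds h0.le h1 ha hb
  obtain ⟨h4, h5⟩ := cos_pi_mul_bounds h0.le h1 ha hb
  have hs : 0 < Real.sin (Real.pi * r) := Real.sin_pos_of_pos_of_lt_pi
    (mul_pos Real.pi_pos h0) (by nlinarith [Real.pi_pos])
  rw [Real.cot_eq_cos_div_sin, le_div_iff₀ hs, div_le_iff₀ hs]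
  exact ⟨(mul_le_mul_of_nonneg_left h3 hc0).trans (hc.trans h4),
    h5.trans (hd.trans (mul_le_mul_of_nonneg_left h2 hd0))⟩

theorem oddCot_eq (n l : ℕ) : oddCot n l = Real.cot (Real.pi * ((2 * l + 1) / (2 * n))) := by
  rw [oddCot]
  congr 1
  ring

/-- Pairing j with n - j halves the cosecant sum; for even n, as in later cases, the unpaired middle
term is 1. -/
theorem trig_bounds_three :
    (2.30940 ≤ cscSum 3 ∧ cscSum 3 ≤ 2.30942) ∧
    (1.73205 ≤ oddCot 3 0 ∧ oddCot 3 0 ≤ 1.73206) := by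
  have e : cscSum 3 = 2 * (cscPi (1 / 3)) := by
    rw [cscSum_eq]
    simp only [Finset.sum_range_succ, Finset.sum_range_zero]
    norm_num only
    rw [show (2 / 3 : ℝ) = 1 - 1 / 3 by norm_num]
    simp only [cscPi_one_sub, cscPi_zero]
    ring
  have c1 := cscPi_bounds (r := 1 / 3) (c := 1.15470) (d := 1.15471) (by norm_num) (by norm_num) rfl rfl
    (by norm_num) (by norm_num) (by norm_num) (by norm_num)
  have k0 := cot_pi_mul_bounds (r := (2 * 0 + 1) / (2 * 3)) (c := 1.73205) (d := 1.73206) (by norm_num)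
    (by norm_num) rfl rfl (by norm_num) (by norm_num) (by norm_num) (by norm_num)
  refine ⟨?_, by rw [oddCot_eq]; exact_mod_cast k0⟩
  rw [e]
  constructor <;> linarith [c1.1, c1.2]

theorem trig_bounds_four :
    (3.82842 ≤ cscSum 4 ∧ cscSum 4 ≤ 3.82844) ∧
    (2.41421 ≤ oddCot 4 0 ∧ oddCot 4 0 ≤ 2.41422) ∧
    (0.41411 ≤ oddCot 4 1 ∧ oddCot 4 1 ≤ 0.41423) := by
  have e : cscSum 4 = 2 * (cscPi (1 / 4)) + 1 := by
    rw [cscSum_eq]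
    simp only [Finset.sum_range_succ, Finset.sum_range_zero]
    norm_num only
    rw [show (3 / 4 : ℝ) = 1 - 1 / 4 by norm_num]
    simp only [cscPi_one_sub, cscPi_zero, cscPi_half]
    ring
  have c1 := cscPi_bounds (r := 1 / 4) (c := 1.41421) (d := 1.41422) (by norm_num) (by norm_num) rfl rfl
    (by norm_num) (by norm_num) (by norm_num) (by norm_num)
  have k0 := cot_pi_mul_bounds (r := (2 * 0 + 1) / (2 * 4)) (c := 2.41421) (d := 2.41422) (by norm_num)
    (by norm_num) rfl rfl (by norm_num) (by norm_num) (by norm_num) (by norm_num)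
  have k1 := cot_pi_mul_bounds (r := (2 * 1 + 1) / (2 * 4)) (c := 0.41411) (d := 0.41423) (by norm_num)
    (by norm_num) rfl rfl (by norm_num) (by norm_num) (by norm_num) (by norm_num)
  refine ⟨?_, by rw [oddCot_eq]; exact_mod_cast k0, by rw [oddCot_eq]; exact_mod_cast k1⟩
  rw [e]
  constructor <;> linarith [c1.1, c1.2]

theorem trig_bounds_five :
    (5.50552 ≤ cscSum 5 ∧ cscSum 5 ≤ 5.50560) ∧
    (3.07768 ≤ oddCot 5 0 ∧ oddCot 5 0 ≤ 3.07769) ∧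
    (0.72652 ≤ oddCot 5 1 ∧ oddCot 5 1 ≤ 0.72655) := by
  have e : cscSum 5 = 2 * (cscPi (1 / 5) + cscPi (2 / 5)) := by
    rw [cscSum_eq]
    simp only [Finset.sum_range_succ, Finset.sum_range_zero]
    norm_num only
    rw [show (4 / 5 : ℝ) = 1 - 1 / 5 by norm_num, show (3 / 5 : ℝ) = 1 - 2 / 5 by norm_num]
    simp only [cscPi_one_sub, cscPi_zero]
    ring
  have c1 := cscPi_bounds (r := 1 / 5) (c := 1.70130) (d := 1.70131) (by norm_num) (by norm_num) rfl rfl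
    (by norm_num) (by norm_num) (by norm_num) (by norm_num)
  have c2 := cscPi_bounds (r := 2 / 5) (c := 1.05146) (d := 1.05149) (by norm_num) (by norm_num) rfl rfl
    (by norm_num) (by norm_num) (by norm_num) (by norm_num)
  have k0 := cot_pi_mul_bounds (r := (2 * 0 + 1) / (2 * 5)) (c := 3.07768) (d := 3.07769) (by norm_num)
    (by norm_num) rfl rfl (by norm_num) (by norm_num) (by norm_num) (by norm_num)
  have k1 := cot_pi_mul_bounds (r := (2 * 1 + 1) / (2 * 5)) (c := 0.72652) (d := 0.72655) (by norm_num)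
    (by norm_num) rfl rfl (by norm_num) (by norm_num) (by norm_num) (by norm_num)
  refine ⟨?_, by rw [oddCot_eq]; exact_mod_cast k0, by rw [oddCot_eq]; exact_mod_cast k1⟩
  rw [e]
  constructor <;> linarith [c1.1, c1.2, c2.1, c2.2]

theorem trig_bounds_six :
    (7.30938 ≤ cscSum 6 ∧ cscSum 6 ≤ 7.30944) ∧
    (3.73205 ≤ oddCot 6 0 ∧ oddCot 6 0 ≤ 3.73206) ∧
    (0.99999 ≤ oddCot 6 1 ∧ oddCot 6 1 ≤ 1.00001) ∧
    (0.26773 ≤ oddCot 6 2 ∧ oddCot 6 2 ≤ 0.26797) := by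
  have e : cscSum 6 = 2 * (cscPi (1 / 6) + cscPi (1 / 3)) + 1 := by
    rw [cscSum_eq]
    simp only [Finset.sum_range_succ, Finset.sum_range_zero]
    norm_num only
    rw [show (5 / 6 : ℝ) = 1 - 1 / 6 by norm_num, show (2 / 3 : ℝ) = 1 - 1 / 3 by norm_num]
    simp only [cscPi_one_sub, cscPi_zero, cscPi_half]
    ring
  have c1 := cscPi_bounds (r := 1 / 6) (c := 1.99999) (d := 2.00001) (by norm_num) (by norm_num) rfl rfl
    (by norm_num) (by norm_num) (by norm_num) (by norm_num)
  have c2 := cscPi_bounds (r := 1 / 3) (c := 1.15470) (d := 1.15471) (by norm_num) (by norm_num) rfl rfl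
    (by norm_num) (by norm_num) (by norm_num) (by norm_num)
  have k0 := cot_pi_mul_bounds (r := (2 * 0 + 1) / (2 * 6)) (c := 3.73205) (d := 3.73206) (by norm_num)
    (by norm_num) rfl rfl (by norm_num) (by norm_num) (by norm_num) (by norm_num)
  have k1 := cot_pi_mul_bounds (r := (2 * 1 + 1) / (2 * 6)) (c := 0.99999) (d := 1.00001) (by norm_num)
    (by norm_num) rfl rfl (by norm_num) (by norm_num) (by norm_num) (by norm_num)
  have k2 := cot_pi_mul_bounds (r := (2 * 2 + 1) / (2 * 6)) (c := 0.26773) (d := 0.26797) (by norm_num)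
    (by norm_num) rfl rfl (by norm_num) (by norm_num) (by norm_num) (by norm_num)
  refine ⟨?_, by rw [oddCot_eq]; exact_mod_cast k0, by rw [oddCot_eq]; exact_mod_cast k1, by rw [oddCot_eq]; exact_mod_cast k2⟩
  rw [e]
  constructor <;> linarith [c1.1, c1.2, c2.1, c2.2]

theorem trig_bounds_seven :
    (9.21902 ≤ cscSum 7 ∧ cscSum 7 ≤ 9.21916) ∧
    (4.38128 ≤ oddCot 7 0 ∧ oddCot 7 0 ≤ 4.38129) ∧
    (1.25395 ≤ oddCot 7 1 ∧ oddCot 7 1 ≤ 1.25397) ∧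
    (0.48150 ≤ oddCot 7 2 ∧ oddCot 7 2 ≤ 0.48158) := by
  have e : cscSum 7 = 2 * (cscPi (1 / 7) + cscPi (2 / 7) + cscPi (3 / 7)) := by
    rw [cscSum_eq]
    simp only [Finset.sum_range_succ, Finset.sum_range_zero]
    norm_num only
    rw [show (6 / 7 : ℝ) = 1 - 1 / 7 by norm_num, show (5 / 7 : ℝ) = 1 - 2 / 7 by norm_num, show (4 / 7 : ℝ) = 1 - 3 / 7 by norm_num]
    simp only [cscPi_one_sub, cscPi_zero]
    ring
  have c1 := cscPi_bounds (r := 1 / 7) (c := 2.30476) (d := 2.30477) (by norm_num) (by norm_num) rfl rfl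
    (by norm_num) (by norm_num) (by norm_num) (by norm_num)
  have c2 := cscPi_bounds (r := 2 / 7) (c := 1.27904) (d := 1.27905) (by norm_num) (by norm_num) rfl rfl
    (by norm_num) (by norm_num) (by norm_num) (by norm_num)
  have c3 := cscPi_bounds (r := 3 / 7) (c := 1.02571) (d := 1.02576) (by norm_num) (by norm_num) rfl rfl
    (by norm_num) (by norm_num) (by norm_num) (by norm_num)
  have k0 := cot_pi_mul_bounds (r := (2 * 0 + 1) / (2 * 7)) (c := 4.38128) (d := 4.38129) (by norm_num)
    (by norm_num) rfl rfl (by norm_num) (by norm_num) (by norm_num) (by norm_num)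
  have k1 := cot_pi_mul_bounds (r := (2 * 1 + 1) / (2 * 7)) (c := 1.25395) (d := 1.25397) (by norm_num)
    (by norm_num) rfl rfl (by norm_num) (by norm_num) (by norm_num) (by norm_num)
  have k2 := cot_pi_mul_bounds (r := (2 * 2 + 1) / (2 * 7)) (c := 0.48150) (d := 0.48158) (by norm_num)
    (by norm_num) rfl rfl (by norm_num) (by norm_num) (by norm_num) (by norm_num)
  refine ⟨?_, by rw [oddCot_eq]; exact_mod_cast k0, by rw [oddCot_eq]; exact_mod_cast k1, by rw [oddCot_eq]; exact_mod_cast k2⟩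
  rw [e]
  constructor <;> linarith [c1.1, c1.2, c2.1, c2.2, c3.1, c3.2]

theorem trig_bounds_eight :
    (11.21944 ≤ cscSum 8 ∧ cscSum 8 ≤ 11.21952) ∧
    (5.02733 ≤ oddCot 8 0 ∧ oddCot 8 0 ≤ 5.02735) ∧
    (1.49660 ≤ oddCot 8 1 ∧ oddCot 8 1 ≤ 1.49661) ∧
    (0.66815 ≤ oddCot 8 2 ∧ oddCot 8 2 ≤ 0.66819) := by
  have e : cscSum 8 = 2 * (cscPi (1 / 8) + cscPi (1 / 4) + cscPi (3 / 8)) + 1 := by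
    rw [cscSum_eq]
    simp only [Finset.sum_range_succ, Finset.sum_range_zero]
    norm_num only
    rw [show (7 / 8 : ℝ) = 1 - 1 / 8 by norm_num, show (3 / 4 : ℝ) = 1 - 1 / 4 by norm_num, show (5 / 8 : ℝ) = 1 - 3 / 8 by norm_num]
    simp only [cscPi_one_sub, cscPi_zero, cscPi_half]
    ring
  have c1 := cscPi_bounds (r := 1 / 8) (c := 2.61312) (d := 2.61313) (by norm_num) (by norm_num) rfl rfl
    (by norm_num) (by norm_num) (by norm_num) (by norm_num)
  have c2 := cscPi_bounds (r := 1 / 4) (c := 1.41421) (d := 1.41422) (by norm_num) (by norm_num) rfl rfl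
    (by norm_num) (by norm_num) (by norm_num) (by norm_num)
  have c3 := cscPi_bounds (r := 3 / 8) (c := 1.08239) (d := 1.08241) (by norm_num) (by norm_num) rfl rfl
    (by norm_num) (by norm_num) (by norm_num) (by norm_num)
  have k0 := cot_pi_mul_bounds (r := (2 * 0 + 1) / (2 * 8)) (c := 5.02733) (d := 5.02735) (by norm_num)
    (by norm_num) rfl rfl (by norm_num) (by norm_num) (by norm_num) (by norm_num)
  have k1 := cot_pi_mul_bounds (r := (2 * 1 + 1) / (2 * 8)) (c := 1.49660) (d := 1.49661) (by norm_num)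
    (by norm_num) rfl rfl (by norm_num) (by norm_num) (by norm_num) (by norm_num)
  have k2 := cot_pi_mul_bounds (r := (2 * 2 + 1) / (2 * 8)) (c := 0.66815) (d := 0.66819) (by norm_num)
    (by norm_num) rfl rfl (by norm_num) (by norm_num) (by norm_num) (by norm_num)
  refine ⟨?_, by rw [oddCot_eq]; exact_mod_cast k0, by rw [oddCot_eq]; exact_mod_cast k1, by rw [oddCot_eq]; exact_mod_cast k2⟩
  rw [e]
  constructor <;> linarith [c1.1, c1.2, c2.1, c2.2, c3.1, c3.2]

theorem trig_bounds_nine :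
    (13.29928 ≤ cscSum 9 ∧ cscSum 9 ≤ 13.29948) ∧
    (5.67128 ≤ oddCot 9 0 ∧ oddCot 9 0 ≤ 5.67129) ∧
    (1.73205 ≤ oddCot 9 1 ∧ oddCot 9 1 ≤ 1.73206) ∧
    (0.83908 ≤ oddCot 9 2 ∧ oddCot 9 2 ≤ 0.83911) := by
  have e : cscSum 9 = 2 * (cscPi (1 / 9) + cscPi (2 / 9) + cscPi (1 / 3) + cscPi (4 / 9)) := by
    rw [cscSum_eq]
    simp only [Finset.sum_range_succ, Finset.sum_range_zero]
    norm_num only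
    rw [show (8 / 9 : ℝ) = 1 - 1 / 9 by norm_num, show (7 / 9 : ℝ) = 1 - 2 / 9 by norm_num, show (2 / 3 : ℝ) = 1 - 1 / 3 by norm_num, show (5 / 9 : ℝ) = 1 - 4 / 9 by norm_num]
    simp only [cscPi_one_sub, cscPi_zero]
    ring
  have c1 := cscPi_bounds (r := 1 / 9) (c := 2.92380) (d := 2.92381) (by norm_num) (by norm_num) rfl rfl
    (by norm_num) (by norm_num) (by norm_num) (by norm_num)
  have c2 := cscPi_bounds (r := 2 / 9) (c := 1.55572) (d := 1.55573) (by norm_num) (by norm_num) rfl rfl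
    (by norm_num) (by norm_num) (by norm_num) (by norm_num)
  have c3 := cscPi_bounds (r := 1 / 3) (c := 1.15470) (d := 1.15471) (by norm_num) (by norm_num) rfl rfl
    (by norm_num) (by norm_num) (by norm_num) (by norm_num)
  have c4 := cscPi_bounds (r := 4 / 9) (c := 1.01542) (d := 1.01549) (by norm_num) (by norm_num) rfl rfl
    (by norm_num) (by norm_num) (by norm_num) (by norm_num)
  have k0 := cot_pi_mul_bounds (r := (2 * 0 + 1) / (2 * 9)) (c := 5.67128) (d := 5.67129) (by norm_num)
    (by norm_num) rfl rfl (by norm_num) (by norm_num) (by norm_num) (by norm_num)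
  have k1 := cot_pi_mul_bounds (r := (2 * 1 + 1) / (2 * 9)) (c := 1.73205) (d := 1.73206) (by norm_num)
    (by norm_num) rfl rfl (by norm_num) (by norm_num) (by norm_num) (by norm_num)
  have k2 := cot_pi_mul_bounds (r := (2 * 2 + 1) / (2 * 9)) (c := 0.83908) (d := 0.83911) (by norm_num)
    (by norm_num) rfl rfl (by norm_num) (by norm_num) (by norm_num) (by norm_num)
  refine ⟨?_, by rw [oddCot_eq]; exact_mod_cast k0, by rw [oddCot_eq]; exact_mod_cast k1, by rw [oddCot_eq]; exact_mod_cast k2⟩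
  rw [e]
  constructor <;> linarith [c1.1, c1.2, c2.1, c2.2, c3.1, c3.2, c4.1, c4.2]

theorem trig_bounds_ten :
    (15.44976 ≤ cscSum 10 ∧ cscSum 10 ≤ 15.44990) ∧
    (6.31375 ≤ oddCot 10 0 ∧ oddCot 10 0 ≤ 6.31376) ∧
    (1.96261 ≤ oddCot 10 1 ∧ oddCot 10 1 ≤ 1.96262) := by
  have e : cscSum 10 = 2 * (cscPi (1 / 10) + cscPi (1 / 5) + cscPi (3 / 10) + cscPi (2 / 5)) + 1 := by
    rw [cscSum_eq]
    simp only [Finset.sum_range_succ, Finset.sum_range_zero]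
    norm_num only
    rw [show (9 / 10 : ℝ) = 1 - 1 / 10 by norm_num, show (4 / 5 : ℝ) = 1 - 1 / 5 by norm_num, show (7 / 10 : ℝ) = 1 - 3 / 10 by norm_num, show (3 / 5 : ℝ) = 1 - 2 / 5 by norm_num]
    simp only [cscPi_one_sub, cscPi_zero, cscPi_half]
    ring
  have c1 := cscPi_bounds (r := 1 / 10) (c := 3.23606) (d := 3.23607) (by norm_num) (by norm_num) rfl rfl
    (by norm_num) (by norm_num) (by norm_num) (by norm_num)
  have c2 := cscPi_bounds (r := 1 / 5) (c := 1.70130) (d := 1.70131) (by norm_num) (by norm_num) rfl rfl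
    (by norm_num) (by norm_num) (by norm_num) (by norm_num)
  have c3 := cscPi_bounds (r := 3 / 10) (c := 1.23606) (d := 1.23608) (by norm_num) (by norm_num) rfl rfl
    (by norm_num) (by norm_num) (by norm_num) (by norm_num)
  have c4 := cscPi_bounds (r := 2 / 5) (c := 1.05146) (d := 1.05149) (by norm_num) (by norm_num) rfl rfl
    (by norm_num) (by norm_num) (by norm_num) (by norm_num)
  have k0 := cot_pi_mul_bounds (r := (2 * 0 + 1) / (2 * 10)) (c := 6.31375) (d := 6.31376) (by norm_num)
    (by norm_num) rfl rfl (by norm_num) (by norm_num) (by norm_num) (by norm_num)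
  have k1 := cot_pi_mul_bounds (r := (2 * 1 + 1) / (2 * 10)) (c := 1.96261) (d := 1.96262) (by norm_num)
    (by norm_num) rfl rfl (by norm_num) (by norm_num) (by norm_num) (by norm_num)
  refine ⟨?_, by rw [oddCot_eq]; exact_mod_cast k0, by rw [oddCot_eq]; exact_mod_cast k1⟩
  rw [e]
  constructor <;> linarith [c1.1, c1.2, c2.1, c2.2, c3.1, c3.2, c4.1, c4.2]

/-! ### Lower and upper estimates for general n -/

theorem inv_add_div_six_le_inv_sin {x : ℝ} (h0 : 0 < x) (h1 : x < Real.pi) :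
    1 / x + x / 6 ≤ (Real.sin x)⁻¹ := by
  have hs := Real.sin_pos_of_pos_of_lt_pi h0 h1
  have h2 := sin_le_taylor_five h0.le
  have h3 : x < 3.15 := h1.trans Real.pi_lt_d2
  rw [← one_div, le_div_iff₀ hs]
  refine (mul_le_mul_of_nonneg_left h2 (by positivity)).trans ?_
  -- The coefficient 1/6 is the next Laurent coefficient of the cosecant, so the x² terms cancel;
  -- the error is negative while x² < 14, which covers (0, π).
  have e : (1 / x + x / 6) * (x - x ^ 3 / 6 + x ^ 5 / 120) = 1 + x ^ 4 * (x ^ 2 - 14) / 720 := by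
    field_simp
    ring
  rw [e]
  have h4 : x ^ 2 ≤ 14 := by nlinarith
  have h5 : 0 ≤ x ^ 4 := by positivity
  nlinarith

theorem cscPi_nonneg {r : ℝ} (h0 : 0 ≤ r) (h1 : r ≤ 1) : 0 ≤ cscPi r :=
  inv_nonneg.2 (Real.sin_nonneg_of_nonneg_of_le_pi (mul_nonneg Real.pi_pos.le h0)
    (by nlinarith [Real.pi_pos]))

theorem two_mul_sum_le_cscSum {n J : ℕ} (hJ : 2 * J < n) :
    2 * ∑ j ∈ Finset.Ico 1 (J + 1), cscPi (j / n) ≤ cscSum n := by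
  have hn0 : (0 : ℝ) < n := by exact_mod_cast (by omega : 0 < n)
  have h1 := Finset.sum_Ico_reflect (fun j : ℕ => cscPi ((j : ℝ) / n)) 1 (m := J + 1) (n := n)
    (by omega)
  have h2 : ∑ j ∈ Finset.Ico 1 (J + 1), cscPi (((n - j : ℕ) : ℝ) / n) =
      ∑ j ∈ Finset.Ico 1 (J + 1), cscPi (j / n) := by
    refine Finset.sum_congr rfl fun j hj => ?_
    have := Finset.mem_Ico.1 hj
    rw [Nat.cast_sub (by omega), sub_div, div_self hn0.ne', cscPi_one_sub]
  rw [h2] at h1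
  rw [two_mul]
  nth_rewrite 2 [h1]
  rw [cscSum_eq, ← Finset.sum_union]
  · refine Finset.sum_le_sum_of_subset_of_nonneg ?_ fun j hj _ => ?_
    · intro j hj
      simp only [Finset.mem_union, Finset.mem_Ico, Finset.mem_range] at hj ⊢
      omega
    · have hj' : (j : ℝ) ≤ n := by exact_mod_cast (Finset.mem_range.1 hj).le
      exact cscPi_nonneg (by positivity) (by rw [div_le_one hn0]; exact hj')
  · rw [Finset.disjoint_left]
    intro j hj hj'
    simp only [Finset.mem_Ico] at hj hj'
    omega

/-- Keep the J terms nearest each end and bound each cosecant by 1/x + x/6. With u = n/π and v = π/n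
this gives 2u times the harmonic number H_J + v²J(J+1)/12. -/
theorem cscSum_lower {n J : ℕ} (hJ : 2 * J < n) :
    2 * ∑ j ∈ Finset.Ico 1 (J + 1), (n / Real.pi * (j : ℝ)⁻¹ + (n / Real.pi)⁻¹ / 6 * j) ≤
      cscSum n := by
  have hn0 : (0 : ℝ) < n := by exact_mod_cast (by omega : 0 < n)
  have hpi := Real.pi_pos
  refine le_trans (mul_le_mul_of_nonneg_left (Finset.sum_le_sum fun j hj => ?_) two_pos.le)
    (two_mul_sum_le_cscSum hJ)
  have := Finset.mem_Ico.1 hj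
  have hj0 : (0 : ℝ) < j := by exact_mod_cast this.1
  have hjn : (j : ℝ) < n := by exact_mod_cast (by omega : j < n)
  have h := inv_add_div_six_le_inv_sin (x := Real.pi * (j / n)) (by positivity)
    (by rw [mul_div_assoc', div_lt_iff₀ hn0]; exact mul_lt_mul_of_pos_left hjn hpi)
  refine le_of_eq_of_le ?_ h
  field_simp

theorem oddCot_zero_le {n : ℕ} (hn : 2 ≤ n) : oddCot n 0 ≤ 2 * (n / Real.pi) := by
  have hn0 : (2 : ℝ) ≤ n := by exact_mod_cast hn
  have hpi := Real.pi_pos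
  set y := (2 * ((0 : ℕ) : ℝ) + 1) * Real.pi / (2 * n) with hy
  have hy' : y = Real.pi / (2 * n) := by rw [hy]; push_cast; ring
  have hy0 : 0 < y := by rw [hy']; positivity
  have hy1 : y < Real.pi / 2 := by
    rw [hy', div_lt_div_iff₀ (by positivity) two_pos]
    nlinarith
  have hc := Real.cos_pos_of_mem_Ioo ⟨by linarith, hy1⟩
  have ht := Real.lt_tan hy0 hy1
  rw [Real.tan_eq_sin_div_cos, lt_div_iff₀ hc] at ht
  have e : 2 * (n / Real.pi) = 1 / y := by rw [hy']; field_simp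
  rw [oddCot, ← hy, Real.cot_eq_cos_div_sin, e, div_le_div_iff₀
    (Real.sin_pos_of_pos_of_lt_pi hy0 (by linarith)) hy0]
  linarith

theorem oddCot_one_lower {n : ℕ} (hn : 4 ≤ n) :
    2 * (n / Real.pi) * (1 / 3 - 3 / 8 * ((n / Real.pi)⁻¹) ^ 2) ≤ oddCot n 1 := by
  have hn0 : (4 : ℝ) ≤ n := by exact_mod_cast hn
  have hpi := Real.pi_pos
  set x := (2 * ((1 : ℕ) : ℝ) + 1) * Real.pi / (2 * n) with hx
  have hx' : x = 3 * Real.pi / (2 * n) := by rw [hx]; push_cast; ring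
  have hx0 : 0 < x := by rw [hx']; positivity
  have hx1 : x < Real.pi / 2 := by
    rw [hx', div_lt_div_iff₀ (by positivity) two_pos]
    nlinarith
  have hs := Real.sin_pos_of_pos_of_lt_pi hx0 (by linarith)
  have hc0 := Real.cos_pos_of_mem_Ioo ⟨by linarith, hx1⟩
  have hc : 1 - x ^ 2 / 2 ≤ Real.cos x := Real.one_sub_sq_div_two_le_cos
  have e : 2 * (n / Real.pi) * (1 / 3 - 3 / 8 * ((n / Real.pi)⁻¹) ^ 2) = (1 - x ^ 2 / 2) / x := by
    rw [hx']
    field_simp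
    ring
  rw [oddCot, Real.cot_eq_cos_div_sin, e]
  calc (1 - x ^ 2 / 2) / x ≤ Real.cos x / x := by gcongr
    _ ≤ Real.cos x / Real.sin x := by
      gcongr
      exact Real.sin_le hx0.le

/-! ### Signs deciding the modes 1, 2 and 3 -/

theorem secondModeSign_pos_of_le {n : ℕ} {K σ τ : ℝ} (hK : 0 < K) (hS : K * σ ≤ cscSum n)
    (hk : oddCot n 0 ≤ K) (hT : K * τ ≤ oddCot n 1) (hσ : 2 ≤ σ)
    (hτ : 0 ≤ τ) (h : 0 < 3 / 4 * σ ^ 2 - 45 / 16 * σ + 9 / 4 + 3 / 16 * σ * τ) :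
    0 < secondModeSign n := by
  rw [secondModeSign]
  generalize cscSum n = S at *
  generalize oddCot n 0 = k at *
  generalize oddCot n 1 = t at *
  have hσK : 2 * K ≤ K * σ := by nlinarith
  -- The three inequalities replace k by K, then t by Kτ, then S by Kσ. On S ≥ 2K, k ≤ K the form
  -- decreases in k and, once k = K, increases in S; by homogeneity K² factors out at the end.
  have h1 : 0 ≤ (K - k) * (45 / 16 * S - 9 / 4 * (K + k)) :=
    mul_nonneg (by linarith) (by linarith)
  have h2 : 0 ≤ S * (t - K * τ) := mul_nonneg (by linarith) (by linarith)
  have h3 : 0 ≤ (S - K * σ) * (3 / 4 * (S + K * σ) - 45 / 16 * K + 3 / 16 * (K * τ)) :=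
    mul_nonneg (by linarith) (by nlinarith [mul_nonneg hK.le hτ])
  have h4 : 0 < K ^ 2 * (3 / 4 * σ ^ 2 - 45 / 16 * σ + 9 / 4 + 3 / 16 * σ * τ) := by positivity
  nlinarith

theorem secondModeSign_pos {n : ℕ} (hn : 10 ≤ n) : 0 < secondModeSign n := by
  rcases hn.eq_or_lt with rfl | hn
  · obtain ⟨⟨a1, a2⟩, ⟨b1, b2⟩, c1, -⟩ := trig_bounds_ten
    rw [secondModeSign]
    nlinarith [mul_nonneg (sub_nonneg.2 a1) (sub_nonneg.2 b2)]
  have hn0 : (11 : ℝ) ≤ n := by exact_mod_cast hn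
  have hpi := Real.pi_pos
  have hpi2 := Real.pi_lt_d2
  have hpi3 := Real.pi_gt_d2
  have hu : 0 < (n : ℝ) / Real.pi := by positivity
  have hu1 : (n : ℝ) / Real.pi ≥ 3 := by
    rw [ge_iff_le, le_div_iff₀ hpi]
    nlinarith
  have hk := oddCot_zero_le (n := n) (by omega)
  have hT := oddCot_one_lower (n := n) (by omega)
  have hw : (n / Real.pi)⁻¹ ≤ 1 / 3 := by
    rw [inv_le_comm₀ hu (by norm_num)]
    norm_num
    exact hu1
  set v := (n / Real.pi)⁻¹ with hv
  have hv0 : 0 < v := inv_pos.2 hu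
  have huv : (n / Real.pi) * v = 1 := mul_inv_cancel₀ hu.ne'
  have hτ : 0 ≤ 1 / 3 - 3 / 8 * v ^ 2 := by nlinarith
  -- The condition 2J < n allows J = 5 from 11 and J = 6 from 13. H₆ = 49/20 is just large enough
  -- without its correction in v²; H₅ = 137/60 is not, so for n = 11, 12 the correction is used,
  -- with v = π/n bounded below.
  rcases (by omega : n ≤ 12 ∨ 13 ≤ n) with h12 | h13
  · have hS := cscSum_lower (n := n) (J := 5) (by omega)
    rw [← hv] at hS
    have hn12 : (n : ℝ) ≤ 12 := by exact_mod_cast h12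
    have hv1 : 0.2616 ≤ v := by
      rw [hv, inv_div, le_div_iff₀ (by linarith)]
      nlinarith
    refine secondModeSign_pos_of_le (K := 2 * (n / Real.pi)) (σ := 137 / 60 + 5 / 2 * v ^ 2)
      (by positivity) ?_ hk hT (by nlinarith) hτ ?_
    · refine le_of_eq_of_le ?_ hS
      simp only [Finset.sum_Ico_eq_sum_range, Nat.add_sub_cancel, Finset.sum_range_succ,
        Finset.sum_range_zero]
      push_cast
      linear_combination 5 * v * huv
    · have hv2 : 0.0684 ≤ v ^ 2 := by nlinarith
      nlinarith
  · have hS := cscSum_lower (n := n) (J := 6) (by omega)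
    rw [← hv] at hS
    refine secondModeSign_pos_of_le (K := 2 * (n / Real.pi)) (σ := 49 / 20 + 7 / 2 * v ^ 2)
      (by positivity) ?_ hk hT (by nlinarith) hτ ?_
    · refine le_of_eq_of_le ?_ hS
      simp only [Finset.sum_Ico_eq_sum_range, Nat.add_sub_cancel, Finset.sum_range_succ,
        Finset.sum_range_zero]
      push_cast
      linear_combination 7 * v * huv
    · nlinarith [sq_nonneg v, sq_nonneg (v ^ 2)]

theorem secondModeSign_neg_of_le {n : ℕ} {S₁ S₂ k₁ k₂ t : ℝ} (hS0 : 0 ≤ S₁) (hk0 : 0 ≤ k₁)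
    (hS : S₁ ≤ cscSum n ∧ cscSum n ≤ S₂) (hk : k₁ ≤ oddCot n 0 ∧ oddCot n 0 ≤ k₂)
    (ht : oddCot n 1 ≤ t) (ht0 : 0 ≤ t)
    (h : 3 / 4 * S₂ ^ 2 - 45 / 16 * S₁ * k₁ + 9 / 4 * k₂ ^ 2 + 3 / 16 * S₂ * t < 0) :
    secondModeSign n < 0 := by
  rw [secondModeSign]
  have hSn : 0 ≤ cscSum n := hS0.trans hS.1
  have hkn : 0 ≤ oddCot n 0 := hk0.trans hk.1
  have h1 : cscSum n ^ 2 ≤ S₂ ^ 2 := pow_le_pow_left₀ hSn hS.2 2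
  have h2 : S₁ * k₁ ≤ cscSum n * oddCot n 0 := mul_le_mul hS.1 hk.1 hk0 hSn
  have h3 : oddCot n 0 ^ 2 ≤ k₂ ^ 2 := pow_le_pow_left₀ hkn hk.2 2
  have h4 : cscSum n * oddCot n 1 ≤ S₂ * t :=
    (mul_le_mul_of_nonneg_left ht hSn).trans (mul_le_mul_of_nonneg_right hS.2 ht0)
  linarith

theorem secondModeSign_neg {n : ℕ} (hn : 4 ≤ n) (hn' : n ≤ 9) : secondModeSign n < 0 := by
  interval_cases n
  · obtain ⟨a, b, c⟩ := trig_bounds_four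
    exact secondModeSign_neg_of_le (by norm_num) (by norm_num) a b c.2 (by norm_num) (by norm_num)
  · obtain ⟨a, b, c⟩ := trig_bounds_five
    exact secondModeSign_neg_of_le (by norm_num) (by norm_num) a b c.2 (by norm_num) (by norm_num)
  · obtain ⟨a, b, c, -⟩ := trig_bounds_six
    exact secondModeSign_neg_of_le (by norm_num) (by norm_num) a b c.2 (by norm_num) (by norm_num)
  · obtain ⟨a, b, c, -⟩ := trig_bounds_seven
    exact secondModeSign_neg_of_le (by norm_num) (by norm_num) a b c.2 (by norm_num) (by norm_num)
  · obtain ⟨a, b, c, -⟩ := trig_bounds_eight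
    exact secondModeSign_neg_of_le (by norm_num) (by norm_num) a b c.2 (by norm_num) (by norm_num)
  · obtain ⟨a, b, c, -⟩ := trig_bounds_nine
    exact secondModeSign_neg_of_le (by norm_num) (by norm_num) a b c.2 (by norm_num) (by norm_num)

theorem firstMode_neg {n : ℕ} (hn : 3 ≤ n) (hn' : n ≤ 6) :
    cscSum n - oddCot n 0 / 2 - n < 0 := by
  interval_cases n
  · obtain ⟨a, b⟩ := trig_bounds_three
    norm_num
    linarith
  · obtain ⟨a, b, -⟩ := trig_bounds_four
    norm_num
    linarith
  · obtain ⟨a, b, -⟩ := trig_bounds_five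
    norm_num
    linarith
  · obtain ⟨a, b, -⟩ := trig_bounds_six
    norm_num
    linarith

theorem firstMode_pos {n : ℕ} (hn : 7 ≤ n) : 0 < cscSum n - oddCot n 0 / 2 - n := by
  rcases (by omega : n = 7 ∨ n = 8 ∨ 9 ≤ n) with rfl | rfl | hn
  · obtain ⟨a, b, -⟩ := trig_bounds_seven
    norm_num
    linarith
  · obtain ⟨a, b, -⟩ := trig_bounds_eight
    norm_num
    linarith
  · have hn0 : (9 : ℝ) ≤ n := by exact_mod_cast hn
    -- With u = n/π, H₄ = 25/12 gives S - k/2 > (25/6 - 1)u = (19/6)u, and 19/6 > 3.15 > π while n =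
    -- πu.
    have hS := cscSum_lower (n := n) (J := 4) (by omega)
    have hk := oddCot_zero_le (n := n) (by omega)
    have hpi := Real.pi_pos
    have hu : 0 < (n : ℝ) / Real.pi := by positivity
    have hv : 0 < ((n : ℝ) / Real.pi)⁻¹ := inv_pos.2 hu
    have hn1 : (n : ℝ) = n / Real.pi * Real.pi := by field_simp
    have h3 : (n : ℝ) / Real.pi * Real.pi < n / Real.pi * 3.15 :=
      mul_lt_mul_of_pos_left Real.pi_lt_d2 hu
    simp only [Finset.sum_Ico_eq_sum_range, Nat.add_sub_cancel, Finset.sum_range_succ,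
      Finset.sum_range_zero] at hS
    push_cast at hS
    rw [← hn1] at h3
    linarith

theorem thirdMode_pos {n : ℕ} (hn : 6 ≤ n) (hn' : n ≤ 9) :
    0 < 3 * cscSum n - 11 / 2 * oddCot n 0 - 3 / 2 * oddCot n 1 + oddCot n 2 / 2 := by
  interval_cases n
  · obtain ⟨a, b, c, d⟩ := trig_bounds_six
    linarith
  · obtain ⟨a, b, c, d⟩ := trig_bounds_seven
    linarith
  · obtain ⟨a, b, c, d⟩ := trig_bounds_eight
    linarith
  · obtain ⟨a, b, c, d⟩ := trig_bounds_nine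
    linarith

theorem gonF_one_pos (hn : 10 ≤ n) : 0 < gonF n 1 := by
  obtain ⟨c, hc, h⟩ := gonF_one_mul (n := n) (by omega)
  have := secondModeSign_pos hn
  rw [← h] at this
  exact pos_of_mul_pos_left this hc.le

theorem gonF_one_neg (hn : 4 ≤ n) (hn' : n ≤ 9) : gonF n 1 < 0 := by
  obtain ⟨c, hc, h⟩ := gonF_one_mul (n := n) hn
  have := secondModeSign_neg hn hn'
  rw [← h] at this
  exact neg_of_mul_neg_left this hc.le

/-- For n ≥ 10 the positive root of mode 2 lies below that of mode 3; for smaller n mode 2 is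
negative and mode 3 needs its own numerical bound. -/
theorem gonF_two_pos (hn : 6 ≤ n) : 0 < gonF n 2 := by
  rcases (by omega : n ≤ 9 ∨ 10 ≤ n) with h | h
  · exact (thirdMode_pos hn h).trans_le (gonF_two_lower hn)
  · exact (gonF_one_pos h).trans (gonF_strictMono (by omega) (by omega))

theorem gonF_pos {l : ℕ} (hl : 2 ≤ l) (hl' : 2 * (l + 1) ≤ n) : 0 < gonF n l := by
  have h := gonF_two_pos (n := n) (by omega)
  rcases hl.eq_or_lt with rfl | hl
  · exact h
  · exact h.trans (gonF_strictMono hl hl')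

/-! ### The degeneracy values -/

theorem det_blockA_eq_zero_iff' (hn : 3 ≤ n) {l : ℕ} (hl : 2 ≤ l) (hl' : l ≤ n / 2) :
    (blockA n m l).det = 0 ↔ m = gonF n (l - 1) / 6 := by
  obtain ⟨k, rfl⟩ := Nat.exists_eq_add_of_le' hl
  exact det_blockA_eq_zero_iff hn (l := k + 1) (by omega) (by omega)

/-- The mass for which the block of the mode `l` is singular. -/
noncomputable def modeMass (n : ℕ) [NeZero n] (l : ℕ) : ℝ :=
  if l = 1 then (cscSum n * 3 / 4 - oddCot n 0 / 2) * (n / 2 + cscSum n / 4) /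
    (3 / 2 * (n + oddCot n 0 / 2 - cscSum n))
  else gonF n (l - 1) / 6

theorem det_blockA1_eq_zero_iff_modeMass (hn : 3 ≤ n) (hn' : n ≤ 6) (hm : 0 < m) :
    (blockA1 n m).det = 0 ↔ m = modeMass n 1 := by
  have h := firstMode_neg hn hn'
  have h' : 0 < 3 / 2 * (n + oddCot n 0 / 2 - cscSum n) := by linarith
  rw [det_blockA1_eq_zero_iff hn hm, modeMass, if_pos rfl, eq_div_iff h'.ne']
  constructor <;> intro h <;> linarith

theorem modeMass_one_pos (hn : 3 ≤ n) (hn' : n ≤ 6) : 0 < modeMass n 1 := by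
  have h := firstMode_neg hn hn'
  rw [modeMass, if_pos rfl]
  exact div_pos (firstMode_const_pos hn) (by linarith)

theorem det_blockA1_ne_zero (hn : 7 ≤ n) (hm : 0 < m) : (blockA1 n m).det ≠ 0 := by
  rw [Ne, det_blockA1_eq_zero_iff (by omega) hm]
  have h1 := firstMode_const_pos (n := n) (by omega)
  have h2 := mul_pos hm (firstMode_pos hn)
  intro h
  linarith

theorem mem_degenerateModes (hn : 3 ≤ n) {l : ℕ} : l ∈ degenerateModes n ↔
    (1 ≤ l ∧ l ≤ n / 2) ∧ (l = 1 → n ≤ 6) ∧ 0 < modeMass n l := by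
  rw [degenerateModes, Set.mem_ofPred_eq, ← and_assoc, and_congr_right_iff]
  rintro ⟨h1, h2⟩
  by_cases hl : l = 1
  · subst hl
    simp only [modeDet, if_true, true_implies]
    constructor
    · rintro ⟨m, hm, h⟩
      have hn6 : n ≤ 6 := by
        by_contra hcon
        exact det_blockA1_ne_zero (by omega) hm h
      exact ⟨hn6, modeMass_one_pos hn hn6⟩
    · rintro ⟨hn6, hp⟩
      exact ⟨_, hp, (det_blockA1_eq_zero_iff_modeMass hn hn6 hp).2 rfl⟩
  · simp only [modeDet, hl, false_implies, true_and]
    have h3 : 2 ≤ l := by omega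
    rw [modeMass, if_neg hl]
    constructor
    · rintro ⟨m, hm, h⟩
      rwa [← (det_blockA_eq_zero_iff' hn h3 h2).1 h]
    · intro hp
      exact ⟨_, hp, (det_blockA_eq_zero_iff' hn h3 h2).2 rfl⟩

/-- Each singular mode has a single positive mass, so counting degeneracy values reduces to counting
modes, once distinct singular modes are known to have distinct masses. -/
theorem degeneracyValues_eq_image (hn : 3 ≤ n) :
    degeneracyValues n = modeMass n '' degenerateModes n := by
  ext m
  rw [degeneracyValues, Set.mem_ofPred_eq, degenerate_iff hn, Set.mem_image]
  simp only [mem_degenerateModes hn]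
  constructor
  · rintro ⟨hm, h | ⟨l, h2, h3, h⟩⟩
    · have hn6 : n ≤ 6 := by
        by_contra hcon
        exact det_blockA1_ne_zero (by omega) hm h
      exact ⟨1, ⟨⟨le_rfl, by omega⟩, fun _ => hn6, modeMass_one_pos hn hn6⟩,
        ((det_blockA1_eq_zero_iff_modeMass hn hn6 hm).1 h).symm⟩
    · have hl : l ≠ 1 := by omega
      have e : modeMass n l = m := by
        rw [modeMass, if_neg hl, ← (det_blockA_eq_zero_iff' hn h2 h3).1 h]
      exact ⟨l, ⟨⟨by omega, h3⟩, fun h => absurd h hl, by rwa [e]⟩, e⟩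
  · rintro ⟨l, ⟨⟨h1, h2⟩, h3, h4⟩, rfl⟩
    refine ⟨h4, ?_⟩
    by_cases hl : l = 1
    · subst hl
      exact Or.inl ((det_blockA1_eq_zero_iff_modeMass hn (h3 rfl) h4).2 rfl)
    · refine Or.inr ⟨l, by omega, h2, ?_⟩
      rw [det_blockA_eq_zero_iff' hn (by omega) h2, modeMass, if_neg hl]

theorem modeMass_pos_iff {l : ℕ} (hl : 2 ≤ l) : 0 < modeMass n l ↔ 0 < gonF n (l - 1) := by
  rw [modeMass, if_neg (by omega)]
  constructor <;> intro h <;> linarith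

theorem degenerateModes_small (hn : 3 ≤ n) (hn' : n ≤ 5) : degenerateModes n = {1} := by
  ext l
  rw [mem_degenerateModes hn, Set.mem_singleton_iff]
  constructor
  · rintro ⟨⟨h1, h2⟩, -, h4⟩
    by_contra hl
    obtain rfl : l = 2 := by omega
    exact absurd ((modeMass_pos_iff le_rfl).1 h4) (gonF_one_neg (by omega) (by omega)).le.not_gt
  · rintro rfl
    exact ⟨⟨le_rfl, by omega⟩, fun _ => by omega, modeMass_one_pos hn (by omega)⟩

theorem degenerateModes_six (hn : n = 6) : degenerateModes n = {1, 3} := by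
  ext l
  rw [mem_degenerateModes (by omega), Set.mem_insert_iff, Set.mem_singleton_iff]
  constructor
  · rintro ⟨⟨h1, h2⟩, -, h4⟩
    by_contra hl
    obtain rfl : l = 2 := by omega
    exact absurd ((modeMass_pos_iff le_rfl).1 h4) (gonF_one_neg (by omega) (by omega)).le.not_gt
  · rintro (rfl | rfl)
    · exact ⟨⟨le_rfl, by omega⟩, fun _ => by omega, modeMass_one_pos (by omega) (by omega)⟩
    · exact ⟨⟨by omega, by omega⟩, fun h => by omega,
        (modeMass_pos_iff (by omega)).2 (gonF_two_pos (by omega))⟩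

theorem degenerateModes_medium (hn : 7 ≤ n) (hn' : n ≤ 9) :
    degenerateModes n = Finset.Icc 3 (n / 2) := by
  ext l
  rw [mem_degenerateModes (by omega), Finset.coe_Icc, Set.mem_Icc]
  constructor
  · rintro ⟨⟨h1, h2⟩, h3, h4⟩
    refine ⟨?_, h2⟩
    by_contra hl
    obtain rfl | rfl : l = 1 ∨ l = 2 := by omega
    · have := h3 rfl
      omega
    · exact absurd ((modeMass_pos_iff le_rfl).1 h4) (gonF_one_neg (by omega) (by omega)).le.not_gt
  · rintro ⟨h1, h2⟩
    exact ⟨⟨by omega, h2⟩, fun h => by omega,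
      (modeMass_pos_iff (by omega)).2 (gonF_pos (by omega) (by omega))⟩

theorem degenerateModes_large (hn : 10 ≤ n) : degenerateModes n = Finset.Icc 2 (n / 2) := by
  ext l
  rw [mem_degenerateModes (by omega), Finset.coe_Icc, Set.mem_Icc]
  constructor
  · rintro ⟨⟨h1, h2⟩, h3, -⟩
    refine ⟨?_, h2⟩
    by_contra hl
    have := h3 (by omega)
    omega
  · rintro ⟨h1, h2⟩
    refine ⟨⟨by omega, h2⟩, fun h => by omega, (modeMass_pos_iff h1).2 ?_⟩
    rcases h1.eq_or_lt with rfl | h1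
    · exact gonF_one_pos hn
    · exact gonF_pos (by omega) (by omega)

theorem modeMass_lt {l i : ℕ} (hl : 2 ≤ l) (hli : l < i) (hi : i ≤ n / 2) :
    modeMass n l < modeMass n i := by
  rw [modeMass, modeMass, if_neg (by omega), if_neg (by omega)]
  have := gonF_strictMono (n := n) (l := l - 1) (i := i - 1) (by omega) (by omega)
  linarith

/-- Monotonicity in l does not reach mode 1. At n = 6 the mass of mode 3 is at most 1/6, far too
small to solve the equation of mode 1. -/
theorem modeMass_one_ne_three (hn : n = 6) : modeMass n 1 ≠ modeMass n 3 := by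
  intro h
  have hpos := modeMass_one_pos (n := n) (by omega) (by omega)
  have h1 := (det_blockA1_eq_zero_iff (by omega) hpos).1
    ((det_blockA1_eq_zero_iff_modeMass (by omega) (by omega) hpos).2 rfl)
  rw [h, modeMass, if_neg (by omega)] at h1
  -- For the hexagon g₃ = -g₂, so the fraction in `gonF` vanishes and its lower bound is an
  -- equality.
  have hG := gonG_symm (n := n) (l := 2) (by omega)
  have e3 : n - 1 - 2 = 2 + 1 := by omega
  have e2 : ((2 + 1 : ℕ) : ZMod n) = 3 := by norm_num
  have hF : gonF n 2 =
      3 * cscSum n - 11 / 2 * oddCot n 0 - 3 / 2 * oddCot n 1 + oddCot n 2 / 2 := by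
    rw [e3] at hG
    rw [gonF, hG, add_neg_cancel, e2, gonR_three_eq (by omega), gonP_three_eq (by omega),
      gonP_one_eq]
    ring
  rw [show 3 - 1 = 2 from rfl, hF] at h1
  obtain ⟨a, b, c, d⟩ := trig_bounds_six
  rw [← hn] at a b c d
  have hnr : (n : ℝ) = 6 := by exact_mod_cast hn
  rw [hnr] at h1
  generalize cscSum n = S at *
  generalize oddCot n 0 = k at *
  generalize oddCot n 1 = k3 at *
  generalize oddCot n 2 = k5 at *
  have h2 : 0 ≤ 3 * S - 11 / 2 * k - 3 / 2 * k3 + k5 / 2 := by linarith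
  have h3 : 3 * S - 11 / 2 * k - 3 / 2 * k3 + k5 / 2 ≤ 1 := by linarith
  -- The equation of mode 1 would equate a quantity of at least 12 with a quarter of one that is at
  -- most 1.
  have h4 : 3 * 4 ≤ (S * 3 / 4 - k / 2) * (6 / 2 + S / 4) :=
    mul_le_mul (by linarith) (by linarith) (by norm_num) (by linarith)
  have h5 : (3 * S - 11 / 2 * k - 3 / 2 * k3 + k5 / 2) * (k / 2 + 6 - S) ≤ 1 * 1 :=
    mul_le_mul h3 (by linarith) (by linarith) (by norm_num)
  linarith

/-- Modes l ≥ 2 are separated by strict monotonicity. Mode 1 is singular only for n ≤ 6, and among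
these only n = 6 has another singular mode, namely 3. -/
theorem modeMass_injOn (hn : 3 ≤ n) : Set.InjOn (modeMass n) (degenerateModes n) := by
  have key : ∀ l ∈ degenerateModes n, ∀ i ∈ degenerateModes n, l < i →
      modeMass n l ≠ modeMass n i := by
    intro l hl i hi hli
    have hi' := ((mem_degenerateModes hn).1 hi).1
    obtain ⟨⟨h1, -⟩, h3, -⟩ := (mem_degenerateModes hn).1 hl
    by_cases hl2 : 2 ≤ l
    · exact (modeMass_lt hl2 hli hi'.2).ne
    · obtain rfl : l = 1 := by omega
      have hn6 := h3 rfl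
      rcases (by omega : n ≤ 5 ∨ n = 6) with h | h
      · rw [degenerateModes_small hn h, Set.mem_singleton_iff] at hi
        omega
      · rw [degenerateModes_six h, Set.mem_insert_iff, Set.mem_singleton_iff] at hi
        obtain rfl : i = 3 := by omega
        exact modeMass_one_ne_three h
  intro l hl i hi h
  rcases lt_trichotomy l i with hlt | heq | hgt
  · exact absurd h (key l hl i hi hlt)
  · exact heq
  · exact absurd h.symm (key i hi l hl hgt)

theorem ncard_degeneracyValues (hn : 3 ≤ n) :
    (degeneracyValues n).ncard = (degenerateModes n).ncard := by
  rw [degeneracyValues_eq_image hn, Set.InjOn.ncard_image (modeMass_injOn hn)]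

theorem degeneracyValues_finite (hn : 3 ≤ n) : (degeneracyValues n).Finite := by
  rw [degeneracyValues_eq_image hn]
  refine Set.Finite.image _ ((Set.finite_Iic (n / 2)).subset fun l hl => ?_)
  exact ((mem_degenerateModes hn).1 hl).1.2

theorem ncard_small (hn : 3 ≤ n) (hn' : n ≤ 5) : (degeneracyValues n).ncard = 1 := by
  rw [ncard_degeneracyValues hn, degenerateModes_small hn hn', Set.ncard_singleton]

theorem ncard_six (hn : n = 6) : (degeneracyValues n).ncard = 2 := by
  rw [ncard_degeneracyValues (by omega), degenerateModes_six hn, Set.ncard_pair (by norm_num)]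

theorem ncard_medium (hn : 7 ≤ n) (hn' : n ≤ 9) : (degeneracyValues n).ncard = n / 2 - 2 := by
  rw [ncard_degeneracyValues (by omega), degenerateModes_medium hn hn', Set.ncard_coe_finset,
    Nat.card_Icc]
  omega

theorem ncard_large (hn : 10 ≤ n) : (degeneracyValues n).ncard = n / 2 - 1 := by
  rw [ncard_degeneracyValues (by omega), degenerateModes_large hn, Set.ncard_coe_finset,
    Nat.card_Icc]
  omega

end

theorem mainTheorem1 :
    (∀ (n : ℕ) [NeZero n], 3 ≤ n →
      -- (1) block structure in the basis adapted to the dihedral group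
      (IsSymmetryAdapted n ∧
        (∃ b : Module.Basis (AdaptedIndex n) ℝ (Config n),
          (∀ x : AdaptedIndex n, b x = blockVector n x.1 x.2) ∧
          ∀ m : ℝ, 0 < m →
            LinearMap.toMatrix b b (hess n m : Config n →ₗ[ℝ] Config n) =
              Matrix.blockDiagonal' (hessBlock n m)) ∧
        (∀ m : ℝ, 0 < m →
          scalarBlock n m (modeV n 0) = 0 ∧ scalarBlock n m (modeW n 0) = 0 ∧
          (Even n → blockA n m (n / 2) =
            Matrix.diagonal
              ![scalarBlock n m (modeV n (n / 2)), scalarBlock n m (modeW n (n / 2))]))) ∧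
      -- (2) degeneracy criterion
      (∀ m : ℝ, 0 < m →
        (Degenerate n m ↔
          (blockA1 n m).det = 0 ∨ ∃ l : ℕ, 2 ≤ l ∧ l ≤ n / 2 ∧ (blockA n m l).det = 0)) ∧
      -- (3) the modes `l ≥ 2`
      (∀ l : ℕ, 2 ≤ l → l ≤ n / 2 →
        {m : ℝ | 0 < m ∧ (blockA n m l).det = 0}.Subsingleton) ∧
      -- (4) the mode `l = 1`
      (n ≤ 6 → ∃! m : ℝ, 0 < m ∧ (blockA1 n m).det = 0) ∧
      (7 ≤ n → ∀ m : ℝ, 0 < m → (blockA1 n m).det ≠ 0) ∧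
      -- (5) the number of degeneracy values
      (degeneracyValues n).Finite ∧
      (degeneracyValues n).ncard = (degenerateModes n).ncard ∧
      (n = 3 → (degeneracyValues n).ncard = 1) ∧
      (4 ≤ n → n ≤ 6 → (degeneracyValues n).ncard = n / 2 - 1) ∧
      (7 ≤ n → n ≤ 9 → (degeneracyValues n).ncard = n / 2 - 2) ∧
      (10 ≤ n → (degeneracyValues n).ncard = n / 2 - 1)) ∧
    (∀ (n : ℕ) [NeZero n], 7 ≤ n →
      (degeneracyValues n).ncard ≤ (degeneracyValues (n + 1)).ncard ∧
      (degeneracyValues n).ncard < (degeneracyValues (n + 2)).ncard) := by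
  refine ⟨fun n _ hn => ⟨⟨isSymmetryAdapted,
    ⟨adaptedBasis hn, adaptedBasis_apply hn, fun m _ => toMatrix_hess hn⟩, fun m _ => ⟨?_, ?_, ?_⟩⟩,
    fun m _ => degenerate_iff hn, ?_, ?_, fun h m hm => det_blockA1_ne_zero h hm,
    degeneracyValues_finite hn, ncard_degeneracyValues hn, fun h => ncard_small hn (by omega), ?_,
    ncard_medium, ncard_large⟩, fun n _ hn => ?_⟩
  · refine scalarBlock_eq (modeV_ne_zero 0) ?_
    rw [← z0_eq_modeV, hess_z0 (by omega), zero_smul]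
  · refine scalarBlock_eq (modeW_ne_zero 0) ?_
    rw [hess_modeW_zero hn, zero_smul]
  · intro he
    have h2 := Nat.two_mul_div_two_of_even he
    rw [blockA_half hn h2, scalarBlock_eq (modeV_ne_zero _) (hess_modeV_half hn h2),
      scalarBlock_eq (modeW_ne_zero _) (hess_modeW_half hn h2)]
  · rintro l hl hl' m₁ ⟨-, h₁⟩ m₂ ⟨-, h₂⟩
    rw [(det_blockA_eq_zero_iff' hn hl hl').1 h₁, (det_blockA_eq_zero_iff' hn hl hl').1 h₂]
  · intro h6
    have hp := modeMass_one_pos hn h6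
    exact ⟨modeMass n 1, ⟨hp, (det_blockA1_eq_zero_iff_modeMass hn h6 hp).2 rfl⟩,
      fun m hm => (det_blockA1_eq_zero_iff_modeMass hn h6 hm.1).1 hm.2⟩
  · intro h4 h6
    rcases (by omega : n ≤ 5 ∨ n = 6) with h | h
    · rw [ncard_small hn h]
      omega
    · rw [ncard_six h]
      omega
  · have h : ∀ (k : ℕ) [NeZero k], 7 ≤ k → (k ≤ 9 ∧ (degeneracyValues k).ncard = k / 2 - 2) ∨
        (10 ≤ k ∧ (degeneracyValues k).ncard = k / 2 - 1) := by
      intro k _ hk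
      rcases (by omega : k ≤ 9 ∨ 10 ≤ k) with h | h
      · exact Or.inl ⟨h, ncard_medium hk h⟩
      · exact Or.inr ⟨h, ncard_large h⟩
    -- The floor of n/2 gains one every two steps, and passing from the offset 2 to the offset 1 at
    -- n = 10 only increases the count.
    have h0 := h n hn
    have h1 := h (n + 1) (by omega)
    have h2 := h (n + 2) (by omega)
    omega
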